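/- Let $m,n\ge 0$ be integers and $\varepsilon>0$. Let $\widehat V:\mathbb R^n\to\mathbb C$ be the Fourier transform of a real potential, i.e. a measurable function with $\widehat V(-S)=\overline{\widehat V(S)}$ for a.e. $S$, and suppose that $$\int_{\mathbb R^n}|\widehat V(S)|\,(|S|+|S|^{m+1})\,dS<\infty .$$ Consider, for functions $W(x,k,t)$ on $\mathbb R^{n}_x\times\mathbb R^n_k$, the Wigner equation $$\partial_t W+2\pi k\cdot\partial_x W+\frac1\varepsilon\int_{\mathbb R^n}\mathrm{Re}\big[i e^{2\pi i S\cdot x}\widehat V(S)\big]\Big(W\big(x,k-\tfrac{\varepsilon S}{2}\big)-W\big(x,k+\tfrac{\varepsilon S}{2}\big)\Big)dS=0,\qquad W(t=0)=W_0 .$$ For real-valued $W$ the last term equals $\frac2\varepsilon\mathrm{Re}\big[i\int e^{2\pi iS\cdot x}\widehat V(S)W(x,k-\frac{\varepsilon S}{2})\,dS\big]$ whenever that integral converges absolutely. Put $$\|f\|_{H^m}=\sum_{|a|+|b|\le m}\|\partial_x^a\partial_k^b f\|_{L^2(\mathbb R^{2n})}$$ (weak derivatives; $\|f\|_{H^m}=\infty$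 if $f\notin H^m$), and $$\|f\|_{H^{-m}}=\sup_{\|g\|_{H^m}\le1}\Big|\int fg\,dx\,dk\Big|,$$ $$D(m,n)=\tfrac12(2\pi)^m\,\big(1+n^{m+1}m!\big)\,\max\Big\{1,\int_{\mathbb R^n}|\widehat V(S)|(|S|+|S|^{m+1})\,dS\Big\},$$ which does not depend on $\varepsilon$. Then for every $T\ge0$ and every complex-valued $W_0\in L^2(\mathbb R^{2n})$ there is exactly one $W\in C([0,T];L^2(\mathbb R^{2n}))$ that solves the Wigner equation in the sense of distributions with $W(0)=W_0$, and for all $t\in[0,T]$ $$\|W(t)\|_{H^m}\le e^{tD(m,n)}\|W_0\|_{H^m},\qquad \|W(t)\|_{H^{-m}}\le e^{tD(m,n)}\|W_0\|_{H^{-m}} .$$ In particular $W(t)\in H^m$ if $W_0\in H^m$. -/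

import Mathlib

open MeasureTheory
open scoped ContDiff ENNReal

noncomputable section

namespace Wigner

/-- Configuration space (positions, momenta and their duals). -/
abbrev Config (n : ℕ) : Type := EuclideanSpace ℝ (Fin n)

/-- Phase space; a point is `z = (x, k)`. -/
abbrev Phase (n : ℕ) : Type := Config n × Config n

/-- Complex-valued square-integrable functions on phase space (Lebesgue measure). -/
abbrev L2 (n : ℕ) : Type := Lp ℂ 2 (volume : Measure (Phase n))

/-- Test functions on phase space: smooth with compact support. -/
def IsTest {n : ℕ} (φ : Phase n → ℂ) : Prop :=
  ContDiff ℝ ∞ φ ∧ HasCompactSupport φ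

/-! ### Derivatives and Sobolev norms -/

/-- The classical partial derivative in the `i`-th position variable. -/
def dx {n : ℕ} (i : Fin n) (φ : Phase n → ℂ) : Phase n → ℂ :=
  fun z => fderiv ℝ φ z (EuclideanSpace.single i 1, 0)

/-- The classical partial derivative in the `i`-th momentum variable. -/
def dk {n : ℕ} (i : Fin n) (φ : Phase n → ℂ) : Phase n → ℂ :=
  fun z => fderiv ℝ φ z (0, EuclideanSpace.single i 1)

/-- The classical mixed derivative `∂_x^a ∂_k^b φ`, for multi-indices `a` and `b`. -/
def mixedDeriv {n : ℕ} (a b : Fin n → ℕ) (φ : Phase n → ℂ) : Phase n → ℂ :=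
  (List.finRange n).foldr (fun i ψ => (dx i)^[a i] ψ)
    ((List.finRange n).foldr (fun i ψ => (dk i)^[b i] ψ) φ)

/-- `g` is the weak derivative `∂_x^a ∂_k^b f`. -/
def HasWeakDeriv {n : ℕ} (a b : Fin n → ℕ) (f g : L2 n) : Prop :=
  ∀ φ : Phase n → ℂ, IsTest φ →
    ∫ z, f z * mixedDeriv a b φ z = (-1) ^ (∑ i, a i + ∑ i, b i) * ∫ z, g z * φ z

/-- `‖∂_x^a ∂_k^b f‖_{L²}`, which is `∞` when the weak derivative is not an `L²` function
(a weak derivative is unique, so the infimum is over at most one function). -/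
def derivNorm {n : ℕ} (a b : Fin n → ℕ) (f : L2 n) : ℝ≥0∞ :=
  ⨅ (g : L2 n) (_ : HasWeakDeriv a b f g), ‖g‖ₑ

/-- The Sobolev norm `∑_{|a| + |b| ≤ m} ‖∂_x^a ∂_k^b f‖_{L²}`, which is `∞` exactly when `f` is
not in `H^m`. The pair `(a, b)` is encoded as one multi-index `α` on `Fin n ⊕ Fin n`, and
`Finset.piAntidiag Finset.univ j` is the set of the `α` with `|α| = j`. -/
def sobolevNorm {n : ℕ} (m : ℕ) (f : L2 n) : ℝ≥0∞ :=
  ∑ j ∈ Finset.range (m + 1),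
    ∑ α ∈ Finset.piAntidiag (Finset.univ : Finset (Fin n ⊕ Fin n)) j,
      derivNorm (fun i => α (Sum.inl i)) (fun i => α (Sum.inr i)) f

/-- The norm of `f` in the dual `H^{-m}` of `H^m`. -/
def dualSobolevNorm {n : ℕ} (m : ℕ) (f : L2 n) : ℝ≥0∞ :=
  ⨆ (g : L2 n) (_ : sobolevNorm m g ≤ 1), ‖∫ z, f z * g z‖ₑ

/-! ### The Wigner equation -/

/-- `Re (i e^{2πi S·x} V̂(S))`. -/
def potKernel {n : ℕ} (Vhat : Config n → ℂ) (x S : Config n) : ℝ :=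
  (Complex.I * Complex.exp ((2 * Real.pi * inner ℝ S x : ℝ) * Complex.I) * Vhat S).re

/-- The potential term of the Wigner equation,
`(1/ε) ∫ Re (i e^{2πi S·x} V̂(S)) (w(x, k - εS/2) - w(x, k + εS/2)) dS`.
As `V̂(-S)` is the conjugate of `V̂(S)`, the kernel is odd in `S`, so for real-valued `w` this is
`(2/ε) Re (i ∫ e^{2πi S·x} V̂(S) w(x, k - εS/2) dS)` (see `potTerm_eq`); the symmetric form is
linear over `ℂ`, and it converges for smooth `w` when only `|S| V̂(S)`, but not necessarily `V̂`,
is integrable. -/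
def potTerm {n : ℕ} (ε : ℝ) (Vhat : Config n → ℂ) (w : Phase n → ℂ) : Phase n → ℂ :=
  fun z => (1 / ε : ℝ) * ∫ S : Config n, (potKernel Vhat z.1 S : ℂ) *
    (w (z.1, z.2 - (ε / 2) • S) - w (z.1, z.2 + (ε / 2) • S))

/-- `W`, continuous from `[0,T]` to `L²`, solves
`∂_t W + 2π k·∂_x W + (potential term of W) = 0`, `W(0) = W₀`, in the sense of distributions.
Both the transport term and the potential term are antisymmetric for the bilinear pairing
`∫ f g`, hence the sign on the right-hand side. -/
structure IsSolution {n : ℕ} (ε : ℝ) (Vhat : Config n → ℂ) (T : ℝ) (W₀ : L2 n)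
    (W : ℝ → L2 n) : Prop where
  continuousOn : ContinuousOn W (Set.Icc 0 T)
  initial : W 0 = W₀
  weak : ∀ φ : Phase n → ℂ, IsTest φ → ∀ t ∈ Set.Icc 0 T,
    (∫ z, W t z * φ z) - ∫ z, W₀ z * φ z =
      ∫ s in (0 : ℝ)..t, ∫ z : Phase n, W s z *
        (2 * Real.pi * fderiv ℝ φ z (z.2, 0) + potTerm ε Vhat φ z)

/-- The growth rate
`(1/2) (2π)^m (1 + n^{m+1} m!) max {1, ∫ |V̂(S)| (|S| + |S|^{m+1}) dS}`. -/
def rate (m n : ℕ) (Vhat : Config n → ℂ) : ℝ :=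
  (2 * Real.pi) ^ m / 2 * (1 + (n : ℝ) ^ (m + 1) * (m.factorial : ℝ)) *
    max 1 (∫ S, ‖Vhat S‖ * (‖S‖ + ‖S‖ ^ (m + 1)))

/-- For real-valued `w` and convergent integrals, the potential term is the usual one. -/
theorem potTerm_eq {n : ℕ} (ε : ℝ) (Vhat : Config n → ℂ)
    (hherm : ∀ᵐ S, Vhat (-S) = (starRingEnd ℂ) (Vhat S)) (w : Phase n → ℝ) (z : Phase n)
    (hint : Integrable fun S : Config n =>
      Complex.exp ((2 * Real.pi * inner ℝ S z.1 : ℝ) * Complex.I) * Vhat S *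
        (w (z.1, z.2 - (ε / 2) • S) : ℂ)) :
    potTerm ε Vhat (fun y => (w y : ℂ)) z =
      ((2 / ε * (Complex.I * ∫ S : Config n,
        Complex.exp ((2 * Real.pi * inner ℝ S z.1 : ℝ) * Complex.I) * Vhat S *
          (w (z.1, z.2 - (ε / 2) • S) : ℂ)).re : ℝ) : ℂ) := by
  set G : Config n → ℝ := fun S => potKernel Vhat z.1 S * w (z.1, z.2 - (ε / 2) • S) with hG
  have hGre : ∀ S, G S = (Complex.I * (Complex.exp
      ((2 * Real.pi * inner ℝ S z.1 : ℝ) * Complex.I) * Vhat S *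
        (w (z.1, z.2 - (ε / 2) • S) : ℂ))).re := by
    intro S
    rw [← mul_assoc, ← mul_assoc, Complex.re_mul_ofReal]
    rfl
  have hGi : Integrable G := by
    have := (hint.const_mul Complex.I).re
    exact this.congr (Filter.Eventually.of_forall fun S => (hGre S).symm)
  have hodd : ∀ᵐ S : Config n, G (-S) =
      -(potKernel Vhat z.1 S * w (z.1, z.2 + (ε / 2) • S)) := by
    filter_upwards [hherm] with S hS
    have : potKernel Vhat z.1 (-S) = - potKernel Vhat z.1 S := by
      simp only [potKernel, hS, inner_neg_left, mul_neg, Complex.ofReal_neg, neg_mul]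
      have h : Complex.exp (-(((2 * Real.pi * inner ℝ S z.1 : ℝ) : ℂ) * Complex.I)) =
          (starRingEnd ℂ) (Complex.exp (((2 * Real.pi * inner ℝ S z.1 : ℝ) : ℂ) * Complex.I)) := by
        rw [← Complex.exp_conj, map_mul, Complex.conj_ofReal, Complex.conj_I, mul_neg]
      rw [h]
      simp only [Complex.mul_re, Complex.mul_im, Complex.conj_re, Complex.conj_im, Complex.I_re,
        Complex.I_im]
      ring
    simp only [hG, this, smul_neg, sub_neg_eq_add, neg_mul]
  have hGn : Integrable fun S => G (-S) := hGi.comp_neg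
  have key : (∫ S, (G S + G (-S))) = 2 * ∫ S, G S := by
    rw [integral_add hGi hGn, integral_neg_eq_self G volume, two_mul]
  have hre : (∫ S, G S) = (Complex.I * ∫ S : Config n,
        Complex.exp ((2 * Real.pi * inner ℝ S z.1 : ℝ) * Complex.I) * Vhat S *
          (w (z.1, z.2 - (ε / 2) • S) : ℂ)).re := by
    rw [← integral_const_mul]
    have := integral_re (hint.const_mul Complex.I)
    simp only [RCLike.re_eq_complex_re] at this
    rw [← this]
    exact integral_congr_ae (Filter.Eventually.of_forall hGre)
  rw [← hre]
  have h2 : (∫ S : Config n, (potKernel Vhat z.1 S : ℂ) *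
      ((w (z.1, z.2 - (ε / 2) • S) : ℂ) - (w (z.1, z.2 + (ε / 2) • S) : ℂ))) =
      ((∫ S, (G S + G (-S)) : ℝ) : ℂ) := by
    rw [← integral_complex_ofReal]
    refine integral_congr_ae ?_
    filter_upwards [hodd] with S hS
    rw [hS]
    simp only [hG]
    push_cast
    ring
  simp only [potTerm]
  rw [h2, key]
  push_cast
  ring

end Wigner

end

noncomputable section

namespace Wigner

open Filter Topology

variable {n m : ℕ}

/-! ### Test functions inside `L²` -/

/-! Write the equation as `∂_t W + 2πk·∂_x W + P W = 0`. The operator `P` is an integral over `S`,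
with density `(i/ε) V̂(S)`, of the differences `f ↦ e^{2πi S·x} (f(x, k - εS/2) - f(x, k + εS/2))`
of two unitary operators. Since `V̂(-S)` is the conjugate of `V̂(S)`, `P` is skew-adjoint
(`re_inner_pot`). Hence the `L²` norm is conserved, and a sum of norms of derivatives can grow only
through commutators.

The commutator of `∂^α` with `2πk·∂_x` exchanges one momentum derivative for a position derivative.
The commutator with `P` comes from the Leibniz rule: derivatives that fall on `e^{2πi S·x}` give
powers of `2πi S` and leave `∂^β W` with `|β| < |α|`. The difference in `k` then costs one momentum
derivative and gains `ε|S|`, which cancels `1/ε`; the total order is still at most `m`, and the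
power of `|S|` lies between `2` and `m + 1` (`norm_jetPot_sub_le`). For the sum of the `L²` norms
what matters are the column sums of the resulting matrix, and `column_coeff_le` bounds them by the
rate. A Gronwall argument that sees only `Re ⟨q, q'⟩` (`sum_norm_le_of_re_inner_le`) gives the
growth, for both directions of time. The propagator for `-t` is the transpose of the one for `t`
(`pair_propagator`), so the bound in `H^{-m}` follows by duality.

To make this rigorous, `V̂` is cut off to an annulus, where `P` is bounded. In the interaction
picture the equation is then an ordinary differential equation with bounded, strongly continuous
coefficients. Regularity is obtained by solving a second equation for the whole family of
derivatives (a jet) in a closed subspace; its first component is the `L²` solution by uniqueness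
(`exists_jet_evol`). Conjugation of constant coefficient operators by transport or by `weyl c S` is
encoded as a substitution in polynomials.

The truncated solutions converge because the error of the potential, as an operator from `H¹` to
`L²`, can be made small even against the exponential growth of the first derivatives
(`nonempty_approx`). The Sobolev bounds survive by lower semicontinuity. For uniqueness, a
difference of two solutions is paired with the backward truncated evolution of a test function; the
derivative of this pairing is again only the truncation error (`norm_pair_toL2_le`). -/

/-- The space of test functions. -/
def testSubmodule (n : ℕ) : Submodule ℂ (Phase n → ℂ) where
  carrier := {φ | IsTest φ}
  add_mem' ha hb := ⟨ha.1.add hb.1, ha.2.add hb.2⟩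
  zero_mem' := ⟨contDiff_const, HasCompactSupport.zero⟩
  smul_mem' c _ h := ⟨h.1.const_smul c, h.2.smul_left (f := fun _ => c)⟩

/-- Test functions as a type. -/
abbrev Test (n : ℕ) : Type := testSubmodule n

theorem Test.contDiff (φ : Test n) : ContDiff ℝ ∞ (φ : Phase n → ℂ) := φ.2.1

theorem Test.hasCompactSupport (φ : Test n) : HasCompactSupport (φ : Phase n → ℂ) := φ.2.2

theorem Test.continuous (φ : Test n) : Continuous (φ : Phase n → ℂ) := φ.2.1.continuous

theorem Test.differentiable (φ : Test n) : Differentiable ℝ (φ : Phase n → ℂ) :=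
  φ.2.1.differentiable (by simp)

theorem Test.memLp (φ : Test n) : MemLp (φ : Phase n → ℂ) 2 :=
  φ.continuous.memLp_of_hasCompactSupport φ.hasCompactSupport

/-- The inclusion of test functions into `L²`. -/
def toL2 : Test n →ₗ[ℂ] L2 n where
  toFun φ := φ.memLp.toLp
  map_add' _ _ := rfl
  map_smul' _ _ := rfl

theorem coeFn_toL2 (φ : Test n) : toL2 φ =ᵐ[volume] (φ : Phase n → ℂ) := φ.memLp.coeFn_toLp

theorem denseRange_toL2 : DenseRange (toL2 : Test n → L2 n) := by
  have h := Lp.dense_hasCompactSupport_contDiff (F := ℂ) (μ := (volume : Measure (Phase n)))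
    (p := 2) (by simp)
  refine h.mono ?_
  rintro f ⟨g, hfg, hg, hg'⟩
  refine ⟨⟨g, hg', hg⟩, ?_⟩
  exact Lp.ext ((coeFn_toL2 _).trans hfg.symm)

/-! ### The bilinear pairing -/

theorem norm_star_L2 (f : L2 n) : ‖star f‖ = ‖f‖ := by
  rw [Lp.norm_def, Lp.norm_def, eLpNorm_congr_ae (Lp.coeFn_star f), eLpNorm_star]

theorem inner_star_L2 (f g : L2 n) : inner ℂ (star f) g = ∫ z, f z * g z := by
  rw [L2.inner_def]
  refine integral_congr_ae ?_
  filter_upwards [Lp.coeFn_star f] with z hz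
  rw [hz]
  simp [mul_comm]

theorem integrable_mul_L2 (f g : L2 n) : Integrable fun z => f z * g z :=
  (Lp.memLp f).integrable_mul (Lp.memLp g)

/-- The bilinear pairing `∫ f g`. -/
def pair : L2 n →L[ℂ] L2 n →L[ℂ] ℂ :=
  LinearMap.mkContinuous₂
    (LinearMap.mk₂ ℂ (fun f g : L2 n => ∫ z, f z * g z)
      (fun f f' g => by
        rw [← integral_add (integrable_mul_L2 f g) (integrable_mul_L2 f' g)]
        refine integral_congr_ae ?_
        filter_upwards [Lp.coeFn_add f f'] with z hz
        rw [hz, Pi.add_apply, add_mul])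
      (fun c f g => by
        rw [← integral_smul]
        refine integral_congr_ae ?_
        filter_upwards [Lp.coeFn_smul c f] with z hz
        rw [hz, Pi.smul_apply, smul_mul_assoc])
      (fun f g g' => by
        rw [← integral_add (integrable_mul_L2 f g) (integrable_mul_L2 f g')]
        refine integral_congr_ae ?_
        filter_upwards [Lp.coeFn_add g g'] with z hz
        rw [hz, Pi.add_apply, mul_add])
      (fun c f g => by
        rw [← integral_smul]
        refine integral_congr_ae ?_
        filter_upwards [Lp.coeFn_smul c g] with z hz
        rw [hz, Pi.smul_apply, mul_smul_comm]))
    1 (fun f g => by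
      simp only [LinearMap.mk₂_apply, one_mul]
      rw [← inner_star_L2, ← norm_star_L2 f]
      exact norm_inner_le_norm _ _)

theorem pair_apply (f g : L2 n) : pair f g = ∫ z, f z * g z := rfl

theorem pair_eq_inner (f g : L2 n) : pair f g = inner ℂ (star f) g := (inner_star_L2 f g).symm

theorem pair_toL2 (f : L2 n) (φ : Test n) : pair f (toL2 φ) = ∫ z, f z * φ.1 z := by
  rw [pair_apply]
  refine integral_congr_ae ?_
  filter_upwards [coeFn_toL2 φ] with z hz
  rw [hz]

theorem pair_comm (f g : L2 n) : pair f g = pair g f := by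
  simp only [pair_apply, mul_comm]

theorem norm_pair_le (f g : L2 n) : ‖pair f g‖ ≤ ‖f‖ * ‖g‖ := by
  rw [pair_eq_inner, ← norm_star_L2 f]
  exact norm_inner_le_norm _ _

/-- The extremal test function is the complex conjugate of `f`, for which the bilinear pairing is
`‖f‖²`. -/
theorem norm_le_of_norm_pair_le {f : L2 n} {C : ℝ} (hC : 0 ≤ C)
    (h : ∀ g, ‖pair f g‖ ≤ C * ‖g‖) : ‖f‖ ≤ C := by
  have h1 := h (star f)
  rw [pair_eq_inner, inner_self_eq_norm_sq_to_K, norm_star_L2] at h1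
  simp only [norm_pow, RCLike.norm_ofReal, abs_norm] at h1
  rcases (norm_nonneg f).eq_or_lt with h0 | h0
  · rwa [← h0]
  · nlinarith

theorem norm_le_of_norm_pair_toL2_le {f : L2 n} {C : ℝ} (hC : 0 ≤ C)
    (h : ∀ φ, ‖pair f (toL2 φ)‖ ≤ C * ‖toL2 φ‖) : ‖f‖ ≤ C :=
  norm_le_of_norm_pair_le hC fun g =>
    denseRange_toL2.induction_on g
      (isClosed_le (by fun_prop) (by fun_prop)) h

theorem eq_of_pair_toL2_eq {f g : L2 n} (h : ∀ φ, pair f (toL2 φ) = pair g (toL2 φ)) : f = g := by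
  rw [← sub_eq_zero, ← norm_le_zero_iff]
  refine norm_le_of_norm_pair_toL2_le le_rfl fun φ => ?_
  simp [h φ]

/-- The Riesz representation theorem for the bilinear pairing. -/
theorem exists_pair_eq (l : L2 n →L[ℂ] ℂ) {C : ℝ} (hC : 0 ≤ C) (hl : ∀ f, ‖l f‖ ≤ C * ‖f‖) :
    ∃ g : L2 n, ‖g‖ ≤ C ∧ ∀ f, pair g f = l f := by
  set g := star ((InnerProductSpace.toDual ℂ (L2 n)).symm l)
  have hg : ∀ f, pair g f = l f := fun f => by
    rw [pair_eq_inner, star_star, InnerProductSpace.toDual_symm_apply]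
  exact ⟨g, norm_le_of_norm_pair_le hC fun f => by rw [hg]; exact hl f, hg⟩

/-! ### Unimodular weights and measure preserving changes of variables -/

/-- A smooth unimodular weight `χ` together with a smooth measure preserving change of variables
`A`; it acts on functions by `f ↦ χ · (f ∘ A)`. -/
structure Twist (n : ℕ) where
  /-- the weight -/
  χ : Phase n → ℂ
  /-- the change of variables -/
  A : Phase n ≃ₜ Phase n
  contDiff_χ : ContDiff ℝ ∞ χ
  norm_χ : ∀ z, ‖χ z‖ = 1
  contDiff_A : ContDiff ℝ ∞ A
  measurePreserving_A : MeasurePreserving A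

namespace Twist

/-- The action of a twist on test functions. -/
def onTest (Q : Twist n) : Test n →ₗ[ℂ] Test n where
  toFun φ := ⟨fun z => Q.χ z * φ.1 (Q.A z), Q.contDiff_χ.mul (φ.contDiff.comp Q.contDiff_A),
    (φ.hasCompactSupport.comp_homeomorph Q.A).mul_left⟩
  map_add' φ ψ := by
    ext z
    simp [mul_add]
  map_smul' c φ := by
    ext z
    simp [mul_left_comm]

theorem onTest_apply (Q : Twist n) (φ : Test n) (z : Phase n) :
    (Q.onTest φ).1 z = Q.χ z * φ.1 (Q.A z) := rfl

theorem norm_toL2_onTest (Q : Twist n) (φ : Test n) : ‖toL2 (Q.onTest φ)‖ = ‖toL2 φ‖ := by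
  change ‖(Q.onTest φ).memLp.toLp‖ = ‖φ.memLp.toLp‖
  rw [Lp.norm_toLp, Lp.norm_toLp]
  congr 1
  rw [← eLpNorm_comp_measurePreserving φ.memLp.1 Q.measurePreserving_A]
  refine eLpNorm_congr_norm_ae (Eventually.of_forall fun z => ?_)
  rw [onTest_apply, norm_mul, Q.norm_χ, one_mul, Function.comp_apply]

/-- The action of a twist on `L²`. -/
def onL2 (Q : Twist n) : L2 n →L[ℂ] L2 n := (toL2 ∘ₗ Q.onTest).extendOfNorm toL2

theorem onL2_toL2 (Q : Twist n) (φ : Test n) : Q.onL2 (toL2 φ) = toL2 (Q.onTest φ) :=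
  LinearMap.extendOfNorm_eq denseRange_toL2
    ⟨1, fun φ => by simp [Q.norm_toL2_onTest]⟩ φ

theorem norm_onL2 (Q : Twist n) (f : L2 n) : ‖Q.onL2 f‖ = ‖f‖ :=
  denseRange_toL2.induction_on f (isClosed_eq (by fun_prop) (by fun_prop))
    fun φ => by rw [onL2_toL2, norm_toL2_onTest]

/-- Two twists are transposes of each other. -/
def IsTranspose (Q Q' : Twist n) : Prop :=
  ∀ z, Q'.A (Q.A z) = z ∧ Q'.χ (Q.A z) = Q.χ z

/-- On test functions this is the change of variables by `Q.A`, which preserves the measure; both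
sides are continuous in `f` and in `g`. -/
theorem IsTranspose.pair_onL2 {Q Q' : Twist n} (h : IsTranspose Q Q') (f g : L2 n) :
    pair (Q.onL2 f) g = pair f (Q'.onL2 g) := by
  refine denseRange_toL2.induction_on f (isClosed_eq (by fun_prop) (by fun_prop)) fun φ => ?_
  refine denseRange_toL2.induction_on g (isClosed_eq (by fun_prop) (by fun_prop)) fun ψ => ?_
  rw [onL2_toL2, onL2_toL2, pair_toL2, pair_comm, pair_toL2]
  have h1 : ∫ z, toL2 (Q.onTest φ) z * ψ.1 z = ∫ z, (Q.onTest φ).1 z * ψ.1 z :=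
    integral_congr_ae (by filter_upwards [coeFn_toL2 (Q.onTest φ)] with z hz; rw [hz])
  have h2 : ∫ z, toL2 (Q'.onTest ψ) z * φ.1 z = ∫ z, (Q'.onTest ψ).1 z * φ.1 z :=
    integral_congr_ae (by filter_upwards [coeFn_toL2 (Q'.onTest ψ)] with z hz; rw [hz])
  rw [h1, h2, ← Q.measurePreserving_A.integral_comp Q.A.measurableEmbedding
    (fun z => (Q'.onTest ψ).1 z * φ.1 z)]
  refine integral_congr_ae (Eventually.of_forall fun z => ?_)
  simp only [onTest_apply, (h z).1, (h z).2]
  ring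

theorem onL2_comp {Q Q' R : Twist n} (h : ∀ φ, Q.onTest (Q'.onTest φ) = R.onTest φ) (f : L2 n) :
    Q.onL2 (Q'.onL2 f) = R.onL2 f := by
  refine denseRange_toL2.induction_on f (isClosed_eq (by fun_prop) (by fun_prop)) fun φ => ?_
  simp only [onL2_toL2, h]

theorem onL2_eq_self {Q : Twist n} (h : ∀ φ, Q.onTest φ = φ) (f : L2 n) : Q.onL2 f = f := by
  refine denseRange_toL2.induction_on f (isClosed_eq (by fun_prop) (by fun_prop)) fun φ => ?_
  simp only [onL2_toL2, h]

end Twist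

/-- The free transport `f ↦ f (x - 2πtk, k)`. -/
def flow (t : ℝ) : Twist n where
  χ _ := 1
  A :=
    { toFun := fun z => (z.1 - (2 * Real.pi * t) • z.2, z.2)
      invFun := fun z => (z.1 + (2 * Real.pi * t) • z.2, z.2)
      left_inv := fun z => by simp
      right_inv := fun z => by simp
      continuous_toFun := by fun_prop
      continuous_invFun := by fun_prop }
  contDiff_χ := contDiff_const
  norm_χ := by simp
  contDiff_A := by
    change ContDiff ℝ ∞ fun z : Phase n => (z.1 - (2 * Real.pi * t) • z.2, z.2)
    fun_prop
  measurePreserving_A := by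
    change MeasurePreserving fun z : Phase n => (z.1 - (2 * Real.pi * t) • z.2, z.2)
    -- A skew product shears the second coordinate, so the shear of the first one is obtained by
    -- conjugation with the swap.
    have h : MeasurePreserving (fun z : Phase n => (z.1, z.2 - (2 * Real.pi * t) • z.1)) :=
      (MeasurePreserving.id volume).skew_product (g := fun x y => y - (2 * Real.pi * t) • x)
        (by fun_prop)
        (Eventually.of_forall fun x => (measurePreserving_sub_right volume _).map_eq)
    have hs : MeasurePreserving (Prod.swap : Phase n → Phase n) := Measure.measurePreserving_swap
    exact (hs.comp h).comp hs

theorem flow_χ (t : ℝ) (z : Phase n) : (flow t).χ z = 1 := rfl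

theorem flow_A (t : ℝ) (z : Phase n) : (flow t).A z = (z.1 - (2 * Real.pi * t) • z.2, z.2) := rfl

/-- The operator `f ↦ e^{2πi S·x} f (x, k + cS)`. -/
def weyl (c : ℝ) (S : Config n) : Twist n where
  χ z := Complex.exp ((2 * Real.pi * inner ℝ S z.1 : ℝ) * Complex.I)
  A := Homeomorph.addRight (0, c • S)
  contDiff_χ := by
    refine ContDiff.cexp (ContDiff.mul ?_ contDiff_const)
    exact Complex.ofRealCLM.contDiff.comp
      (contDiff_const.mul (contDiff_const.inner ℝ contDiff_fst))
  norm_χ z := Complex.norm_exp_ofReal_mul_I _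
  contDiff_A := by
    change ContDiff ℝ ∞ fun z : Phase n => z + (0, c • S)
    fun_prop
  measurePreserving_A := by
    change MeasurePreserving fun z : Phase n => (z.1 + 0, z.2 + c • S)
    simp only [add_zero]
    exact (MeasurePreserving.id volume).prod (measurePreserving_add_right volume (c • S))

theorem weyl_χ (c : ℝ) (S : Config n) (z : Phase n) :
    (weyl c S).χ z = Complex.exp ((2 * Real.pi * inner ℝ S z.1 : ℝ) * Complex.I) := rfl

theorem weyl_A (c : ℝ) (S : Config n) (z : Phase n) : (weyl c S).A z = (z.1, z.2 + c • S) := by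
  simp [weyl, Prod.ext_iff]

theorem isTranspose_flow (t : ℝ) : (flow t : Twist n).IsTranspose (flow (-t)) := fun z => by
  simp [flow_A, flow_χ]

theorem isTranspose_weyl (c : ℝ) (S : Config n) : (weyl c S).IsTranspose (weyl (-c) S) := fun z => by
  simp [weyl_A, weyl_χ]

theorem flow_add (s t : ℝ) (f : L2 n) :
    (flow s).onL2 ((flow t).onL2 f) = (flow (s + t)).onL2 f := by
  refine Twist.onL2_comp (fun φ => ?_) f
  ext z
  simp only [Twist.onTest_apply, flow_χ, flow_A, one_mul]
  have h : z.1 - (2 * Real.pi * s) • z.2 - (2 * Real.pi * t) • z.2 =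
      z.1 - (2 * Real.pi * (s + t)) • z.2 := by module
  rw [h]

theorem flow_zero (f : L2 n) : (flow 0).onL2 f = f :=
  Twist.onL2_eq_self (fun φ => by ext z; simp [Twist.onTest_apply, flow_χ, flow_A]) f

section

open MvPolynomial

/-! ### Constant coefficient differential operators on test functions -/

/-- Labels of the coordinates of phase space. -/
abbrev Idx (n : ℕ) : Type := Fin n ⊕ Fin n

/-- The coordinate directions of phase space. -/
def dir : Idx n → Phase n
  | Sum.inl i => (EuclideanSpace.single i 1, 0)
  | Sum.inr i => (0, EuclideanSpace.single i 1)

/-- The derivative of a test function in a fixed direction. -/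
def dirDeriv (v : Phase n) : Test n →ₗ[ℂ] Test n where
  toFun φ := ⟨fun z => fderiv ℝ φ.1 z v,
    (φ.contDiff.fderiv_right (m := ∞) (by simp)).clm_apply contDiff_const,
    φ.hasCompactSupport.fderiv_apply ℝ v⟩
  map_add' φ ψ := by
    ext z
    simp [fderiv_add (φ.differentiable z) (ψ.differentiable z)]
  map_smul' c φ := by
    ext z
    simp [fderiv_const_smul (φ.differentiable z)]

/-- Partial derivatives of test functions. -/
abbrev pd (e : Idx n) : Module.End ℂ (Test n) := dirDeriv (dir e)

theorem dirDeriv_apply (v : Phase n) (φ : Test n) (z : Phase n) :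
    (dirDeriv v φ).1 z = fderiv ℝ φ.1 z v := rfl

theorem dirDeriv_comm (v w : Phase n) (φ : Test n) :
    dirDeriv v (dirDeriv w φ) = dirDeriv w (dirDeriv v φ) := by
  ext z
  have hd : DifferentiableAt ℝ (fderiv ℝ φ.1) z :=
    (φ.contDiff.fderiv_right (m := ∞) (by simp)).differentiable (by simp) z
  have key : ∀ v w : Phase n,
      (dirDeriv v (dirDeriv w φ)).1 z = fderiv ℝ (fderiv ℝ φ.1) z v w := fun v w => by
    change fderiv ℝ (fun z => fderiv ℝ φ.1 z w) z v = _
    rw [fderiv_clm_apply hd (differentiableAt_const w)]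
    simp
  rw [key, key]
  exact (φ.contDiff.contDiffAt.isSymmSndFDerivAt
    (by simpa using WithTop.coe_le_coe.2 (le_top : (2 : ℕ∞) ≤ ⊤))).eq v w

theorem commute_pd (e e' : Idx n) : Commute (pd e : Module.End ℂ (Test n)) (pd e') :=
  LinearMap.ext fun φ => dirDeriv_comm _ _ φ

theorem dirDeriv_inr (S : Config n) (φ : Test n) :
    dirDeriv (0, S) φ = ∑ i, ((S i : ℝ) : ℂ) • pd (Sum.inr i) φ := by
  ext z
  have hS : ((0 : Config n), S) = ∑ i, S i • dir (Sum.inr i) := by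
    refine Prod.ext ?_ ?_
    · simp [dir, Prod.fst_sum]
    · ext j
      simp [dir, Prod.snd_sum, Finset.sum_apply, Pi.single_apply]
  have hc : (((∑ i, ((S i : ℝ) : ℂ) • pd (Sum.inr i) φ : Test n)) : Phase n → ℂ) z =
      ∑ i, ((S i : ℝ) : ℂ) • fderiv ℝ φ.1 z (dir (Sum.inr i)) := by
    simp [dirDeriv_apply]
  rw [hc, dirDeriv_apply, hS, map_sum]
  simp

/-- Commutativity moves the extra factor to the front, and `Nodup` ensures that it occurs exactly
once. This is the recursion behind `monoDeriv_add_single`. -/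
theorem prod_map_pow_add_ite {M ι : Type*} [Monoid M] [DecidableEq ι] {g : ι → M}
    (hg : ∀ i j, Commute (g i) (g j)) (a : ι → ℕ) {j : ι} :
    ∀ {l : List ι}, l.Nodup → j ∈ l →
      (l.map fun i => g i ^ (a i + if i = j then 1 else 0)).prod =
        g j * (l.map fun i => g i ^ a i).prod
  | [], _, h => by simp at h
  | i :: l, hl, h => by
    rw [List.nodup_cons] at hl
    simp only [List.map_cons, List.prod_cons]
    by_cases hij : i = j
    · subst hij
      rw [if_pos rfl, pow_succ', mul_assoc]
      congr 3
      refine List.map_congr_left fun k hk => ?_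
      rw [if_neg (by rintro rfl; exact hl.1 hk), add_zero]
    · rw [if_neg hij, add_zero, prod_map_pow_add_ite hg a hl.2
        ((List.mem_cons.1 h).resolve_left (Ne.symm hij)), ← mul_assoc, ← mul_assoc,
        ((hg i j).pow_left _).eq]

/-- The monomial differential operator `∂^β`. -/
def monoDeriv (β : Idx n →₀ ℕ) : Module.End ℂ (Test n) :=
  ((List.finRange n).map fun i => pd (Sum.inl i) ^ β (Sum.inl i)).prod *
    ((List.finRange n).map fun i => pd (Sum.inr i) ^ β (Sum.inr i)).prod

theorem monoDeriv_zero : monoDeriv (0 : Idx n →₀ ℕ) = 1 := by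
  simp [monoDeriv]

theorem monoDeriv_add_single (β : Idx n →₀ ℕ) (e : Idx n) :
    monoDeriv (β + Finsupp.single e 1) = pd e * monoDeriv β := by
  classical
  rcases e with j | j
  · have := prod_map_pow_add_ite (g := fun i => (pd (Sum.inl i) : Module.End ℂ (Test n)))
      (fun i j => commute_pd _ _) (fun i => β (Sum.inl i)) (List.nodup_finRange n)
      (List.mem_finRange j)
    simp only [monoDeriv, ← mul_assoc, ← this]
    congr 3
    · ext i : 1
      simp [Finsupp.single_apply, eq_comm]
    · ext i : 1
      simp
  · have := prod_map_pow_add_ite (g := fun i => (pd (Sum.inr i) : Module.End ℂ (Test n)))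
      (fun i j => commute_pd _ _) (fun i => β (Sum.inr i)) (List.nodup_finRange n)
      (List.mem_finRange j)
    have hc : Commute (pd (Sum.inr j))
        ((List.finRange n).map fun i => (pd (Sum.inl i) : Module.End ℂ (Test n)) ^
          β (Sum.inl i)).prod := by
      refine Commute.list_prod_right _ _ fun x hx => ?_
      obtain ⟨i, -, rfl⟩ := List.mem_map.1 hx
      exact (commute_pd _ _).pow_right _
    simp only [monoDeriv]
    rw [← mul_assoc, hc.eq, mul_assoc, ← this]
    congr 3
    · ext i : 1
      simp
    · ext i : 1
      simp [Finsupp.single_apply, eq_comm]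

/-- The bridge between the algebra of differential operators and the iterated derivatives in the
definition of the Sobolev norm. -/
theorem coe_monoDeriv (β : Idx n →₀ ℕ) (φ : Test n) :
    (monoDeriv β φ : Phase n → ℂ) =
      mixedDeriv (fun i => β (Sum.inl i)) (fun i => β (Sum.inr i)) φ := by
  have hit : ∀ (d : (Phase n → ℂ) → Phase n → ℂ) (P : Module.End ℂ (Test n)),
      (∀ ψ : Test n, (P ψ : Phase n → ℂ) = d ψ) → ∀ (k : ℕ) (ψ : Test n),
        ((P ^ k) ψ : Phase n → ℂ) = d^[k] ψ := fun d P h k => by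
    induction k with
    | zero => intro ψ; rfl
    | succ k ih =>
      intro ψ
      rw [pow_succ, Module.End.mul_apply, ih, h, Function.iterate_succ_apply]
  have hfold : ∀ (d : Fin n → (Phase n → ℂ) → Phase n → ℂ) (P : Fin n → Module.End ℂ (Test n)),
      (∀ i (ψ : Test n), (P i ψ : Phase n → ℂ) = d i ψ) → ∀ (a : Fin n → ℕ) (l : List (Fin n))
        (ψ : Test n), ((l.map fun i => P i ^ a i).prod ψ : Phase n → ℂ) =
          l.foldr (fun i χ => (d i)^[a i] χ) ψ := fun d P h a l => by
    induction l with
    | nil => intro ψ; rfl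
    | cons i l ih =>
      intro ψ
      rw [List.map_cons, List.prod_cons, Module.End.mul_apply, hit (d i) _ (h i), ih,
        List.foldr_cons]
  rw [monoDeriv, Module.End.mul_apply, hfold dx _ (fun i ψ => rfl), hfold dk _ (fun i ψ => rfl)]
  rfl

/-- The differential operator `P(∂)` on test functions. -/
def diffOp : MvPolynomial (Idx n) ℂ →ₗ[ℂ] Module.End ℂ (Test n) :=
  (basisMonomials (Idx n) ℂ).constr ℂ monoDeriv

theorem diffOp_monomial (β : Idx n →₀ ℕ) : diffOp (monomial β (1 : ℂ)) = monoDeriv β := by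
  have := (basisMonomials (Idx n) ℂ).constr_basis ℂ (monoDeriv (n := n)) β
  simpa [diffOp] using this

theorem diffOp_C (c : ℂ) : diffOp (C c : MvPolynomial (Idx n) ℂ) = c • 1 := by
  have h : (C c : MvPolynomial (Idx n) ℂ) = c • monomial 0 1 := by
    rw [smul_monomial, smul_eq_mul, mul_one]; rfl
  rw [h, map_smul, diffOp_monomial, monoDeriv_zero]

theorem diffOp_mul_X (P : MvPolynomial (Idx n) ℂ) (e : Idx n) :
    diffOp (P * X e) = pd e * diffOp P := by
  induction P using MvPolynomial.induction_on' with
  | monomial β c =>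
    have h : (monomial β c : MvPolynomial (Idx n) ℂ) = c • monomial β 1 := by
      rw [smul_monomial, smul_eq_mul, mul_one]
    rw [h, smul_mul_assoc, map_smul, map_smul, X, monomial_mul, one_mul, diffOp_monomial,
      diffOp_monomial, monoDeriv_add_single, mul_smul_comm]
  | add P Q hP hQ => rw [add_mul, map_add, hP, hQ, map_add, mul_add]

/-- The differential operator `P(-∂)` on test functions. -/
def diffOpNeg : MvPolynomial (Idx n) ℂ →ₗ[ℂ] Module.End ℂ (Test n) :=
  diffOp ∘ₗ (aeval fun e => -X e : MvPolynomial (Idx n) ℂ →ₐ[ℂ] MvPolynomial (Idx n) ℂ).toLinearMap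

theorem diffOpNeg_C (c : ℂ) : diffOpNeg (C c : MvPolynomial (Idx n) ℂ) = c • 1 := by
  simp [diffOpNeg, ← diffOp_C, MvPolynomial.algebraMap_eq]

theorem diffOpNeg_mul_X (P : MvPolynomial (Idx n) ℂ) (e : Idx n) :
    diffOpNeg (P * X e) = -(pd e * diffOpNeg P) := by
  simp [diffOpNeg, diffOp_mul_X]

theorem diffOpNeg_monomial (β : Idx n →₀ ℕ) :
    diffOpNeg (monomial β (1 : ℂ)) = (-1 : ℂ) ^ β.degree • monoDeriv β := by
  have h : (aeval fun e => -X e : MvPolynomial (Idx n) ℂ →ₐ[ℂ] MvPolynomial (Idx n) ℂ)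
      (monomial β 1) = (-1 : ℂ) ^ β.degree • monomial β 1 := by
    rw [aeval_monomial, map_one, one_mul, monomial_eq, C_1, one_mul, Finsupp.prod, Finsupp.prod,
      Finsupp.degree_apply, ← Finset.prod_pow_eq_pow_sum, Algebra.smul_def, map_prod,
      ← Finset.prod_mul_distrib]
    refine Finset.prod_congr rfl fun e _ => ?_
    rw [neg_pow, map_pow, map_neg, map_one]
  rw [diffOpNeg, LinearMap.comp_apply, AlgHom.toLinearMap_apply, h, map_smul, diffOp_monomial]

theorem commute_pd_diffOp (e : Idx n) (P : MvPolynomial (Idx n) ℂ) :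
    Commute (pd e) (diffOp P) := by
  induction P using MvPolynomial.induction_on with
  | C c => rw [diffOp_C]; exact (Commute.one_right _).smul_right c
  | add P Q hP hQ => rw [map_add]; exact hP.add_right hQ
  | mul_X P e' h => rw [diffOp_mul_X]; exact (commute_pd e e').mul_right h

/-- `Module.End` is not commutative and `diffOp` is only linear by construction; it is
multiplicative because the partial derivatives commute. -/
theorem diffOp_mul (P R : MvPolynomial (Idx n) ℂ) : diffOp (P * R) = diffOp P * diffOp R := by
  induction R using MvPolynomial.induction_on with
  | C c => rw [mul_comm, ← smul_eq_C_mul, map_smul, diffOp_C, mul_smul_comm, mul_one]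
  | add R R' h h' => rw [mul_add, map_add, h, h', map_add, mul_add]
  | mul_X R e h =>
    rw [← mul_assoc, diffOp_mul_X, h, diffOp_mul_X, ← mul_assoc, (commute_pd_diffOp e P).eq,
      mul_assoc]

theorem diffOp_X (e : Idx n) : diffOp (X e : MvPolynomial (Idx n) ℂ) = pd e := by
  have := diffOp_mul_X (1 : MvPolynomial (Idx n) ℂ) e
  rwa [one_mul, ← C_1, diffOp_C, one_smul, mul_one] at this

theorem diffOpNeg_mul (P R : MvPolynomial (Idx n) ℂ) :
    diffOpNeg (P * R) = diffOpNeg P * diffOpNeg R := by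
  simp [diffOpNeg, diffOp_mul]

theorem diffOpNeg_X (e : Idx n) : diffOpNeg (X e : MvPolynomial (Idx n) ℂ) = -pd e := by
  simp [diffOpNeg, diffOp_X]

instance : (volume : Measure (Phase n)).IsAddHaarMeasure :=
  inferInstanceAs ((volume : Measure (Config n)).prod volume).IsAddHaarMeasure

theorem pair_pd (φ ψ : Test n) (e : Idx n) :
    pair (toL2 φ) (toL2 (pd e ψ)) = -pair (toL2 (pd e φ)) (toL2 ψ) := by
  have h0 : ∀ φ ψ : Test n, pair (toL2 φ) (toL2 ψ) = ∫ z, φ.1 z * ψ.1 z := fun φ ψ => by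
    rw [pair_toL2]
    exact integral_congr_ae (by filter_upwards [coeFn_toL2 φ] with z hz; rw [hz])
  have hi : ∀ φ ψ : Test n, Integrable fun z => φ.1 z * ψ.1 z := fun φ ψ =>
    (φ.continuous.mul ψ.continuous).integrable_of_hasCompactSupport φ.hasCompactSupport.mul_right
  rw [h0, h0]
  exact integral_mul_fderiv_eq_neg_fderiv_mul_of_integrable (hi (pd e φ) ψ) (hi φ (pd e ψ)) (hi φ ψ)
    (fun z _ => φ.differentiable z) (fun z _ => ψ.differentiable z)

/-- Each integration by parts produces one sign, and the substitution `X ↦ -X` in `diffOpNeg`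
absorbs all of them. -/
theorem pair_diffOpNeg (P : MvPolynomial (Idx n) ℂ) (φ ψ : Test n) :
    pair (toL2 φ) (toL2 (diffOpNeg P ψ)) = pair (toL2 (diffOp P φ)) (toL2 ψ) := by
  induction P using MvPolynomial.induction_on generalizing φ with
  | C c => simp [diffOpNeg_C, diffOp_C]
  | add P Q hP hQ => simp [hP, hQ]
  | mul_X P e h =>
    rw [diffOpNeg_mul_X, diffOp_mul_X, (commute_pd_diffOp e P).eq, LinearMap.neg_apply,
      Module.End.mul_apply, Module.End.mul_apply, map_neg, map_neg, pair_pd, neg_neg, h]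

/-! ### Jets: families of derivatives up to a fixed order -/

/-- The multi-indices of order at most `m`. -/
def multiIdx (n m : ℕ) : Finset (Idx n →₀ ℕ) :=
  (Finset.range (m + 1)).biUnion fun j => Finset.finsuppAntidiag Finset.univ j

theorem mem_multiIdx {β : Idx n →₀ ℕ} : β ∈ multiIdx n m ↔ β.degree ≤ m := by
  simp [multiIdx, Finset.mem_finsuppAntidiag, Finsupp.degree_eq_sum]

/-- Families of `L²` functions indexed by the multi-indices of order at most `m`. -/
abbrev Jet (n m : ℕ) : Type := multiIdx n m → L2 n

/-- The zero multi-index. -/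
def zeroIdx : multiIdx n m := ⟨0, mem_multiIdx.2 (by simp)⟩

/-- The contraction of a family with a polynomial, `∑ β, coeff β P • u β`. -/
def contract (P : MvPolynomial (Idx n) ℂ) : Jet n m →L[ℂ] L2 n :=
  ∑ β : multiIdx n m, coeff β.1 P • ContinuousLinearMap.proj β

theorem contract_apply (P : MvPolynomial (Idx n) ℂ) (u : Jet n m) :
    contract P u = ∑ β : multiIdx n m, coeff β.1 P • u β := by
  simp [contract]

theorem contract_add (P R : MvPolynomial (Idx n) ℂ) (u : Jet n m) :
    contract (P + R) u = contract P u + contract R u := by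
  simp [contract_apply, add_smul, Finset.sum_add_distrib]

theorem contract_smul (c : ℂ) (P : MvPolynomial (Idx n) ℂ) (u : Jet n m) :
    contract (c • P) u = c • contract P u := by
  simp [contract_apply, Finset.smul_sum, smul_smul]

theorem contract_monomial (α : multiIdx n m) (u : Jet n m) :
    contract (monomial α.1 1) u = u α := by
  classical
  rw [contract_apply, Finset.sum_eq_single α]
  · simp
  · intro β _ hβ
    rw [coeff_monomial, if_neg (fun h => hβ (Subtype.ext h.symm)), zero_smul]
  · simp

/-- The monomials indexed by `multiIdx n m` span the polynomials of degree at most `m`, so linear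
identities on jets need a check on monomials only. -/
theorem induction_totalDegree {motive : MvPolynomial (Idx n) ℂ → Prop}
    (mono : ∀ α : multiIdx n m, motive (monomial α.1 1)) (zero : motive 0)
    (add : ∀ P R, motive P → motive R → motive (P + R))
    (smul : ∀ (c : ℂ) P, motive P → motive (c • P)) {P : MvPolynomial (Idx n) ℂ}
    (hP : P.totalDegree ≤ m) : motive P := by
  rw [P.as_sum]
  refine Finset.sum_induction _ motive add zero fun β hβ => ?_
  have h : (monomial β (coeff β P) : MvPolynomial (Idx n) ℂ) = coeff β P • monomial β 1 := by
    rw [smul_monomial, smul_eq_mul, mul_one]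
  rw [h]
  refine smul _ _ (mono ⟨β, mem_multiIdx.2 ?_⟩)
  exact (le_totalDegree hβ).trans hP

/-- The families `(∂^α f)_α` of weak derivatives. -/
def weakJets (n m : ℕ) : Submodule ℂ (Jet n m) where
  carrier := {u | ∀ (α : multiIdx n m) (φ : Test n),
    pair (u zeroIdx) (toL2 (diffOpNeg (monomial α.1 1) φ)) = pair (u α) (toL2 φ)}
  add_mem' hu hv α φ := by simp [hu α φ, hv α φ]
  zero_mem' α φ := by simp
  smul_mem' c u hu α φ := by simp [hu α φ]

theorem isClosed_weakJets : IsClosed (weakJets n m : Set (Jet n m)) := by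
  have : (weakJets n m : Set (Jet n m)) = ⋂ (α : multiIdx n m) (φ : Test n),
      {u | pair (u zeroIdx) (toL2 (diffOpNeg (monomial α.1 1) φ)) = pair (u α) (toL2 φ)} := by
    ext u
    simp [weakJets]
  rw [this]
  exact isClosed_iInter fun α => isClosed_iInter fun φ => isClosed_eq (by fun_prop) (by fun_prop)

theorem pair_contract {u : Jet n m} (hu : u ∈ weakJets n m) {P : MvPolynomial (Idx n) ℂ}
    (hP : P.totalDegree ≤ m) (φ : Test n) :
    pair (u zeroIdx) (toL2 (diffOpNeg P φ)) = pair (contract P u) (toL2 φ) := by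
  refine induction_totalDegree (motive := fun P =>
    pair (u zeroIdx) (toL2 (diffOpNeg P φ)) = pair (contract P u) (toL2 φ)) ?_ ?_ ?_ ?_ hP
  · intro α
    rw [contract_monomial]
    exact hu α φ
  · simp [contract_apply]
  · intro P R h h'
    simp [contract_add, h, h']
  · intro c P h
    simp [contract_smul, h]

/-- The family of classical derivatives of a test function. -/
def jet (n m : ℕ) : Test n →ₗ[ℂ] Jet n m :=
  LinearMap.pi fun α => toL2 ∘ₗ diffOp (monomial α.1 1)

theorem jet_apply (φ : Test n) (α : multiIdx n m) :
    jet n m φ α = toL2 (diffOp (monomial α.1 1) φ) := rfl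

theorem jet_zeroIdx (φ : Test n) : jet n m φ zeroIdx = toL2 φ := by
  rw [jet_apply]
  change toL2 (diffOp (monomial 0 1) φ) = _
  rw [diffOp_monomial, monoDeriv_zero]
  rfl

theorem contract_jet {P : MvPolynomial (Idx n) ℂ} (hP : P.totalDegree ≤ m) (φ : Test n) :
    contract P (jet n m φ) = toL2 (diffOp P φ) := by
  refine induction_totalDegree (motive := fun P =>
    contract P (jet n m φ) = toL2 (diffOp P φ)) ?_ ?_ ?_ ?_ hP
  · intro α
    rw [contract_monomial, jet_apply]
  · simp [contract_apply]
  · intro P R h h'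
    simp [contract_add, h, h']
  · intro c P h
    simp [contract_smul, h]

/-- The closure of the families of derivatives of test functions. -/
def testJets (n m : ℕ) : Submodule ℂ (Jet n m) := (LinearMap.range (jet n m)).topologicalClosure

theorem isClosed_testJets : IsClosed (testJets n m : Set (Jet n m)) :=
  Submodule.isClosed_topologicalClosure _

theorem jet_mem_testJets (φ : Test n) : jet n m φ ∈ testJets n m :=
  Submodule.le_topologicalClosure _ ⟨φ, rfl⟩

/-- Integration by parts handles test functions, and the relations that define `weakJets` are
closed. -/
theorem testJets_le_weakJets : testJets n m ≤ weakJets n m := by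
  refine Submodule.topologicalClosure_minimal _ ?_ isClosed_weakJets
  rintro _ ⟨φ, rfl⟩ α ψ
  rw [jet_zeroIdx, jet_apply, pair_diffOpNeg]

/-- The component of a family of weak derivatives in the next order. -/
theorem pair_pd_of_mem_weakJets {u : Jet n m} (hu : u ∈ weakJets n m) {α β : multiIdx n m}
    {e : Idx n} (h : β.1 = α.1 + Finsupp.single e 1) (φ : Test n) :
    pair (u α) (toL2 (pd e φ)) = -pair (u β) (toL2 φ) := by
  rw [← hu α, ← hu β, h, ← neg_neg (toL2 (diffOpNeg (monomial α.1 1) (pd e φ))), map_neg]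
  congr 2
  have : (monomial (α.1 + Finsupp.single e 1) 1 : MvPolynomial (Idx n) ℂ) =
      monomial α.1 1 * X e := by
    rw [X, monomial_mul, one_mul]
  rw [this, diffOpNeg_mul, diffOpNeg_X, ← map_neg]
  simp

/-! ### The action of twists on jets -/

/-- The twist `Q`, with transpose `Q'`, turns derivatives into derivatives by means of the
substitution `ψ`. -/
structure Intertwines (Q Q' : Twist n)
    (ψ : MvPolynomial (Idx n) ℂ →ₐ[ℂ] MvPolynomial (Idx n) ℂ) : Prop where
  isTranspose : Q.IsTranspose Q'
  pd_onTest : ∀ e φ, pd e (Q.onTest φ) = Q.onTest (diffOp (ψ (X e)) φ)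
  onTest_pd : ∀ e φ, Q'.onTest (-pd e φ) = diffOpNeg (ψ (X e)) (Q'.onTest φ)
  totalDegree_le : ∀ e, (ψ (X e)).totalDegree ≤ 1

namespace Intertwines

variable {Q Q' : Twist n} {ψ : MvPolynomial (Idx n) ℂ →ₐ[ℂ] MvPolynomial (Idx n) ℂ}

/-- Both `diffOp` and `ψ` are multiplicative, so the commutation rule for single derivatives
propagates to all polynomials. -/
theorem diffOp_onTest (h : Intertwines Q Q' ψ) (P : MvPolynomial (Idx n) ℂ) (φ : Test n) :
    diffOp P (Q.onTest φ) = Q.onTest (diffOp (ψ P) φ) := by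
  induction P using MvPolynomial.induction_on with
  | C c => simp [diffOp_C, ← MvPolynomial.algebraMap_eq]
  | add P R hP hR => simp [hP, hR]
  | mul_X P e hP =>
    rw [diffOp_mul_X, Module.End.mul_apply, hP, h.pd_onTest, map_mul, mul_comm, diffOp_mul,
      Module.End.mul_apply]

theorem onTest_diffOpNeg (h : Intertwines Q Q' ψ) (P : MvPolynomial (Idx n) ℂ) (φ : Test n) :
    Q'.onTest (diffOpNeg P φ) = diffOpNeg (ψ P) (Q'.onTest φ) := by
  induction P using MvPolynomial.induction_on with
  | C c => simp [diffOpNeg_C, ← MvPolynomial.algebraMap_eq]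
  | add P R hP hR => simp [hP, hR]
  | mul_X P e hP =>
    rw [diffOpNeg_mul_X, LinearMap.neg_apply, Module.End.mul_apply, h.onTest_pd, hP, map_mul,
      mul_comm, diffOpNeg_mul, Module.End.mul_apply]

/-- A substitution that is affine in the variables does not raise degrees; hence jets of order `m`
determine the derivatives up to order `m` of the transformed function. -/
theorem totalDegree_monomial_le (h : Intertwines Q Q' ψ) (α : multiIdx n m) :
    (ψ (monomial α.1 1)).totalDegree ≤ m := by
  refine le_trans ?_ (mem_multiIdx.1 α.2)
  rw [monomial_eq, C_1, one_mul, Finsupp.prod, map_prod, Finsupp.degree_apply]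
  refine (totalDegree_finsetProd _ _).trans (Finset.sum_le_sum fun e _ => ?_)
  rw [map_pow]
  refine (totalDegree_pow _ _).trans ?_
  simpa using Nat.mul_le_mul_left (α.1 e) (h.totalDegree_le e)

end Intertwines

/-- The action of a twist on jets. -/
def jetMap (m : ℕ) (Q : Twist n) (ψ : MvPolynomial (Idx n) ℂ →ₐ[ℂ] MvPolynomial (Idx n) ℂ) :
    Jet n m →L[ℂ] Jet n m :=
  ContinuousLinearMap.pi fun α => Q.onL2 ∘L contract (ψ (monomial α.1 1))

theorem jetMap_apply (Q : Twist n) (ψ : MvPolynomial (Idx n) ℂ →ₐ[ℂ] MvPolynomial (Idx n) ℂ)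
    (u : Jet n m) (α : multiIdx n m) :
    jetMap m Q ψ u α = Q.onL2 (contract (ψ (monomial α.1 1)) u) := rfl

theorem jetMap_zeroIdx (Q : Twist n) (ψ : MvPolynomial (Idx n) ℂ →ₐ[ℂ] MvPolynomial (Idx n) ℂ)
    (u : Jet n m) : jetMap m Q ψ u zeroIdx = Q.onL2 (u zeroIdx) := by
  rw [jetMap_apply]
  have h : (monomial (zeroIdx : multiIdx n m).1 1 : MvPolynomial (Idx n) ℂ) = 1 := rfl
  rw [h, map_one, ← h, contract_monomial]

theorem contract_jetMap {Q : Twist n}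
    {ψ : MvPolynomial (Idx n) ℂ →ₐ[ℂ] MvPolynomial (Idx n) ℂ} {P : MvPolynomial (Idx n) ℂ}
    (hP : P.totalDegree ≤ m) (u : Jet n m) :
    contract P (jetMap m Q ψ u) = Q.onL2 (contract (ψ P) u) := by
  refine induction_totalDegree (motive := fun P =>
    contract P (jetMap m Q ψ u) = Q.onL2 (contract (ψ P) u)) ?_ ?_ ?_ ?_ hP
  · intro α
    rw [contract_monomial, jetMap_apply]
  · simp [contract_apply]
  · intro P R h h'
    simp [contract_add, h, h']
  · intro c P h
    simp [contract_smul, h]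

namespace Intertwines

variable {Q Q' : Twist n} {ψ : MvPolynomial (Idx n) ℂ →ₐ[ℂ] MvPolynomial (Idx n) ℂ}

/-- `Q` is moved onto the test function as `Q'`, the derivatives are commuted past it there, and
`Q'` is moved back. No smoothness of the jet is needed. -/
theorem jetMap_mem_weakJets (h : Intertwines Q Q' ψ) {u : Jet n m} (hu : u ∈ weakJets n m) :
    jetMap m Q ψ u ∈ weakJets n m := fun α φ => by
  rw [jetMap_zeroIdx, jetMap_apply, h.isTranspose.pair_onL2, h.isTranspose.pair_onL2,
    Twist.onL2_toL2, Twist.onL2_toL2, h.onTest_diffOpNeg,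
    pair_contract hu (h.totalDegree_monomial_le α)]

theorem jetMap_jet (h : Intertwines Q Q' ψ) (φ : Test n) :
    jetMap m Q ψ (jet n m φ) = jet n m (Q.onTest φ) := by
  ext1 α
  rw [jetMap_apply, jet_apply, contract_jet (h.totalDegree_monomial_le α), Twist.onL2_toL2,
    h.diffOp_onTest]

theorem jetMap_mem_testJets (h : Intertwines Q Q' ψ) {u : Jet n m} (hu : u ∈ testJets n m) :
    jetMap m Q ψ u ∈ testJets n m := by
  have h1 : Set.MapsTo (jetMap m Q ψ) (LinearMap.range (jet n m)) (testJets n m) := by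
    rintro _ ⟨φ, rfl⟩
    rw [h.jetMap_jet]
    exact jet_mem_testJets _
  have h2 := h1.closure (jetMap m Q ψ).continuous hu
  rwa [isClosed_testJets.closure_eq] at h2

end Intertwines

/-! ### Directional derivatives of twisted test functions -/

theorem dirDeriv_add (v w : Phase n) (φ : Test n) :
    dirDeriv (v + w) φ = dirDeriv v φ + dirDeriv w φ := by
  ext z
  simp [dirDeriv_apply]

theorem dirDeriv_smul (c : ℝ) (v : Phase n) (φ : Test n) :
    dirDeriv (c • v) φ = (c : ℂ) • dirDeriv v φ := by
  ext z
  simp [dirDeriv_apply]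

theorem dirDeriv_flow (t : ℝ) (v : Phase n) (φ : Test n) :
    dirDeriv v ((flow t).onTest φ) =
      (flow t).onTest (dirDeriv (v.1 - (2 * Real.pi * t) • v.2, v.2) φ) := by
  ext z
  let A : Phase n →L[ℝ] Phase n :=
    (ContinuousLinearMap.fst ℝ (Config n) (Config n) -
      (2 * Real.pi * t) • ContinuousLinearMap.snd ℝ (Config n) (Config n)).prod
        (ContinuousLinearMap.snd ℝ (Config n) (Config n))
  have h1 : ((flow t).onTest φ).1 = φ.1 ∘ A := by
    ext z
    simp [Twist.onTest_apply, flow_χ, flow_A, A]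
  rw [dirDeriv_apply, h1, fderiv_comp z (φ.differentiable _) A.differentiableAt, A.fderiv]
  simp [Twist.onTest_apply, flow_χ, flow_A, A, dirDeriv_apply]

/-- Product rule: the second term is the derivative of the character, and it vanishes for momentum
directions. -/
theorem dirDeriv_weyl (c : ℝ) (S : Config n) (v : Phase n) (φ : Test n) :
    dirDeriv v ((weyl c S).onTest φ) = (weyl c S).onTest (dirDeriv v φ) +
      (((2 * Real.pi * inner ℝ S v.1 : ℝ) : ℂ) * Complex.I) • (weyl c S).onTest φ := by
  ext z
  have h1 : HasFDerivAt (fun z : Phase n => (2 * Real.pi * inner ℝ S z.1 : ℝ))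
      ((2 * Real.pi) • ((innerSL ℝ S) ∘L ContinuousLinearMap.fst ℝ (Config n) (Config n))) z :=
    (((innerSL ℝ S) ∘L ContinuousLinearMap.fst ℝ (Config n) (Config n)).hasFDerivAt).const_mul _
  have h2 := ((Complex.ofRealCLM.hasFDerivAt.comp z h1).mul_const Complex.I).cexp
  have h3 : HasFDerivAt (fun z : Phase n => φ.1 (z + (0, c • S)))
      (fderiv ℝ φ.1 (z + (0, c • S))) z := by
    have h := HasFDerivAt.comp (f := fun z : Phase n => z + (0, c • S)) z
      (φ.differentiable (z + (0, c • S))).hasFDerivAt ((hasFDerivAt_id z).add_const (0, c • S))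
    rwa [ContinuousLinearMap.comp_id] at h
  have h4 := h2.mul h3
  have h5 : ((weyl c S).onTest φ).1 = fun z : Phase n =>
      Complex.exp ((2 * Real.pi * inner ℝ S z.1 : ℝ) * Complex.I) * φ.1 (z + (0, c • S)) := rfl
  have h6 := congrArg (fun L => L v) h4.fderiv
  have h7 : (((weyl c S).onTest (dirDeriv v φ) +
      (((2 * Real.pi * inner ℝ S v.1 : ℝ) : ℂ) * Complex.I) • (weyl c S).onTest φ : Test n) :
        Phase n → ℂ) z = Complex.exp ((2 * Real.pi * inner ℝ S z.1 : ℝ) * Complex.I) *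
          fderiv ℝ φ.1 (z + (0, c • S)) v + (((2 * Real.pi * inner ℝ S v.1 : ℝ) : ℂ) * Complex.I) *
            (Complex.exp ((2 * Real.pi * inner ℝ S z.1 : ℝ) * Complex.I) *
              φ.1 (z + (0, c • S))) := rfl
  rw [h7, dirDeriv_apply, h5]
  refine h6.trans ?_
  simp
  ring

/-- The substitution belonging to the free transport. -/
def flowSub (t : ℝ) : MvPolynomial (Idx n) ℂ →ₐ[ℂ] MvPolynomial (Idx n) ℂ :=
  aeval (Sum.elim (fun i => X (Sum.inl i))
    (fun i => X (Sum.inr i) - ((2 * Real.pi * t : ℝ) : ℂ) • X (Sum.inl i)))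

theorem flowSub_inl (t : ℝ) (i : Fin n) :
    flowSub t (X (Sum.inl i)) = X (Sum.inl i) := by
  simp [flowSub]

theorem flowSub_inr (t : ℝ) (i : Fin n) :
    flowSub t (X (Sum.inr i)) = X (Sum.inr i) - ((2 * Real.pi * t : ℝ) : ℂ) • X (Sum.inl i) := by
  simp [flowSub]

/-- The frequencies of the character `e^{2πi S·x}`. -/
def freq (S : Config n) : Idx n → ℂ :=
  Sum.elim (fun i => ((2 * Real.pi * S i : ℝ) : ℂ) * Complex.I) 0

theorem freq_eq (S : Config n) (e : Idx n) :
    freq S e = ((2 * Real.pi * inner ℝ S (dir e).1 : ℝ) : ℂ) * Complex.I := by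
  rcases e with i | i
  · simp [freq, dir, EuclideanSpace.inner_single_right]
  · simp [freq, dir]

/-- The substitution belonging to the operators `weyl c S`. -/
def weylSub (S : Config n) : MvPolynomial (Idx n) ℂ →ₐ[ℂ] MvPolynomial (Idx n) ℂ :=
  aeval fun e => X e + C (freq S e)

theorem weylSub_X (S : Config n) (e : Idx n) : weylSub S (X e) = X e + C (freq S e) := by
  simp [weylSub]

theorem pd_weyl (c : ℝ) (S : Config n) (e : Idx n) (φ : Test n) :
    pd e ((weyl c S).onTest φ) = (weyl c S).onTest (pd e φ) + freq S e • (weyl c S).onTest φ := by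
  rw [dirDeriv_weyl, freq_eq]

theorem intertwines_weyl (c : ℝ) (S : Config n) :
    Intertwines (weyl c S) (weyl (-c) S) (weylSub S) where
  isTranspose := isTranspose_weyl c S
  pd_onTest e φ := by
    rw [pd_weyl, weylSub_X, map_add, diffOp_X, diffOp_C]
    simp
  onTest_pd e φ := by
    rw [weylSub_X, map_add, diffOpNeg_X, diffOpNeg_C, map_neg]
    simp only [LinearMap.add_apply, LinearMap.neg_apply, LinearMap.smul_apply, Module.End.one_apply]
    rw [pd_weyl]
    abel
  totalDegree_le e := by
    rw [weylSub_X]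
    refine (totalDegree_add _ _).trans ?_
    simp

theorem pd_inl_flow (t : ℝ) (i : Fin n) (φ : Test n) :
    pd (Sum.inl i) ((flow t).onTest φ) = (flow t).onTest (pd (Sum.inl i) φ) := by
  have h : ((dir (Sum.inl i)).1 - (2 * Real.pi * t) • (dir (Sum.inl i)).2, (dir (Sum.inl i)).2) =
      (dir (Sum.inl i) : Phase n) := by
    simp [dir]
  rw [dirDeriv_flow, h]

theorem pd_inr_flow (t : ℝ) (i : Fin n) (φ : Test n) :
    pd (Sum.inr i) ((flow t).onTest φ) = (flow t).onTest (pd (Sum.inr i) φ) -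
      ((2 * Real.pi * t : ℝ) : ℂ) • (flow t).onTest (pd (Sum.inl i) φ) := by
  have h : ((dir (Sum.inr i)).1 - (2 * Real.pi * t) • (dir (Sum.inr i)).2, (dir (Sum.inr i)).2) =
      dir (Sum.inr i) + (-(2 * Real.pi * t)) • (dir (Sum.inl i) : Phase n) := by
    simp [dir]
  rw [dirDeriv_flow, h, dirDeriv_add, dirDeriv_smul, map_add, map_smul, Complex.ofReal_neg]
  module

theorem intertwines_flow (t : ℝ) :
    Intertwines (flow t : Twist n) (flow (-t)) (flowSub t) where
  isTranspose := isTranspose_flow t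
  pd_onTest e φ := by
    rcases e with i | i
    · rw [flowSub_inl, diffOp_X, pd_inl_flow]
    · rw [flowSub_inr, map_sub, map_smul, diffOp_X, diffOp_X, pd_inr_flow]
      simp
  onTest_pd e φ := by
    rcases e with i | i
    · rw [flowSub_inl, diffOpNeg_X, LinearMap.neg_apply, pd_inl_flow, map_neg]
    · rw [flowSub_inr, map_sub, map_smul, diffOpNeg_X, diffOpNeg_X]
      simp only [LinearMap.sub_apply, LinearMap.neg_apply, LinearMap.smul_apply, map_neg]
      rw [pd_inl_flow, pd_inr_flow, mul_neg, Complex.ofReal_neg]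
      module
  totalDegree_le e := by
    rcases e with i | i
    · rw [flowSub_inl, totalDegree_X]
    · rw [flowSub_inr]
      refine (totalDegree_sub _ _).trans (max_le (totalDegree_X _).le ?_)
      exact (totalDegree_smul_le _ _).trans (totalDegree_X _).le

/-! ### Dependence of the substitutions on parameters -/

theorem continuous_coeff_algHom {T : Type*} [TopologicalSpace T]
    {ψ : T → MvPolynomial (Idx n) ℂ →ₐ[ℂ] MvPolynomial (Idx n) ℂ}
    (h : ∀ e β, Continuous fun s => coeff β (ψ s (X e))) (P : MvPolynomial (Idx n) ℂ) :
    ∀ β, Continuous fun s => coeff β (ψ s P) := by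
  classical
  induction P using MvPolynomial.induction_on with
  | C c =>
    intro β
    simp only [← MvPolynomial.algebraMap_eq, AlgHom.commutes]
    exact continuous_const
  | add P Q hP hQ =>
    intro β
    simp only [map_add, coeff_add]
    exact (hP β).add (hQ β)
  | mul_X P e hP =>
    intro β
    simp only [map_mul, coeff_mul]
    exact continuous_finsetSum _ fun x _ => (hP _).mul (h e _)

theorem continuous_contract_algHom {T : Type*} [TopologicalSpace T]
    {ψ : T → MvPolynomial (Idx n) ℂ →ₐ[ℂ] MvPolynomial (Idx n) ℂ}
    (h : ∀ e β, Continuous fun s => coeff β (ψ s (X e))) (P : MvPolynomial (Idx n) ℂ) :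
    Continuous fun s => (contract (ψ s P) : Jet n m →L[ℂ] L2 n) :=
  continuous_finsetSum _ fun β _ => (continuous_coeff_algHom h P β.1).smul continuous_const

theorem continuous_coeff_weylSub (e : Idx n) (β : Idx n →₀ ℕ) :
    Continuous fun S : Config n => coeff β (weylSub S (X e)) := by
  classical
  have hf : Continuous fun S : Config n => freq S e := by
    rcases e with i | i
    · simp only [freq, Sum.elim_inl]
      fun_prop
    · simp only [freq, Sum.elim_inr, Pi.zero_apply]
      fun_prop
  simp only [weylSub_X, coeff_add, coeff_C]
  refine continuous_const.add ?_
  split_ifs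
  · exact hf
  · exact continuous_const

theorem continuous_coeff_flowSub (e : Idx n) (β : Idx n →₀ ℕ) :
    Continuous fun t : ℝ => coeff β (flowSub t (X e)) := by
  rcases e with i | i
  · simp only [flowSub_inl]
    exact continuous_const
  · simp only [flowSub_inr, coeff_sub, coeff_smul]
    fun_prop

/-- The derivation `X_k ↦ -2π X_x`, `X_x ↦ 0` generating `flowSub`. -/
def flowDer : Derivation ℂ (MvPolynomial (Idx n) ℂ) (MvPolynomial (Idx n) ℂ) :=
  mkDerivation ℂ (Sum.elim 0 fun i => (-(2 * Real.pi : ℝ) : ℂ) • X (Sum.inl i))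

/-- Algebra homomorphisms and derivations are determined by the variables, where this is `d/dt (X_k
- 2πt X_x) = -2π X_x`; the Leibniz rule does the rest. -/
theorem hasDerivAt_coeff_flowSub (P : MvPolynomial (Idx n) ℂ) (t : ℝ) :
    ∀ β, HasDerivAt (fun t : ℝ => coeff β (flowSub t P)) (coeff β (flowSub t (flowDer P))) t := by
  classical
  induction P using MvPolynomial.induction_on with
  | C c =>
    intro β
    simp only [← MvPolynomial.algebraMap_eq, AlgHom.commutes, Derivation.map_algebraMap, map_zero,
      coeff_zero]
    exact hasDerivAt_const _ _
  | add P Q hP hQ =>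
    intro β
    simp only [map_add, coeff_add]
    exact (hP β).add (hQ β)
  | mul_X P e hP =>
    intro β
    have hX : ∀ β, HasDerivAt (fun t : ℝ => coeff β (flowSub t (X e)))
        (coeff β (flowSub t (flowDer (X e)))) t := fun β => by
      rcases e with i | i
      · simp only [flowSub_inl, flowDer, mkDerivation_X, Sum.elim_inl, Pi.zero_apply, map_zero,
          coeff_zero]
        exact hasDerivAt_const _ _
      · simp only [flowSub_inr, flowDer, mkDerivation_X, Sum.elim_inr, map_smul, flowSub_inl,
          coeff_sub, coeff_smul, smul_eq_mul]
        have h1 : HasDerivAt (fun t : ℝ => ((2 * Real.pi * t : ℝ) : ℂ)) ((2 * Real.pi : ℝ) : ℂ) t := by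
          simpa using ((hasDerivAt_id t).const_mul (2 * Real.pi)).ofReal_comp
        simpa using (h1.mul_const (coeff β (X (Sum.inl i)))).const_sub
          (coeff β (X (Sum.inr i)))
    simp only [map_mul, coeff_mul]
    refine (HasDerivAt.fun_sum fun x _ => (hP x.1).mul (hX x.2)).congr_deriv ?_
    rw [Derivation.leibniz, map_add, coeff_add, smul_eq_mul, smul_eq_mul, map_mul, map_mul,
      mul_comm (flowSub t (X e)), coeff_mul, coeff_mul, ← Finset.sum_add_distrib]
    exact Finset.sum_congr rfl fun x _ => add_comm _ _

theorem hasDerivAt_contract_flowSub (P : MvPolynomial (Idx n) ℂ) (t : ℝ) :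
    HasDerivAt (fun t : ℝ => (contract (flowSub t P) : Jet n m →L[ℂ] L2 n))
      (contract (flowSub t (flowDer P))) t :=
  HasDerivAt.fun_sum fun β _ => (hasDerivAt_coeff_flowSub P t β.1).smul_const
    (ContinuousLinearMap.proj β : Jet n m →L[ℂ] L2 n)

/-! ### Strong continuity -/

/-- For isometries, norm convergence follows from convergence of inner products, since `‖a s - a
s₀‖² = 2‖φ‖² - 2 Re ⟨a s₀, a s⟩`. The integral for the inner product is dominated because the fixed
factor `a s₀` has compact support and the other one is bounded. General `f` are approximated
uniformly in `s` by density. -/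
theorem Twist.continuous_onL2 {T : Type*} [TopologicalSpace T] [FirstCountableTopology T]
    {Q : T → Twist n}
    (h : ∀ (φ : Test n) z, Continuous fun s => ((Q s).onTest φ).1 z) (f : L2 n) :
    Continuous fun s => (Q s).onL2 f := by
  have htest : ∀ φ : Test n, Continuous fun s => (Q s).onL2 (toL2 φ) := fun φ => by
    obtain ⟨B, hB⟩ := φ.hasCompactSupport.exists_bound_of_continuous φ.continuous
    refine continuous_iff_continuousAt.2 fun s₀ => ?_
    set a : T → L2 n := fun s => (Q s).onL2 (toL2 φ) with ha
    have hnorm : ∀ s, ‖a s‖ = ‖toL2 φ‖ := fun s => (Q s).norm_onL2 _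
    have hint : ∀ s, inner ℂ (a s₀) (a s) =
        ∫ z, (starRingEnd ℂ) (((Q s₀).onTest φ).1 z) * ((Q s).onTest φ).1 z := fun s => by
      rw [L2.inner_def]
      refine integral_congr_ae ?_
      simp only [ha, Twist.onL2_toL2]
      filter_upwards [coeFn_toL2 ((Q s₀).onTest φ), coeFn_toL2 ((Q s).onTest φ)] with z h1 h2
      rw [h1, h2]
      simp [mul_comm]
    have hcont : Continuous fun s => inner ℂ (a s₀) (a s) := by
      simp only [hint]
      refine continuous_of_dominated (bound := fun z => ‖((Q s₀).onTest φ).1 z‖ * B) ?_ ?_ ?_ ?_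
      · intro s
        exact ((Complex.continuous_conj.comp ((Q s₀).onTest φ).continuous).mul
          ((Q s).onTest φ).continuous).aestronglyMeasurable
      · refine fun s => Eventually.of_forall fun z => ?_
        rw [norm_mul, RCLike.norm_conj]
        refine mul_le_mul_of_nonneg_left ?_ (norm_nonneg _)
        rw [onTest_apply, norm_mul, (Q s).norm_χ, one_mul]
        exact hB _
      · exact (((Q s₀).onTest φ).continuous.integrable_of_hasCompactSupport
          ((Q s₀).onTest φ).hasCompactSupport).norm.mul_const B
      · exact Eventually.of_forall fun z => continuous_const.mul (h φ z)
    have hsq : ∀ s, ‖a s - a s₀‖ ^ 2 =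
        2 * ‖toL2 φ‖ ^ 2 - 2 * (inner ℂ (a s₀) (a s)).re := fun s => by
      rw [norm_sub_rev, @norm_sub_sq ℂ, hnorm, hnorm, RCLike.re_eq_complex_re]
      ring
    have h0 : Tendsto (fun s => ‖a s - a s₀‖ ^ 2) (𝓝 s₀) (𝓝 0) := by
      have h1 : Continuous fun s => ‖a s - a s₀‖ ^ 2 := by
        simp only [hsq]
        exact continuous_const.sub (continuous_const.mul (Complex.continuous_re.comp hcont))
      simpa using h1.tendsto s₀
    have h2 := h0.sqrt
    simp only [Real.sqrt_zero, Real.sqrt_sq (norm_nonneg _)] at h2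
    exact tendsto_iff_norm_sub_tendsto_zero.2 h2
  refine continuous_of_uniform_approx_of_continuous fun u hu => ?_
  obtain ⟨ε, hε, hu⟩ := Metric.mem_uniformity_dist.1 hu
  obtain ⟨φ, hφ⟩ := denseRange_toL2.exists_dist_lt f hε
  refine ⟨_, htest φ, fun s => hu ?_⟩
  rwa [dist_eq_norm, ← map_sub, (Q s).norm_onL2, ← dist_eq_norm]

theorem Twist.continuous_onL2_comp {T : Type*} [TopologicalSpace T] {Q : T → Twist n}
    (h : ∀ f, Continuous fun s => (Q s).onL2 f) {g : T → L2 n} (hg : Continuous g) :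
    Continuous fun s => (Q s).onL2 (g s) := by
  refine continuous_iff_continuousAt.2 fun s₀ => ?_
  refine tendsto_iff_norm_sub_tendsto_zero.2 ?_
  have h1 : Tendsto (fun s => ‖g s - g s₀‖ + ‖(Q s).onL2 (g s₀) - (Q s₀).onL2 (g s₀)‖) (𝓝 s₀)
      (𝓝 (0 + 0)) :=
    (tendsto_iff_norm_sub_tendsto_zero.1 (hg.tendsto s₀)).add
      (tendsto_iff_norm_sub_tendsto_zero.1 ((h (g s₀)).tendsto s₀))
  rw [add_zero] at h1
  refine squeeze_zero (fun s => norm_nonneg _) (fun s => ?_) h1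
  rw [← (Q s).norm_onL2 (g s - g s₀), map_sub]
  exact norm_sub_le_norm_sub_add_norm_sub _ _ _

theorem continuous_flow_onTest (φ : Test n) (z : Phase n) :
    Continuous fun t => ((flow t).onTest φ).1 z := by
  simp only [Twist.onTest_apply, flow_χ, flow_A, one_mul]
  exact φ.continuous.comp (by fun_prop)

theorem continuous_weyl_onTest (φ : Test n) (z : Phase n) :
    Continuous fun x : ℝ × Config n => ((weyl x.1 x.2).onTest φ).1 z := by
  simp only [Twist.onTest_apply, weyl_χ, weyl_A]
  exact Continuous.mul (by fun_prop) (φ.continuous.comp (by fun_prop))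

theorem continuous_flow (f : L2 n) : Continuous fun t => (flow t).onL2 f :=
  Twist.continuous_onL2 continuous_flow_onTest f

theorem continuous_weyl (f : L2 n) :
    Continuous fun x : ℝ × Config n => (weyl x.1 x.2).onL2 f :=
  Twist.continuous_onL2 continuous_weyl_onTest f

/-! ### Differentiation along one-parameter families -/

/-- A pointwise derivative becomes an `L²` derivative by comparison with the `L²`-valued primitive
`g` of the expected derivative. Paired with any test function, the curve and `g` have the same
derivative and the same value at `0`, so they coincide. -/
theorem Twist.hasDerivAt_onTest {Q : ℝ → Twist n} (hQ : ∀ f, Continuous fun t => (Q t).onL2 f)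
    {φ φ' : Test n}
    (h : ∀ z t, HasDerivAt (fun t => ((Q t).onTest φ).1 z) (((Q t).onTest φ').1 z) t) (t : ℝ) :
    HasDerivAt (fun t => toL2 ((Q t).onTest φ)) (toL2 ((Q t).onTest φ')) t := by
  have hc : Continuous fun t => toL2 ((Q t).onTest φ') := by
    simpa only [Twist.onL2_toL2] using hQ (toL2 φ')
  set g : ℝ → L2 n := fun t => toL2 ((Q 0).onTest φ) + ∫ s in (0 : ℝ)..t, toL2 ((Q s).onTest φ')
  have hg : ∀ t, HasDerivAt g (toL2 ((Q t).onTest φ')) t := fun t =>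
    (intervalIntegral.integral_hasDerivAt_right (hc.intervalIntegrable _ _)
      (hc.stronglyMeasurableAtFilter _ _) hc.continuousAt).const_add _
  suffices hgt : ∀ t, toL2 ((Q t).onTest φ) = g t by
    rw [funext hgt]
    exact hg t
  obtain ⟨B, hB⟩ := φ'.hasCompactSupport.exists_bound_of_continuous φ'.continuous
  refine fun t => eq_of_pair_toL2_eq fun ψ => ?_
  have hp : ∀ (χ : Test n), pair (toL2 χ) (toL2 ψ) = ∫ z, χ.1 z * ψ.1 z := fun χ => by
    rw [pair_toL2]
    exact integral_congr_ae (by filter_upwards [coeFn_toL2 χ] with z hz; rw [hz])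
  have hd : ∀ t, HasDerivAt (fun t => pair (toL2 ((Q t).onTest φ)) (toL2 ψ))
      (pair (toL2 ((Q t).onTest φ')) (toL2 ψ)) t := fun t => by
    simp only [hp]
    refine (hasDerivAt_integral_of_dominated_loc_of_deriv_le (s := Set.univ)
      (F := fun t z => ((Q t).onTest φ).1 z * ψ.1 z)
      (F' := fun t z => ((Q t).onTest φ').1 z * ψ.1 z)
      (bound := fun z => B * ‖ψ.1 z‖) univ_mem ?_ ?_ ?_ ?_ ?_ ?_).2
    · exact Eventually.of_forall fun t =>
        (((Q t).onTest φ).continuous.mul ψ.continuous).aestronglyMeasurable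
    · exact (((Q t).onTest φ).continuous.mul ψ.continuous).integrable_of_hasCompactSupport
        ψ.hasCompactSupport.mul_left
    · exact (((Q t).onTest φ').continuous.mul ψ.continuous).aestronglyMeasurable
    · refine Eventually.of_forall fun z t _ => ?_
      rw [norm_mul, onTest_apply, norm_mul, (Q t).norm_χ, one_mul]
      exact mul_le_mul_of_nonneg_right (hB _) (norm_nonneg _)
    · exact (ψ.continuous.integrable_of_hasCompactSupport ψ.hasCompactSupport).norm.const_mul B
    · exact Eventually.of_forall fun z t _ => (h z t).mul_const _
  have hd' : ∀ t, HasDerivAt (fun t => pair (g t) (toL2 ψ))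
      (pair (toL2 ((Q t).onTest φ')) (toL2 ψ)) t := fun t =>
    (((pair.flip (toL2 ψ)).restrictScalars ℝ).hasFDerivAt.comp_hasDerivAt t (hg t))
  have h0 : ∀ t, HasDerivAt (fun t => pair (toL2 ((Q t).onTest φ)) (toL2 ψ) -
      pair (g t) (toL2 ψ)) 0 t := fun t => by
    have := (hd t).sub (hd' t)
    rwa [sub_self] at this
  have := is_const_of_deriv_eq_zero (fun t => (h0 t).differentiableAt) (fun t => (h0 t).deriv) t 0
  simp only [g, intervalIntegral.integral_same, add_zero, sub_self] at this
  exact sub_eq_zero.1 this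

/-- The transport operator `2πk·∂_x` on test functions. -/
def transport (φ : Test n) : Test n :=
  ⟨fun z => 2 * Real.pi * fderiv ℝ φ.1 z (z.2, 0),
    contDiff_const.mul ((φ.contDiff.fderiv_right (m := ∞) (by simp)).clm_apply
      (contDiff_snd.prodMk contDiff_const)), by
    refine HasCompactSupport.mul_left ?_
    refine (φ.hasCompactSupport.fderiv ℝ).mono fun z hz => ?_
    contrapose! hz
    simp only [Function.mem_support, not_not] at hz ⊢
    simp [hz]⟩

theorem transport_apply (φ : Test n) (z : Phase n) :
    (transport φ).1 z = 2 * Real.pi * fderiv ℝ φ.1 z (z.2, 0) := rfl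

theorem hasDerivAt_flow (φ : Test n) (t : ℝ) :
    HasDerivAt (fun t => toL2 ((flow t).onTest φ)) (-toL2 ((flow t).onTest (transport φ))) t := by
  rw [← map_neg, ← map_neg]
  refine Twist.hasDerivAt_onTest continuous_flow (fun z t => ?_) t
  have h1 : HasDerivAt (fun t : ℝ => ((z.1 - (2 * Real.pi * t) • z.2, z.2) : Phase n))
      (-(2 * Real.pi) • z.2, 0) t := by
    have h : HasDerivAt (fun t : ℝ => z.1 - (2 * Real.pi * t) • z.2) (-(2 * Real.pi) • z.2) t := by
      simpa using (((hasDerivAt_id t).const_mul (2 * Real.pi)).smul_const z.2).const_sub z.1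
    exact h.prodMk (hasDerivAt_const t z.2)
  have h2 := (φ.differentiable (z.1 - (2 * Real.pi * t) • z.2, z.2)).hasFDerivAt.comp_hasDerivAt t h1
  have h3 : ((-(2 * Real.pi) • z.2, 0) : Phase n) = (-(2 * Real.pi)) • (z.2, 0) := by simp
  simp only [Twist.onTest_apply, flow_χ, flow_A, one_mul]
  refine h2.congr_deriv ?_
  change _ = -(transport φ).1 _
  rw [h3, map_smul, transport_apply]
  simp

theorem hasDerivAt_weyl (S : Config n) (φ : Test n) (c : ℝ) :
    HasDerivAt (fun c => toL2 ((weyl c S).onTest φ))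
      (toL2 ((weyl c S).onTest (dirDeriv (0, S) φ))) c := by
  have hQ : ∀ f : L2 n, Continuous fun c : ℝ => (weyl c S).onL2 f := fun f => by
    have h := (continuous_weyl f).comp (Continuous.prodMk_left S)
    simpa only [Function.comp_def] using h
  refine Twist.hasDerivAt_onTest hQ (fun z c => ?_) c
  have h1 : HasDerivAt (fun c : ℝ => ((z.1, z.2 + c • S) : Phase n)) (0, S) c := by
    have h : HasDerivAt (fun c : ℝ => z.2 + c • S) S c := by
      simpa using ((hasDerivAt_id c).smul_const S).const_add z.2
    exact (hasDerivAt_const c z.1).prodMk h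
  have h2 := (φ.differentiable (z.1, z.2 + c • S)).hasFDerivAt.comp_hasDerivAt c h1
  simp only [Twist.onTest_apply, weyl_χ, weyl_A]
  exact h2.const_mul _

/-! ### The difference operators in the potential term -/

/-- The operator `f ↦ e^{2πi S·x} (f (x, k - εS/2) - f (x, k + εS/2))`. -/
def dif (ε : ℝ) (S : Config n) : L2 n →L[ℂ] L2 n :=
  (weyl (-(ε / 2)) S).onL2 - (weyl (ε / 2) S).onL2

theorem dif_apply (ε : ℝ) (S : Config n) (f : L2 n) :
    dif ε S f = (weyl (-(ε / 2)) S).onL2 f - (weyl (ε / 2) S).onL2 f := rfl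

theorem norm_dif_le (ε : ℝ) (S : Config n) (f : L2 n) : ‖dif ε S f‖ ≤ 2 * ‖f‖ := by
  rw [dif_apply]
  refine (norm_sub_le _ _).trans ?_
  rw [Twist.norm_onL2, Twist.norm_onL2, two_mul]

theorem continuous_weyl_right (c : ℝ) (f : L2 n) : Continuous fun S => (weyl c S).onL2 f := by
  have h := (continuous_weyl f).comp (Continuous.prodMk_right c)
  simpa only [Function.comp_def] using h

theorem continuous_dif (ε : ℝ) {g : Config n → L2 n} (hg : Continuous g) :
    Continuous fun S => dif ε S (g S) :=
  (Twist.continuous_onL2_comp (continuous_weyl_right _) hg).sub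
    (Twist.continuous_onL2_comp (continuous_weyl_right _) hg)

theorem pair_dif (ε : ℝ) (S : Config n) (f g : L2 n) :
    pair (dif ε S f) g = -pair f (dif ε S g) := by
  rw [dif_apply, dif_apply, map_sub, map_sub, sub_apply,
    (isTranspose_weyl _ S).pair_onL2, (isTranspose_weyl _ S).pair_onL2, neg_neg, neg_sub]

/-- `weyl c S` is unitary with inverse `weyl c (-S)`. The adjoint reverses `S`, whereas the
transpose reverses `c`. -/
theorem inner_weyl (c : ℝ) (S : Config n) (f g : L2 n) :
    inner ℂ ((weyl c S).onL2 f) g = inner ℂ f ((weyl c (-S)).onL2 g) := by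
  have h : (weyl c S).onL2 ((weyl c (-S)).onL2 g) = g := by
    refine denseRange_toL2.induction_on g (isClosed_eq (by fun_prop) (by fun_prop)) fun φ => ?_
    rw [Twist.onL2_toL2, Twist.onL2_toL2]
    congr 1
    ext z
    simp only [Twist.onTest_apply, weyl_χ, weyl_A]
    rw [← mul_assoc, ← Complex.exp_add]
    simp
  conv_lhs => rw [← h]
  exact (LinearIsometry.mk (weyl c S).onL2.toLinearMap (weyl c S).norm_onL2).inner_map_map _ _

theorem inner_dif (ε : ℝ) (S : Config n) (f g : L2 n) :
    inner ℂ (dif ε S f) g = inner ℂ f (dif ε (-S) g) := by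
  rw [dif_apply, dif_apply, inner_sub_left, inner_sub_right, inner_weyl, inner_weyl]

/-- Mean value inequality for the shift parameter `c` over the interval from `-ε/2` to `ε/2`, tested
against `φ`: the derivative in `c` is `S·∂_k`, and the length of the interval is the factor `ε` that
later cancels `1/ε`. -/
theorem norm_dif_le_of_mem_weakJets {ε : ℝ} (hε : 0 ≤ ε) (S : Config n) {u : Jet n m}
    (hu : u ∈ weakJets n m) {α : multiIdx n m} {β : Fin n → multiIdx n m}
    (hβ : ∀ i, (β i).1 = α.1 + Finsupp.single (Sum.inr i) 1) :
    ‖dif ε S (u α)‖ ≤ ε * ‖S‖ * ∑ i, ‖u (β i)‖ := by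
  refine norm_le_of_norm_pair_toL2_le (by positivity) fun φ => ?_
  set F : ℝ → ℂ := fun c => pair ((weyl c S).onL2 (u α)) (toL2 φ) with hF
  have hF1 : F = fun c => pair (u α) (toL2 ((weyl (-c) S).onTest φ)) := by
    ext c
    rw [hF]
    dsimp only
    rw [(isTranspose_weyl c S).pair_onL2, Twist.onL2_toL2]
  have hd : ∀ c, HasDerivAt F
      (∑ i, ((S i : ℝ) : ℂ) * pair (u (β i)) (toL2 ((weyl (-c) S).onTest φ))) c := fun c => by
    have h1 : HasDerivAt (fun c => toL2 ((weyl (-c) S).onTest φ))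
        (-toL2 ((weyl (-c) S).onTest (dirDeriv (0, S) φ))) c := by
      have h := (hasDerivAt_weyl S φ (-c)).scomp c (hasDerivAt_neg c)
      rw [neg_smul, one_smul] at h
      exact h
    have h2 := ((pair (u α)).restrictScalars ℝ).hasFDerivAt.comp_hasDerivAt c h1
    rw [hF1]
    refine h2.congr_deriv ?_
    -- The character does not depend on `k`, so momentum derivatives commute with the operator.
    have h3 : (weyl (-c) S).onTest (dirDeriv (0, S) φ) =
        dirDeriv (0, S) ((weyl (-c) S).onTest φ) := by
      rw [dirDeriv_weyl]
      simp
    rw [h3, dirDeriv_inr, ContinuousLinearMap.coe_restrictScalars', map_neg, map_sum, map_sum,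
      ← Finset.sum_neg_distrib]
    refine Finset.sum_congr rfl fun i _ => ?_
    rw [map_smul, map_smul, pair_pd_of_mem_weakJets hu (hβ i), smul_eq_mul]
    ring
  have hb : ∀ c, ‖∑ i, ((S i : ℝ) : ℂ) * pair (u (β i)) (toL2 ((weyl (-c) S).onTest φ))‖ ≤
      ‖S‖ * (∑ i, ‖u (β i)‖) * ‖toL2 φ‖ := fun c => by
    rw [Finset.mul_sum, Finset.sum_mul]
    refine norm_sum_le_of_le _ fun i _ => ?_
    rw [norm_mul, Complex.norm_real, mul_assoc]
    refine mul_le_mul (PiLp.norm_apply_le S i) ?_ (norm_nonneg _) (norm_nonneg _)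
    refine (norm_pair_le _ _).trans ?_
    rw [Twist.norm_toL2_onTest]
  have hmv := convex_univ.norm_image_sub_le_of_norm_hasDerivWithin_le (𝕜 := ℝ) (f := F)
    (fun c _ => (hd c).hasDerivWithinAt) (fun c _ => hb c) (Set.mem_univ (ε / 2))
    (Set.mem_univ (-(ε / 2)))
  have hval : pair (dif ε S (u α)) (toL2 φ) = F (-(ε / 2)) - F (ε / 2) := by
    rw [dif_apply, map_sub, sub_apply]
  have hε' : ‖-(ε / 2) - ε / 2‖ = ε := by
    rw [Real.norm_eq_abs, abs_of_nonpos (by linarith)]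
    ring
  rw [hval]
  rw [hε'] at hmv
  refine hmv.trans (le_of_eq ?_)
  ring

/-! ### Potentials as Bochner integrals -/

/-- The integral is formed vector by vector, since the families in question are assumed only
strongly continuous in `S`, not continuous in operator norm. -/
theorem exists_integral_clm {E : Type*} [NormedAddCommGroup E] [NormedSpace ℂ E] [CompleteSpace E]
    {v : Config n → ℂ} (hv : AEStronglyMeasurable v) {T : Config n → E →L[ℂ] E}
    (hT : ∀ u, Continuous fun S => T S u) {b : Config n → ℝ} (hb : ∀ S u, ‖T S u‖ ≤ b S * ‖u‖)
    (hi : Integrable fun S => ‖v S‖ * b S) :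
    (∀ u, Integrable fun S => v S • T S u) ∧ ∃ L : E →L[ℂ] E, ∀ u, L u = ∫ S, v S • T S u := by
  have h1 : ∀ u, Integrable fun S => v S • T S u := fun u => by
    refine (hi.mul_const ‖u‖).mono' (hv.smul (hT u).aestronglyMeasurable)
      (Eventually.of_forall fun S => ?_)
    rw [norm_smul, mul_assoc]
    exact mul_le_mul_of_nonneg_left (hb S u) (norm_nonneg _)
  refine ⟨h1, ⟨LinearMap.mkContinuous
    { toFun := fun u => ∫ S, v S • T S u
      map_add' := fun u u' => by
        simp only [map_add, smul_add]
        exact integral_add (h1 u) (h1 u')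
      map_smul' := fun c u => by
        simp only [map_smul, smul_comm (v _) c]
        exact integral_smul c _ } (∫ S, ‖v S‖ * b S) fun u => ?_, fun u => rfl⟩⟩
  rw [← integral_mul_const]
  refine norm_integral_le_of_norm_le (hi.mul_const ‖u‖) (Eventually.of_forall fun S => ?_)
  rw [norm_smul, mul_assoc]
  exact mul_le_mul_of_nonneg_left (hb S u) (norm_nonneg _)

/-- The potential term `(i/ε) ∫ v(S) e^{2πi S·x} (f (x, k - εS/2) - f (x, k + εS/2)) dS` as a
Bochner integral in `L²`. -/
def pot (ε : ℝ) (v : Config n → ℂ) (f : L2 n) : L2 n :=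
  (Complex.I / (ε : ℂ)) • ∫ S, v S • dif ε S f

/-- Integrable potentials of bounded support which are Fourier transforms of real functions. -/
structure IsTruncated (v : Config n → ℂ) : Prop where
  integrable : Integrable v
  bounded : ∃ R : ℝ, ∀ S, R < ‖S‖ → v S = 0
  herm : ∀ᵐ S, v (-S) = (starRingEnd ℂ) (v S)

theorem IsTruncated.integrable_mul {v : Config n → ℂ} (hv : IsTruncated v) {b : Config n → ℝ}
    (hb : Continuous b) : Integrable fun S => ‖v S‖ * b S := by
  obtain ⟨R, hR⟩ := hv.bounded
  obtain ⟨B, hB⟩ := (isCompact_closedBall (0 : Config n) R).exists_bound_of_continuousOn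
    hb.continuousOn
  refine (hv.integrable.norm.mul_const B).mono' (hv.integrable.norm.1.mul hb.aestronglyMeasurable)
    (Eventually.of_forall fun S => ?_)
  rw [norm_mul, norm_norm]
  by_cases h : R < ‖S‖
  · simp [hR S h]
  · exact mul_le_mul_of_nonneg_left (hB S (by simpa using h)) (norm_nonneg _)

theorem integrable_smul_dif (ε : ℝ) {v : Config n → ℂ} (hv : Integrable v) (f : L2 n) :
    Integrable fun S => v S • dif ε S f :=
  (exists_integral_clm hv.1 (T := dif ε) (fun _ => continuous_dif ε continuous_const)
    (norm_dif_le ε) (hv.norm.mul_const 2)).1 f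

theorem exists_pot_clm (ε : ℝ) {v : Config n → ℂ} (hv : Integrable v) :
    ∃ L : L2 n →L[ℂ] L2 n, ∀ f, L f = pot ε v f := by
  obtain ⟨-, L, hL⟩ := exists_integral_clm hv.1 (T := dif ε)
    (fun _ => continuous_dif ε continuous_const) (norm_dif_le ε) (hv.norm.mul_const 2)
  exact ⟨(Complex.I / (ε : ℂ)) • L, fun f => by
    rw [smul_apply, hL]; rfl⟩

theorem pair_pot_left {ε : ℝ} {v : Config n → ℂ} {f : L2 n}
    (hf : Integrable fun S => v S • dif ε S f) (g : L2 n) :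
    pair (pot ε v f) g = (Complex.I / (ε : ℂ)) * ∫ S, v S * pair (dif ε S f) g := by
  have h := (pair.flip g).integral_comp_comm hf
  simp only [map_smul, ContinuousLinearMap.flip_apply, smul_eq_mul] at h
  rw [pot, map_smul, smul_apply, smul_eq_mul, h]

theorem pair_pot {ε : ℝ} {v : Config n → ℂ} {f g : L2 n}
    (hf : Integrable fun S => v S • dif ε S f) (hg : Integrable fun S => v S • dif ε S g) :
    pair (pot ε v f) g = -pair f (pot ε v g) := by
  have h : ∀ S, v S * pair (dif ε S g) f = -(v S * pair (dif ε S f) g) := fun S => by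
    rw [pair_dif, pair_comm g, mul_neg]
  rw [pair_comm f, pair_pot_left hf, pair_pot_left hg]
  simp only [h]
  rw [integral_neg, mul_neg, neg_neg]

/-- The potential term is skew-adjoint. -/
theorem re_inner_pot {ε : ℝ} {v : Config n → ℂ} (hv : Integrable v)
    (herm : ∀ᵐ S, v (-S) = (starRingEnd ℂ) (v S)) (f : L2 n) :
    (inner ℂ f (pot ε v f)).re = 0 := by
  have h := (innerSL ℂ f).integral_comp_comm (integrable_smul_dif ε hv f)
  simp only [innerSL_apply_apply, inner_smul_right] at h
  set a : Config n → ℂ := fun S => v S * inner ℂ f (dif ε S f) with ha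
  -- The reflection `S ↦ -S` turns the integral into its conjugate. It is therefore real, and the
  -- prefactor `i/ε` makes the inner product purely imaginary.
  have hconj : (starRingEnd ℂ) (∫ S, a S) = ∫ S, a S := by
    rw [← integral_conj, ← integral_neg_eq_self a]
    refine integral_congr_ae ?_
    filter_upwards [herm] with S hS
    simp only [ha, map_mul, hS, inner_conj_symm, inner_dif]
  rw [pot, inner_smul_right, ← h]
  obtain ⟨r, hr⟩ := Complex.conj_eq_iff_real.1 hconj
  rw [hr]
  simp [Complex.div_re]

/-! ### Potentials acting on jets -/

/-- The difference operators acting on jets. -/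
def jetDif (m : ℕ) (ε : ℝ) (S : Config n) : Jet n m →L[ℂ] Jet n m :=
  jetMap m (weyl (-(ε / 2)) S) (weylSub S) - jetMap m (weyl (ε / 2) S) (weylSub S)

theorem jetDif_apply (ε : ℝ) (S : Config n) (u : Jet n m) (α : multiIdx n m) :
    jetDif m ε S u α = dif ε S (contract (weylSub S (monomial α.1 1)) u) := rfl

theorem jetDif_mem_weakJets (ε : ℝ) (S : Config n) {u : Jet n m} (hu : u ∈ weakJets n m) :
    jetDif m ε S u ∈ weakJets n m :=
  sub_mem ((intertwines_weyl _ S).jetMap_mem_weakJets hu)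
    ((intertwines_weyl _ S).jetMap_mem_weakJets hu)

theorem jetDif_mem_testJets (ε : ℝ) (S : Config n) {u : Jet n m} (hu : u ∈ testJets n m) :
    jetDif m ε S u ∈ testJets n m :=
  sub_mem ((intertwines_weyl _ S).jetMap_mem_testJets hu)
    ((intertwines_weyl _ S).jetMap_mem_testJets hu)

theorem continuous_contract_weylSub (α : multiIdx n m) :
    Continuous fun S : Config n => (contract (weylSub S (monomial α.1 1)) : Jet n m →L[ℂ] L2 n) :=
  continuous_contract_algHom continuous_coeff_weylSub _

theorem continuous_jetDif (ε : ℝ) (u : Jet n m) : Continuous fun S => jetDif m ε S u :=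
  continuous_pi fun α => continuous_dif ε
    ((continuous_contract_weylSub α).clm_apply continuous_const)

theorem norm_jetDif_le (ε : ℝ) (S : Config n) (u : Jet n m) :
    ‖jetDif m ε S u‖ ≤ (2 * ∑ α : multiIdx n m,
      ‖(contract (weylSub S (monomial α.1 1)) : Jet n m →L[ℂ] L2 n)‖) * ‖u‖ := by
  refine (pi_norm_le_iff_of_nonneg (by positivity)).2 fun α => ?_
  rw [jetDif_apply, mul_assoc]
  refine (norm_dif_le _ _ _).trans (mul_le_mul_of_nonneg_left ?_ zero_le_two)
  refine (ContinuousLinearMap.le_opNorm _ _).trans (mul_le_mul_of_nonneg_right ?_ (norm_nonneg _))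
  exact Finset.single_le_sum (f := fun α : multiIdx n m =>
    ‖(contract (weylSub S (monomial α.1 1)) : Jet n m →L[ℂ] L2 n)‖)
    (fun _ _ => norm_nonneg _) (Finset.mem_univ α)

theorem exists_jetPot_clm (m : ℕ) (ε : ℝ) {v : Config n → ℂ} (hv : IsTruncated v) :
    (∀ u, Integrable fun S => v S • jetDif m ε S u) ∧
    ∃ L : Jet n m →L[ℂ] Jet n m, ∀ u, L u = (Complex.I / (ε : ℂ)) • ∫ S, v S • jetDif m ε S u := by
  obtain ⟨h, L, hL⟩ := exists_integral_clm hv.integrable.1 (T := jetDif m ε)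
    (continuous_jetDif ε) (norm_jetDif_le ε) (hv.integrable_mul (by
      refine continuous_const.mul (continuous_finsetSum _ fun α _ => ?_)
      exact (continuous_contract_weylSub α).norm))
  exact ⟨h, (Complex.I / (ε : ℂ)) • L, fun f => by
    rw [smul_apply, hL]; rfl⟩

/-- The potential term acting on jets. -/
def jetPot (m : ℕ) (ε : ℝ) {v : Config n → ℂ} (hv : IsTruncated v) : Jet n m →L[ℂ] Jet n m :=
  (exists_jetPot_clm m ε hv).2.choose

theorem jetPot_eq (ε : ℝ) {v : Config n → ℂ} (hv : IsTruncated v) (u : Jet n m) :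
    jetPot m ε hv u = (Complex.I / (ε : ℂ)) • ∫ S, v S • jetDif m ε S u :=
  (exists_jetPot_clm m ε hv).2.choose_spec u

theorem jetPot_apply (ε : ℝ) {v : Config n → ℂ} (hv : IsTruncated v) (u : Jet n m)
    (α : multiIdx n m) :
    jetPot m ε hv u α = (Complex.I / (ε : ℂ)) •
      ∫ S, v S • dif ε S (contract (weylSub S (monomial α.1 1)) u) := by
  have h := (ContinuousLinearMap.proj (R := ℂ) (φ := fun _ : multiIdx n m => L2 n)
    α).integral_comp_comm ((exists_jetPot_clm m ε hv).1 u)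
  rw [jetPot_eq, Pi.smul_apply]
  congr 1
  exact h.symm

theorem integrable_jetPot (ε : ℝ) {v : Config n → ℂ} (hv : IsTruncated v) (u : Jet n m)
    (α : multiIdx n m) :
    Integrable fun S => v S • dif ε S (contract (weylSub S (monomial α.1 1)) u) :=
  (ContinuousLinearMap.proj (R := ℂ) (φ := fun _ : multiIdx n m => L2 n)
    α).integrable_comp ((exists_jetPot_clm m ε hv).1 u)

theorem jetPot_zeroIdx (ε : ℝ) {v : Config n → ℂ} (hv : IsTruncated v) (u : Jet n m) :
    jetPot m ε hv u zeroIdx = pot ε v (u zeroIdx) := by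
  have h : (monomial (zeroIdx : multiIdx n m).1 1 : MvPolynomial (Idx n) ℂ) = 1 := rfl
  rw [jetPot_apply, pot]
  simp only [h, map_one]
  simp only [← h, contract_monomial]

/-- A closed subspace is itself complete, so the Bochner integral can be taken inside it and then
included. -/
theorem integral_mem_of_isClosed {E : Type*} [NormedAddCommGroup E] [NormedSpace ℂ E]
    [CompleteSpace E] {K : Submodule ℂ E} (hK : IsClosed (K : Set E)) {F : Config n → E}
    (hF : Integrable F) (h : ∀ S, F S ∈ K) : ∫ S, F S ∈ K := by
  have : CompleteSpace K := hK.completeSpace_coe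
  have hG : Integrable fun S => (⟨F S, h S⟩ : K) := by
    refine ⟨?_, ?_⟩
    · exact Topology.IsEmbedding.subtypeVal.aestronglyMeasurable_comp_iff.1 hF.1
    · exact hF.2
  have := K.subtypeL.integral_comp_comm hG
  simp only [Submodule.subtypeL_apply] at this
  rw [this]
  exact Subtype.property _

theorem jetPot_mem_of_isClosed (ε : ℝ) {v : Config n → ℂ} (hv : IsTruncated v)
    {K : Submodule ℂ (Jet n m)} (hK : IsClosed (K : Set (Jet n m)))
    (h : ∀ S, ∀ u ∈ K, jetDif m ε S u ∈ K) {u : Jet n m} (hu : u ∈ K) : jetPot m ε hv u ∈ K := by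
  rw [jetPot_eq]
  exact K.smul_mem _ (integral_mem_of_isClosed hK ((exists_jetPot_clm m ε hv).1 u)
    fun S => K.smul_mem _ (h S u hu))

/-! ### The coefficients of the substitution -/

/-- The Leibniz rule for `∂^α (e^{2πi S·x} f)` in symbols: the binomial theorem is applied to each
factor of `∏ (X e + freq S e)^(α e)`, and each choice of exponents contributes to a different
monomial. -/
theorem coeff_weylSub_monomial (S : Config n) (α β : Idx n →₀ ℕ) :
    coeff β (weylSub S (monomial α 1)) =
      ∏ e, ((α e).choose (β e) : ℂ) * freq S e ^ (α e - β e) := by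
  classical
  have h1 : weylSub S (monomial α 1) = ∏ e, (X e + C (freq S e)) ^ α e := by
    rw [weylSub, aeval_monomial, map_one, one_mul, Finsupp.prod_fintype _ _ (by simp)]
  have h2 : ∀ p : Idx n → ℕ, (∏ e, (X e ^ p e * C (freq S e) ^ (α e - p e) *
      ((α e).choose (p e) : MvPolynomial (Idx n) ℂ))) =
      monomial (Finsupp.equivFunOnFinite.symm p)
        (∏ e, ((α e).choose (p e) : ℂ) * freq S e ^ (α e - p e)) := fun p => by
    rw [monomial_eq, Finsupp.prod_fintype _ _ (by simp), map_prod, ← Finset.prod_mul_distrib]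
    refine Finset.prod_congr rfl fun e _ => ?_
    simp
    ring
  rw [h1]
  simp only [add_pow]
  rw [Finset.prod_univ_sum]
  simp only [h2]
  rw [coeff_sum]
  simp only [coeff_monomial]
  have h3 : ∀ p : Idx n → ℕ, (Finsupp.equivFunOnFinite.symm p = β) ↔ p = β := fun p => by
    rw [Equiv.symm_apply_eq]; rfl
  simp only [h3]
  rw [Finset.sum_ite_eq']
  split_ifs with h
  · rfl
  · simp only [Fintype.mem_piFinset, Finset.mem_range, not_forall, not_lt] at h
    obtain ⟨e, he⟩ := h
    refine (Finset.prod_eq_zero (Finset.mem_univ e) ?_).symm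
    rw [Nat.choose_eq_zero_of_lt (by omega), Nat.cast_zero, zero_mul]

end

section

/-! ### Linear evolution equations with strongly continuous coefficients -/

section ODE

/-- Integration gains `1/l` in the weighted norm with weight `e^{-l|t|}`; this makes the Picard map
a contraction on the whole line. -/
theorem norm_integral_le_of_exp_bound {E : Type*} [NormedAddCommGroup E] [NormedSpace ℝ E]
    {g : ℝ → E} {M l : ℝ} (hl : 0 < l) (hg : ∀ s, ‖g s‖ ≤ M * Real.exp (l * |s|)) (t : ℝ) :
    ‖∫ s in (0 : ℝ)..t, g s‖ ≤ M / l * Real.exp (l * |t|) := by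
  have hM : 0 ≤ M := by simpa using (norm_nonneg _).trans (hg 0)
  have key : ∀ g : ℝ → E, (∀ s, ‖g s‖ ≤ M * Real.exp (l * |s|)) → ∀ t, 0 ≤ t →
      ‖∫ s in (0 : ℝ)..t, g s‖ ≤ M / l * Real.exp (l * |t|) := fun g hg t ht => by
    have h1 : ‖∫ s in (0 : ℝ)..t, g s‖ ≤ ∫ s in (0 : ℝ)..t, M * Real.exp (l * s) := by
      refine intervalIntegral.norm_integral_le_of_norm_le ht (Eventually.of_forall fun s hs => ?_)
        (Continuous.intervalIntegrable (by fun_prop) _ _)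
      simpa [abs_of_pos hs.1] using hg s
    have h2 : ∫ s in (0 : ℝ)..t, M * Real.exp (l * s) =
        M / l * Real.exp (l * t) - M / l * Real.exp (l * 0) :=
      intervalIntegral.integral_eq_sub_of_hasDerivAt (f := fun s => M / l * Real.exp (l * s))
        (fun s _ => by
          have := (((hasDerivAt_id s).const_mul l).exp).const_mul (M / l)
          refine this.congr_deriv ?_
          simp
          field_simp) (Continuous.intervalIntegrable (by fun_prop) _ _)
    rw [abs_of_nonneg ht]
    rw [h2] at h1
    have : 0 ≤ M / l * Real.exp (l * 0) := by positivity
    linarith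
  rcases le_total 0 t with ht | ht
  · exact key g hg t ht
  · have h := key (fun s => g (-s)) (fun s => by simpa using hg (-s)) (-t) (by linarith)
    rw [intervalIntegral.integral_comp_neg, neg_zero, neg_neg, intervalIntegral.integral_symm,
      norm_neg, abs_neg] at h
    exact h

theorem continuous_of_lipschitz_right {E : Type*} [NormedAddCommGroup E] {B : ℝ → E → E} {K : ℝ}
    (hc : ∀ u, Continuous fun t => B t u)
    (hK : ∀ t u w, ‖B t u - B t w‖ ≤ K * ‖u - w‖) {g : ℝ → E} (hg : Continuous g) :
    Continuous fun t => B t (g t) := by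
  refine continuous_iff_continuousAt.2 fun s₀ => tendsto_iff_norm_sub_tendsto_zero.2 ?_
  have h1 : Tendsto (fun s => K * ‖g s - g s₀‖ + ‖B s (g s₀) - B s₀ (g s₀)‖) (𝓝 s₀)
      (𝓝 (K * 0 + 0)) :=
    ((tendsto_iff_norm_sub_tendsto_zero.1 (hg.tendsto s₀)).const_mul K).add
      (tendsto_iff_norm_sub_tendsto_zero.1 ((hc (g s₀)).tendsto s₀))
  rw [mul_zero, add_zero] at h1
  refine squeeze_zero (fun s => norm_nonneg _) (fun s => ?_) h1
  exact (norm_sub_le_norm_sub_add_norm_sub _ (B s (g s₀)) _).trans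
    (add_le_add_left (hK s _ _) _)

variable {E : Type*} [NormedAddCommGroup E] [NormedSpace ℝ E] [CompleteSpace E]

/-- Picard iteration for `v(t) = e^{-l|t|} p(t)` in the bounded continuous functions on `ℝ`. With `l
= 2K` the contraction constant is `K / l = 1/2`, which gives a global solution at once, and only
continuity of `t ↦ B t u` for fixed `u` is used. -/
theorem exists_hasDerivAt_of_lipschitz {B : ℝ → E → E} {K : ℝ} (hK0 : 0 < K)
    (hc : ∀ u, Continuous fun t => B t u) (hK : ∀ t u w, ‖B t u - B t w‖ ≤ K * ‖u - w‖)
    (hB0 : ∀ t, B t 0 = 0) (x : E) :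
    ∃ p : ℝ → E, p 0 = x ∧ ∀ t, HasDerivAt p (B t (p t)) t := by
  set l : ℝ := 2 * K with hl
  have hl0 : 0 < l := by positivity
  have hg : ∀ v : BoundedContinuousFunction ℝ E,
      Continuous fun s => B s (Real.exp (l * |s|) • v s) := fun v =>
    continuous_of_lipschitz_right hc hK (by fun_prop)
  have hI : ∀ v : BoundedContinuousFunction ℝ E,
      Continuous fun t => ∫ s in (0 : ℝ)..t, B s (Real.exp (l * |s|) • v s) := fun v =>
    intervalIntegral.continuous_primitive (fun a b => (hg v).intervalIntegrable a b) 0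
  have hb : ∀ (v : BoundedContinuousFunction ℝ E) s,
      ‖B s (Real.exp (l * |s|) • v s)‖ ≤ K * ‖v‖ * Real.exp (l * |s|) := fun v s => by
    have h := hK s (Real.exp (l * |s|) • v s) 0
    rw [hB0, sub_zero, sub_zero, norm_smul, Real.norm_eq_abs, Real.abs_exp] at h
    calc _ ≤ K * ‖v s‖ * Real.exp (l * |s|) := h.trans_eq (by ring)
      _ ≤ _ := by
        have := v.norm_coe_le_norm s
        gcongr
  have hexp : ∀ t : ℝ, Real.exp (-(l * |t|)) ≤ 1 := fun t => by
    rw [Real.exp_le_one_iff]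
    have : 0 ≤ l * |t| := by positivity
    linarith
  have hexp' : ∀ (t a : ℝ), Real.exp (-(l * |t|)) * (a * Real.exp (l * |t|)) = a := fun t a => by
    rw [mul_left_comm, ← Real.exp_add, neg_add_cancel, Real.exp_zero, mul_one]
  let Γ : BoundedContinuousFunction ℝ E → BoundedContinuousFunction ℝ E := fun v =>
    BoundedContinuousFunction.ofNormedAddCommGroup
      (fun t => Real.exp (-(l * |t|)) • (x + ∫ s in (0 : ℝ)..t, B s (Real.exp (l * |s|) • v s)))
      (Continuous.smul (by fun_prop) (continuous_const.add (hI v))) (‖x‖ + K * ‖v‖ / l) fun t => by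
        rw [smul_add]
        refine (norm_add_le _ _).trans (add_le_add ?_ ?_)
        · rw [norm_smul, Real.norm_eq_abs, Real.abs_exp]
          exact mul_le_of_le_one_left (norm_nonneg _) (hexp t)
        · rw [norm_smul, Real.norm_eq_abs, Real.abs_exp]
          refine (mul_le_mul_of_nonneg_left (norm_integral_le_of_exp_bound hl0 (hb v) t)
            (Real.exp_pos _).le).trans ?_
          rw [hexp']
  have hΓ : ∀ v t, Γ v t =
    Real.exp (-(l * |t|)) • (x + ∫ s in (0 : ℝ)..t, B s (Real.exp (l * |s|) • v s)) :=
    fun v t => rfl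
  have hcontr : ContractingWith (1 / 2) Γ := by
    refine ⟨by norm_num [← NNReal.coe_lt_coe], LipschitzWith.of_dist_le_mul fun v w => ?_⟩
    refine (BoundedContinuousFunction.dist_le (by positivity)).2 fun t => ?_
    rw [dist_eq_norm, hΓ, hΓ, ← smul_sub, add_sub_add_left_eq_sub,
      ← intervalIntegral.integral_sub ((hg v).intervalIntegrable _ _)
        ((hg w).intervalIntegrable _ _), norm_smul, Real.norm_eq_abs, Real.abs_exp]
    have hbd : ∀ s, ‖B s (Real.exp (l * |s|) • v s) - B s (Real.exp (l * |s|) • w s)‖ ≤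
        K * dist v w * Real.exp (l * |s|) := fun s => by
      have h := hK s (Real.exp (l * |s|) • v s) (Real.exp (l * |s|) • w s)
      rw [← smul_sub, norm_smul, Real.norm_eq_abs, Real.abs_exp, ← dist_eq_norm (v s)] at h
      calc _ ≤ K * dist (v s) (w s) * Real.exp (l * |s|) := h.trans_eq (by ring)
        _ ≤ _ := by
          have := v.dist_coe_le_dist (g := w) s
          gcongr
    refine (mul_le_mul_of_nonneg_left (norm_integral_le_of_exp_bound hl0 hbd t)
      (Real.exp_pos _).le).trans ?_
    rw [hexp', hl]
    apply le_of_eq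
    push_cast
    field_simp
  obtain ⟨v, hv⟩ : ∃ v, Γ v = v := ⟨_, hcontr.fixedPoint_isFixedPt⟩
  have hp : ∀ t, Real.exp (l * |t|) • v t =
      x + ∫ s in (0 : ℝ)..t, B s (Real.exp (l * |s|) • v s) := fun t => by
    conv_lhs => rw [← hv, hΓ, smul_smul, ← Real.exp_add, add_neg_cancel, Real.exp_zero, one_smul]
  refine ⟨fun t => Real.exp (l * |t|) • v t, by simpa using hp 0, fun t => ?_⟩
  rw [funext hp]
  beta_reduce
  rw [← hp t]
  exact (intervalIntegral.integral_hasDerivAt_right ((hg v).intervalIntegrable _ _)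
    ((hg v).stronglyMeasurableAtFilter _ _) (hg v).continuousAt).const_add x

end ODE

/-- Solving inside the complete space `K` shows that the solution never leaves `K`. -/
theorem exists_hasDerivAt_of_mem_submodule {E : Type*} [NormedAddCommGroup E] [NormedSpace ℂ E]
    [CompleteSpace E] {K : Submodule ℂ E} (hK : IsClosed (K : Set E)) {B : ℝ → E →L[ℂ] E}
    (hc : ∀ u, Continuous fun t => B t u) {T M : ℝ} (hM : ∀ t ∈ Set.Icc (-T) T, ‖B t‖ ≤ M)
    (hBK : ∀ t, ∀ u ∈ K, B t u ∈ K) {x : E} (hx : x ∈ K) :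
    ∃ y : ℝ → E, y 0 = x ∧ (∀ t, y t ∈ K) ∧ ∀ t ∈ Set.Icc (-T) T, HasDerivAt y (B t (y t)) t := by
  rcases lt_or_ge T 0 with hT | hT
  · exact ⟨fun _ => x, rfl, fun _ => hx, fun t ht => by linarith [ht.1, ht.2]⟩
  have : CompleteSpace K := hK.completeSpace_coe
  -- Freezing the time outside `[-T, T]` turns the local bound `M` into a global Lipschitz constant
  -- without changing the equation on `[-T, T]`.
  let r : ℝ → ℝ := fun t => max (-T) (min T t)
  have hr : Continuous r := by fun_prop
  have hr1 : ∀ t, r t ∈ Set.Icc (-T) T := fun t =>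
    ⟨le_max_left _ _, max_le (by linarith) (min_le_left _ _)⟩
  have hr2 : ∀ t ∈ Set.Icc (-T) T, r t = t := fun t ht => by
    simp only [r, min_eq_right ht.2, max_eq_right ht.1]
  have hM0 : 0 ≤ M := (norm_nonneg _).trans (hM 0 ⟨by linarith, hT⟩)
  let B' : ℝ → K → K := fun t u => ⟨B (r t) u, hBK _ _ u.2⟩
  obtain ⟨p, hp0, hp⟩ := exists_hasDerivAt_of_lipschitz (B := B') (K := M + 1) (by linarith)
    (fun u => ((hc u).comp hr).subtype_mk _) (fun t u w => by
      change ‖B (r t) u - B (r t) w‖ ≤ (M + 1) * ‖(u : E) - w‖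
      rw [← map_sub]
      refine ((B (r t)).le_opNorm _).trans (mul_le_mul_of_nonneg_right ?_ (norm_nonneg _))
      linarith [hM _ (hr1 t)]) (fun t => Subtype.ext (by simp [B'])) ⟨x, hx⟩
  refine ⟨fun t => p t, congrArg Subtype.val hp0, fun t => (p t).2, fun t ht => ?_⟩
  have h := (K.subtypeL.restrictScalars ℝ).hasFDerivAt.comp_hasDerivAt t (hp t)
  have h2 : (K.subtypeL.restrictScalars ℝ) (B' t (p t)) = B t (p t) := by
    change B (r t) (p t) = _
    rw [hr2 t ht]
  rw [h2] at h
  exact h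

/-! ### Growth of solutions up to skew-adjoint terms -/

/-- Gronwall for `∑ ‖q i‖`, formulated with `Re ⟨q, q'⟩` so that skew-adjoint parts of `q'` cost
nothing. The norm is not differentiable at `0`; it is replaced by `√(κ² + ‖q‖²)`, and `κ → 0` at the
end. -/
theorem sum_norm_le_of_re_inner_le {H ι : Type*} [NormedAddCommGroup H] [InnerProductSpace ℂ H]
    [Fintype ι] {q q' : ι → ℝ → H} {b : ι → ℝ → ℝ} {D η T : ℝ} (hD : 0 ≤ D) (hη : 0 ≤ η)
    (hq : ∀ i, ∀ t ∈ Set.Icc 0 T, HasDerivAt (q i) (q' i t) t)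
    (hb : ∀ i, ∀ t ∈ Set.Icc 0 T, 0 ≤ b i t)
    (hre : ∀ i, ∀ t ∈ Set.Icc 0 T, (inner ℂ (q i t) (q' i t)).re ≤ ‖q i t‖ * b i t)
    (hsum : ∀ t ∈ Set.Icc 0 T, ∑ i, b i t ≤ D * ∑ i, ‖q i t‖ + η) {t : ℝ}
    (ht : t ∈ Set.Icc 0 T) :
    ∑ i, ‖q i t‖ ≤ Real.exp (D * t) * (∑ i, ‖q i 0‖ + η * t) := by
  have key : ∀ κ : ℝ, 0 < κ → ∑ i, ‖q i t‖ ≤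
      Real.exp (D * t) * (∑ i, (‖q i 0‖ + κ) + η * t) := fun κ hκ => by
    set f : ι → ℝ → ℝ := fun i t => Real.sqrt (κ ^ 2 + ‖q i t‖ ^ 2) with hf
    have hpos : ∀ i t, 0 < κ ^ 2 + ‖q i t‖ ^ 2 := fun i t => by positivity
    have hfq : ∀ i t, ‖q i t‖ ≤ f i t := fun i t =>
      Real.le_sqrt_of_sq_le (by nlinarith)
    have hf0 : ∀ i t, 0 < f i t := fun i t => Real.sqrt_pos.2 (hpos i t)
    have hfd : ∀ i, ∀ t ∈ Set.Icc 0 T, HasDerivAt (f i)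
        ((inner ℂ (q i t) (q' i t)).re / f i t) t := fun i t ht => by
      have h1 : HasDerivAt (fun t => (inner ℂ (q i t) (q i t)).re)
          (inner ℂ (q i t) (q' i t) + inner ℂ (q' i t) (q i t)).re t :=
        Complex.reCLM.hasFDerivAt.comp_hasDerivAt t ((hq i t ht).inner ℂ (hq i t ht))
      have h2 : (fun t => (inner ℂ (q i t) (q i t)).re) = fun t => ‖q i t‖ ^ 2 := by
        ext t
        rw [inner_self_eq_norm_sq_to_K]
        norm_cast
      have h3 : (inner ℂ (q i t) (q' i t) + inner ℂ (q' i t) (q i t)).re =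
          2 * (inner ℂ (q i t) (q' i t)).re := by
        rw [Complex.add_re, ← inner_conj_symm (q' i t), Complex.conj_re]
        ring
      rw [h2, h3] at h1
      refine ((h1.const_add (κ ^ 2)).sqrt (hpos i t).ne').congr_deriv ?_
      change _ = _ / Real.sqrt _
      rw [mul_div_mul_left _ _ two_ne_zero]
    -- With the integrating factor `e^{-Dt}` and the forcing subtracted, `G` is nonincreasing; since
    -- `D t ≥ 0`, the factor `e^{-Dt}` in front of the forcing `η` can be bounded by `1`.
    set G : ℝ → ℝ := fun t => Real.exp (-(D * t)) * ∑ i, f i t - η * t with hG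
    have hGd : ∀ t ∈ Set.Icc 0 T, HasDerivAt G (Real.exp (-(D * t)) * (-D) * ∑ i, f i t +
        Real.exp (-(D * t)) * ∑ i, (inner ℂ (q i t) (q' i t)).re / f i t - η) t := fun t ht => by
      have h1 : HasDerivAt (fun t => Real.exp (-(D * t))) (Real.exp (-(D * t)) * (-D)) t := by
        simpa using (((hasDerivAt_id t).const_mul D).neg).exp
      have h2 := h1.mul (HasDerivAt.fun_sum (u := Finset.univ) fun i _ => hfd i t ht)
      have h3 := h2.sub ((hasDerivAt_id t).const_mul η)
      rw [mul_one] at h3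
      exact h3
    have hanti : AntitoneOn G (Set.Icc 0 T) := by
      refine antitoneOn_of_deriv_nonpos (convex_Icc 0 T)
        (fun t ht => (hGd t ht).continuousAt.continuousWithinAt)
        (fun t ht => (hGd t (interior_subset ht)).differentiableAt.differentiableWithinAt)
        fun t ht => ?_
      have ht := interior_subset ht
      rw [(hGd t ht).deriv]
      have h1 : ∑ i, (inner ℂ (q i t) (q' i t)).re / f i t ≤ D * ∑ i, f i t + η := by
        calc ∑ i, (inner ℂ (q i t) (q' i t)).re / f i t ≤ ∑ i, b i t := by
              refine Finset.sum_le_sum fun i _ => ?_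
              rw [div_le_iff₀ (hf0 i t), mul_comm]
              exact (hre i t ht).trans (mul_le_mul_of_nonneg_right (hfq i t) (hb i t ht))
          _ ≤ D * ∑ i, ‖q i t‖ + η := hsum t ht
          _ ≤ D * ∑ i, f i t + η := by
              have := Finset.sum_le_sum fun i (_ : i ∈ Finset.univ) => hfq i t
              gcongr
      have h2 : Real.exp (-(D * t)) ≤ 1 :=
        Real.exp_le_one_iff.2 (by linarith [mul_nonneg hD ht.1])
      have h3 := Real.exp_pos (-(D * t))
      nlinarith
    have h0T : (0 : ℝ) ∈ Set.Icc 0 T := ⟨le_rfl, ht.1.trans ht.2⟩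
    have h1 := hanti h0T ht ht.1
    have h2 : G 0 ≤ ∑ i, (‖q i 0‖ + κ) := by
      simp only [hG, mul_zero, neg_zero, Real.exp_zero, one_mul, sub_zero]
      refine Finset.sum_le_sum fun i _ => ?_
      refine Real.sqrt_le_iff.2 ⟨by positivity, ?_⟩
      nlinarith [norm_nonneg (q i 0)]
    have h3 : Real.exp (-(D * t)) * ∑ i, f i t ≤ ∑ i, (‖q i 0‖ + κ) + η * t := by
      simp only [hG] at h1 h2
      linarith
    calc ∑ i, ‖q i t‖ ≤ ∑ i, f i t := Finset.sum_le_sum fun i _ => hfq i t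
      _ = Real.exp (D * t) * (Real.exp (-(D * t)) * ∑ i, f i t) := by
          rw [← mul_assoc, ← Real.exp_add, add_neg_cancel, Real.exp_zero, one_mul]
      _ ≤ _ := mul_le_mul_of_nonneg_left h3 (Real.exp_pos _).le
  have hlim : Tendsto (fun κ : ℝ => Real.exp (D * t) * (∑ i, (‖q i 0‖ + κ) + η * t)) (𝓝[>] 0)
      (𝓝 (Real.exp (D * t) * (∑ i, (‖q i 0‖ + 0) + η * t))) := by
    refine Tendsto.mono_left ?_ nhdsWithin_le_nhds
    exact Continuous.tendsto (by fun_prop) 0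
  simp only [add_zero] at hlim
  exact ge_of_tendsto hlim (eventually_mem_nhdsWithin.mono key)

end

section

open MvPolynomial

/-! ### The evolution with a truncated potential -/

theorem flow_neg_flow (t : ℝ) (f : L2 n) : (flow (-t)).onL2 ((flow t).onL2 f) = f := by
  rw [flow_add, neg_add_cancel, flow_zero]

theorem flow_flow_neg (t : ℝ) (f : L2 n) : (flow t).onL2 ((flow (-t)).onL2 f) = f := by
  rw [flow_add, add_neg_cancel, flow_zero]

theorem inner_flow_neg (t : ℝ) (f g : L2 n) :
    inner ℂ f ((flow (-t)).onL2 g) = inner ℂ ((flow t).onL2 f) g := by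
  conv_rhs => rw [← flow_flow_neg t g]
  exact ((LinearIsometry.mk (flow t).onL2.toLinearMap (flow t).norm_onL2).inner_map_map _ _).symm

/-- The generator in the interaction picture. -/
def gen (ε : ℝ) (v : Config n → ℂ) (t : ℝ) (f : L2 n) : L2 n :=
  -(flow (-t)).onL2 (pot ε v ((flow t).onL2 f))

/-- Solutions of the evolution equation in the interaction picture. -/
def IsEvol (ε : ℝ) (v : Config n → ℂ) (p : ℝ → L2 n) : Prop :=
  ∀ t, HasDerivAt p (gen ε v t (p t)) t

theorem pot_sub {ε : ℝ} {v : Config n → ℂ} (hv : Integrable v) (f g : L2 n) :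
    pot ε v (f - g) = pot ε v f - pot ε v g := by
  obtain ⟨L, hL⟩ := exists_pot_clm ε hv
  simp only [← hL, map_sub]

theorem gen_sub {ε : ℝ} {v : Config n → ℂ} (hv : Integrable v) (t : ℝ) (f g : L2 n) :
    gen ε v t (f - g) = gen ε v t f - gen ε v t g := by
  simp only [gen, map_sub, pot_sub hv]
  abel

theorem re_inner_gen {ε : ℝ} {v : Config n → ℂ} (hv : IsTruncated v) (t : ℝ) (f : L2 n) :
    (inner ℂ f (gen ε v t f)).re = 0 := by
  rw [gen, inner_neg_right, inner_flow_neg, Complex.neg_re, re_inner_pot hv.integrable hv.herm,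
    neg_zero]

theorem exists_isEvol (ε : ℝ) {v : Config n → ℂ} (hv : Integrable v) (f : L2 n) :
    ∃ p, p 0 = f ∧ IsEvol ε v p := by
  obtain ⟨L, hL⟩ := exists_pot_clm ε hv
  refine exists_hasDerivAt_of_lipschitz (B := gen ε v) (K := ‖L‖ + 1) (by positivity) ?_ ?_ ?_ f
  · intro u
    simp only [gen, ← hL]
    exact (Twist.continuous_onL2_comp (Q := fun t => flow (-t))
      (fun f => (continuous_flow f).comp continuous_neg)
      (L.continuous.comp (continuous_flow u))).neg
  · intro t u w
    rw [← gen_sub hv, gen, norm_neg, Twist.norm_onL2, ← hL]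
    refine (L.le_opNorm _).trans ?_
    rw [Twist.norm_onL2]
    gcongr
    linarith
  · intro t
    simp [gen, ← hL]

/-- The derivative of `‖q‖²` is `2 Re ⟨q, q'⟩`. Applied to the difference of two solutions of a
skew-adjoint linear equation, this is also the uniqueness statement. -/
theorem norm_eq_of_re_inner_eq_zero {H : Type*} [NormedAddCommGroup H] [InnerProductSpace ℂ H]
    {q q' : ℝ → H} {T : ℝ} (hq : ∀ t ∈ Set.Icc (-T) T, HasDerivAt q (q' t) t)
    (h : ∀ t ∈ Set.Icc (-T) T, (inner ℂ (q t) (q' t)).re = 0) {t : ℝ} (ht : t ∈ Set.Icc (-T) T) :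
    ‖q t‖ = ‖q 0‖ := by
  have hd : ∀ t ∈ Set.Icc (-T) T, HasDerivWithinAt (fun t => ‖q t‖ ^ 2) 0 (Set.Icc (-T) T) t :=
    fun t ht => by
    have h1 : HasDerivAt (fun t => (inner ℂ (q t) (q t)).re)
        (inner ℂ (q t) (q' t) + inner ℂ (q' t) (q t)).re t :=
      Complex.reCLM.hasFDerivAt.comp_hasDerivAt t ((hq t ht).inner ℂ (hq t ht))
    have h2 : (fun t => (inner ℂ (q t) (q t)).re) = fun t => ‖q t‖ ^ 2 := by
      ext t
      rw [inner_self_eq_norm_sq_to_K]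
      norm_cast
    have h3 : (inner ℂ (q t) (q' t) + inner ℂ (q' t) (q t)).re = 0 := by
      rw [Complex.add_re, ← inner_conj_symm (q' t), Complex.conj_re, h t ht, add_zero]
    rw [h2, h3] at h1
    exact h1.hasDerivWithinAt
  have h0 : (0 : ℝ) ∈ Set.Icc (-T) T := ⟨by linarith [ht.1, ht.2], by linarith [ht.1, ht.2]⟩
  have := (convex_Icc (-T) T).norm_image_sub_le_of_norm_hasDerivWithin_le (𝕜 := ℝ) (C := 0) hd
    (by simp) h0 ht
  rw [zero_mul, norm_le_zero_iff, sub_eq_zero] at this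
  exact (pow_left_inj₀ (norm_nonneg _) (norm_nonneg _) two_ne_zero).1 this

theorem IsEvol.norm_sub_eq {ε : ℝ} {v : Config n → ℂ} (hv : IsTruncated v) {p r : ℝ → L2 n}
    (hp : IsEvol ε v p) (hr : IsEvol ε v r) (t : ℝ) : ‖p t - r t‖ = ‖p 0 - r 0‖ :=
  norm_eq_of_re_inner_eq_zero (q := p - r) (T := |t|) (fun t _ => (hp t).sub (hr t))
    (fun t _ => by
      rw [← gen_sub hv.integrable]
      exact re_inner_gen hv t _) ⟨neg_abs_le t, le_abs_self t⟩

/-- The free transport acting on jets. -/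
def jetFlow (m : ℕ) (t : ℝ) : Jet n m →L[ℂ] Jet n m := jetMap m (flow t) (flowSub t)

theorem continuous_jetFlow {X : Type*} [TopologicalSpace X] {g : X → Jet n m} (hg : Continuous g)
    {r : X → ℝ} (hr : Continuous r) : Continuous fun t => jetFlow m (r t) (g t) :=
  continuous_pi fun _ => Twist.continuous_onL2_comp (Q := fun t => flow (r t))
    (fun f => (continuous_flow f).comp hr)
    (((continuous_contract_algHom continuous_coeff_flowSub _).comp hr).clm_apply hg)

theorem flowSub_comp (s t : ℝ) (P : MvPolynomial (Idx n) ℂ) :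
    flowSub s (flowSub t P) = flowSub (s + t) P := by
  rw [← AlgHom.comp_apply]
  congr 1
  refine MvPolynomial.algHom_ext fun e => ?_
  rcases e with i | i
  · simp only [AlgHom.comp_apply, flowSub_inl]
  · simp only [AlgHom.comp_apply, flowSub_inr, map_sub, map_smul, flowSub_inl, mul_add,
      Complex.ofReal_add]
    module

theorem flowSub_zero (P : MvPolynomial (Idx n) ℂ) : flowSub 0 P = P := by
  have : (flowSub 0 : MvPolynomial (Idx n) ℂ →ₐ[ℂ] _) = AlgHom.id ℂ _ := by
    refine MvPolynomial.algHom_ext fun e => ?_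
    rcases e with i | i
    · simp [flowSub_inl]
    · simp [flowSub_inr]
  rw [this, AlgHom.id_apply]

theorem jetFlow_jetFlow_neg (t : ℝ) (u : Jet n m) : jetFlow m t (jetFlow m (-t) u) = u := by
  ext1 α
  rw [jetFlow, jetMap_apply, jetFlow, contract_jetMap ((intertwines_flow t).totalDegree_monomial_le α),
    flow_flow_neg, flowSub_comp, neg_add_cancel, flowSub_zero, contract_monomial]

/-- The generator in the interaction picture, acting on jets. -/
def jetGen (m : ℕ) (ε : ℝ) {v : Config n → ℂ} (hv : IsTruncated v) (t : ℝ) :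
    Jet n m →L[ℂ] Jet n m :=
  -(jetFlow m (-t) ∘L jetPot m ε hv ∘L jetFlow m t)

theorem jetGen_apply (ε : ℝ) {v : Config n → ℂ} (hv : IsTruncated v) (t : ℝ) (u : Jet n m) :
    jetGen m ε hv t u = -jetFlow m (-t) (jetPot m ε hv (jetFlow m t u)) := rfl

theorem norm_jetFlow_le (t : ℝ) : ‖(jetFlow m t : Jet n m →L[ℂ] Jet n m)‖ ≤ ∑ α : multiIdx n m,
    ‖(contract (flowSub t (monomial α.1 1)) : Jet n m →L[ℂ] L2 n)‖ := by
  refine ContinuousLinearMap.opNorm_le_bound _ (by positivity) fun u => ?_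
  refine (pi_norm_le_iff_of_nonneg (by positivity)).2 fun α => ?_
  rw [jetFlow, jetMap_apply, Twist.norm_onL2]
  refine (ContinuousLinearMap.le_opNorm _ _).trans (mul_le_mul_of_nonneg_right ?_ (norm_nonneg _))
  exact Finset.single_le_sum (f := fun α : multiIdx n m =>
    ‖(contract (flowSub t (monomial α.1 1)) : Jet n m →L[ℂ] L2 n)‖)
    (fun _ _ => norm_nonneg _) (Finset.mem_univ α)

theorem exists_norm_jetFlow_le (n m : ℕ) (T : ℝ) :
    ∃ C, 0 ≤ C ∧ ∀ t ∈ Set.Icc (-T) T, ‖(jetFlow m t : Jet n m →L[ℂ] Jet n m)‖ ≤ C := by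
  have hb : Continuous fun t => ∑ α : multiIdx n m,
      ‖(contract (flowSub t (monomial α.1 1)) : Jet n m →L[ℂ] L2 n)‖ :=
    continuous_finsetSum _ fun α _ => (continuous_contract_algHom continuous_coeff_flowSub _).norm
  obtain ⟨C, hC⟩ := isCompact_Icc (a := -T) (b := T) |>.exists_bound_of_continuousOn hb.continuousOn
  exact ⟨max C 0, le_max_right _ _, fun t ht => (norm_jetFlow_le t).trans
    ((le_abs_self _).trans ((hC t ht).trans (le_max_left _ _)))⟩

/-- Closed spaces of jets which are invariant under the evolution. -/
structure IsInvariant (ε : ℝ) (K : Submodule ℂ (Jet n m)) : Prop where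
  isClosed : IsClosed (K : Set (Jet n m))
  jetDif_mem : ∀ S, ∀ u ∈ K, jetDif m ε S u ∈ K
  jetFlow_mem : ∀ t, ∀ u ∈ K, jetFlow m t u ∈ K

theorem isInvariant_weakJets (ε : ℝ) : IsInvariant ε (weakJets n m) where
  isClosed := isClosed_weakJets
  jetDif_mem S _ hu := jetDif_mem_weakJets ε S hu
  jetFlow_mem t _ hu := (intertwines_flow t).jetMap_mem_weakJets hu

/-- Needed for uniqueness: the weak equation is assumed for test functions only and extends no
further than to the closure of their jets. -/
theorem isInvariant_testJets (ε : ℝ) : IsInvariant ε (testJets n m) where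
  isClosed := isClosed_testJets
  jetDif_mem S _ hu := jetDif_mem_testJets ε S hu
  jetFlow_mem t _ hu := (intertwines_flow t).jetMap_mem_testJets hu

/-- The evolution of jets: the first component is the evolution in `L²`. -/
theorem exists_jet_evol {ε : ℝ} {v : Config n → ℂ} (hv : IsTruncated v)
    {K : Submodule ℂ (Jet n m)} (hK : IsInvariant ε K) {p : ℝ → L2 n} (hp : IsEvol ε v p)
    {u : Jet n m} (hu : u ∈ K) (hup : u zeroIdx = p 0) (T : ℝ) :
    ∃ y : ℝ → Jet n m, y 0 = u ∧ (∀ t, y t ∈ K) ∧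
      (∀ t ∈ Set.Icc (-T) T, HasDerivAt y (jetGen m ε hv t (y t)) t) ∧
      ∀ t ∈ Set.Icc (-T) T, y t zeroIdx = p t := by
  have hc : ∀ u : Jet n m, Continuous fun t => jetGen m ε hv t u := fun u =>
    (continuous_jetFlow ((jetPot m ε hv).continuous.comp
      (continuous_jetFlow continuous_const continuous_id)) continuous_neg).neg
  obtain ⟨C, hC0, hC⟩ := exists_norm_jetFlow_le n m T
  have hM : ∀ t ∈ Set.Icc (-T) T, ‖jetGen m ε hv t‖ ≤ C * (‖jetPot m ε hv‖ * C) := fun t ht => by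
    rw [jetGen, norm_neg]
    refine (ContinuousLinearMap.opNorm_comp_le _ _).trans ?_
    refine mul_le_mul (hC (-t) ⟨by linarith [ht.2], by linarith [ht.1]⟩) ?_ (norm_nonneg _) hC0
    refine (ContinuousLinearMap.opNorm_comp_le _ _).trans ?_
    exact mul_le_mul_of_nonneg_left (hC t ht) (norm_nonneg _)
  obtain ⟨y, hy0, hyK, hy⟩ := exists_hasDerivAt_of_mem_submodule hK.isClosed hc hM
    (fun t u hu => K.neg_mem (hK.jetFlow_mem _ _ (jetPot_mem_of_isClosed ε hv hK.isClosed
      hK.jetDif_mem (hK.jetFlow_mem _ _ hu)))) hu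
  refine ⟨y, hy0, hyK, hy, fun t ht => ?_⟩
  have hy1 : ∀ t ∈ Set.Icc (-T) T, HasDerivAt (fun t => y t zeroIdx) (gen ε v t (y t zeroIdx)) t :=
    fun t ht => by
    have h := (hasDerivAt_pi.1 (hy t ht)) zeroIdx
    have h1 : jetGen m ε hv t (y t) zeroIdx = gen ε v t (y t zeroIdx) := by
      rw [jetGen_apply, Pi.neg_apply, jetFlow, jetMap_zeroIdx, jetPot_zeroIdx, jetFlow,
        jetMap_zeroIdx, gen]
    rwa [h1] at h
  -- The first component and `p` solve the same skew-adjoint equation with the same initial value,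
  -- so they agree; thus the jets really are the derivatives of the `L²` evolution.
  have h := norm_eq_of_re_inner_eq_zero (q := fun t => y t zeroIdx - p t) (T := T)
    (fun t ht => (hy1 t ht).sub (hp t)) (fun t _ => by
      rw [← gen_sub hv.integrable]
      exact re_inner_gen hv t _) ht
  simp only [hy0, hup, sub_self, norm_zero] at h
  exact sub_eq_zero.1 (norm_eq_zero.1 h)

/-! ### The growth of Sobolev norms -/

/-- The norms of the entries of a jet, extended by zero. -/
def entryNorm (u : Jet n m) (β : Idx n →₀ ℕ) : ℝ :=
  if h : β ∈ multiIdx n m then ‖u ⟨β, h⟩‖ else 0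

theorem entryNorm_nonneg (u : Jet n m) (β : Idx n →₀ ℕ) : 0 ≤ entryNorm u β := by
  unfold entryNorm
  split_ifs
  · exact norm_nonneg _
  · exact le_rfl

theorem entryNorm_coe (u : Jet n m) (β : multiIdx n m) : entryNorm u β = ‖u β‖ := by
  rw [entryNorm, dif_pos β.2]

/-- The coefficients in the Leibniz rule, without the power of `|S|`. -/
def leibnizCoeff (α β : Idx n →₀ ℕ) : ℝ :=
  ∏ e, ((α e).choose (β e) : ℝ) *
    (Sum.elim (fun _ => 2 * Real.pi) (fun _ => 0) e : ℝ) ^ (α e - β e)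

theorem leibnizCoeff_nonneg (α β : Idx n →₀ ℕ) : 0 ≤ leibnizCoeff α β := by
  refine Finset.prod_nonneg fun e _ => mul_nonneg (by positivity) (pow_nonneg ?_ _)
  rcases e with i | i
  · simp only [Sum.elim_inl]
    positivity
  · simp

theorem leibnizCoeff_eq_zero {α β : Idx n →₀ ℕ} (h : ¬β ≤ α) : leibnizCoeff α β = 0 := by
  rw [Finsupp.le_def, not_forall] at h
  obtain ⟨e, he⟩ := h
  refine Finset.prod_eq_zero (Finset.mem_univ e) ?_
  rw [Nat.choose_eq_zero_of_lt (not_le.1 he), Nat.cast_zero, zero_mul]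

theorem norm_freq_le (S : Config n) (e : Idx n) :
    ‖freq S e‖ ≤ (Sum.elim (fun _ => 2 * Real.pi) (fun _ => 0) e : ℝ) * ‖S‖ := by
  rcases e with i | i
  · simp only [freq, Sum.elim_inl, norm_mul, Complex.norm_real, Complex.norm_I, mul_one,
      Real.norm_eq_abs, abs_of_pos Real.pi_pos, abs_two]
    have := PiLp.norm_apply_le S i
    rw [Real.norm_eq_abs] at this
    gcongr
  · simp [freq]

theorem degree_lt_of_le_of_ne {α β : Idx n →₀ ℕ} (h : β ≤ α) (hne : β ≠ α) :
    β.degree < α.degree := by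
  rw [Finsupp.degree_eq_sum, Finsupp.degree_eq_sum]
  refine Finset.sum_lt_sum (fun e _ => h e) ?_
  by_contra hc
  push Not at hc
  exact hne (le_antisymm h fun e => hc e (Finset.mem_univ e))

/-- The additional `‖S‖` will come from the difference in `k`. For `β ≤ α`, `β ≠ α`, the total power
of `‖S‖` is between `2` and `m + 1`, so it is at most `‖S‖` if `‖S‖ ≤ 1` and at most `‖S‖ ^ (m + 1)`
otherwise. This is the origin of the moment in the rate. -/
theorem norm_coeff_weylSub_mul_le (S : Config n) {α β : Idx n →₀ ℕ} (hα : α ∈ multiIdx n m)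
    (hne : β ≠ α) :
    ‖coeff β (weylSub S (monomial α 1))‖ * ‖S‖ ≤
      leibnizCoeff α β * (‖S‖ + ‖S‖ ^ (m + 1)) := by
  rw [coeff_weylSub_monomial]
  by_cases h : β ≤ α
  · have h1 : ‖∏ e, ((α e).choose (β e) : ℂ) * freq S e ^ (α e - β e)‖ ≤
        leibnizCoeff α β * ‖S‖ ^ (α.degree - β.degree) := by
      have hd : α.degree - β.degree = ∑ e, (α e - β e) := by
        rw [Finset.sum_tsub_distrib _ fun e _ => h e, Finsupp.degree_eq_sum, Finsupp.degree_eq_sum]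
      rw [hd, ← Finset.prod_pow_eq_pow_sum, leibnizCoeff, ← Finset.prod_mul_distrib, norm_prod]
      refine Finset.prod_le_prod (fun e _ => norm_nonneg _) fun e _ => ?_
      rw [norm_mul, norm_pow, RCLike.norm_natCast, mul_assoc, ← mul_pow]
      gcongr
      exact norm_freq_le S e
    have h2 := degree_lt_of_le_of_ne h hne
    have h3 := mem_multiIdx.1 hα
    have h4 : ‖S‖ ^ (α.degree - β.degree) * ‖S‖ ≤ ‖S‖ + ‖S‖ ^ (m + 1) := by
      rw [← pow_succ]
      have h0 := norm_nonneg S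
      rcases le_total ‖S‖ 1 with hS | hS
      · have := pow_le_pow_of_le_one h0 hS (show 1 ≤ α.degree - β.degree + 1 by omega)
        rw [pow_one] at this
        have := pow_nonneg h0 (m + 1)
        linarith
      · have := pow_le_pow_right₀ hS (show α.degree - β.degree + 1 ≤ m + 1 by omega)
        linarith
    calc _ ≤ leibnizCoeff α β * ‖S‖ ^ (α.degree - β.degree) * ‖S‖ := by gcongr
      _ = leibnizCoeff α β * (‖S‖ ^ (α.degree - β.degree) * ‖S‖) := mul_assoc _ _ _
      _ ≤ _ := mul_le_mul_of_nonneg_left h4 (leibnizCoeff_nonneg _ _)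
  · rw [leibnizCoeff_eq_zero h, zero_mul]
    rw [Finsupp.le_def, not_forall] at h
    obtain ⟨e, he⟩ := h
    rw [Finset.prod_eq_zero (Finset.mem_univ e), norm_zero, zero_mul]
    rw [Nat.choose_eq_zero_of_lt (not_le.1 he), Nat.cast_zero, zero_mul]

theorem norm_dif_le_entryNorm {ε : ℝ} (hε : 0 ≤ ε) (S : Config n) {u : Jet n m}
    (hu : u ∈ weakJets n m) {β : multiIdx n m} (hβ : β.1.degree < m) :
    ‖dif ε S (u β)‖ ≤ ε * ‖S‖ * ∑ j, entryNorm u (β.1 + Finsupp.single (Sum.inr j) 1) := by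
  have hmem : ∀ j : Fin n, β.1 + Finsupp.single (Sum.inr j) 1 ∈ multiIdx n m := fun j => by
    rw [mem_multiIdx, map_add, Finsupp.degree_single]
    omega
  refine (norm_dif_le_of_mem_weakJets hε S hu
    (β := fun j => ⟨β.1 + Finsupp.single (Sum.inr j) 1, hmem j⟩) fun j => rfl).trans (le_of_eq ?_)
  congr 1
  refine Finset.sum_congr rfl fun j _ => ?_
  rw [← entryNorm_coe]

/-- The Leibniz term `β = α` has coefficient `1` and is exactly `pot ε v (u α)`. It has to be split
off, since for `|α| = m` no further derivative is available to estimate it, but it is skew-adjoint.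
In the other terms `|β| < m` leaves room for the momentum derivative spent on `dif`, whose factor
`ε` cancels the prefactor. -/
theorem norm_jetPot_sub_le {ε : ℝ} (hε : 0 < ε) {v : Config n → ℂ} (hv : IsTruncated v)
    {u : Jet n m} (hu : u ∈ weakJets n m) (α : multiIdx n m) :
    ‖jetPot m ε hv u α - pot ε v (u α)‖ ≤ (∫ S, ‖v S‖ * (‖S‖ + ‖S‖ ^ (m + 1))) *
      ∑ β ∈ (multiIdx n m).erase α, leibnizCoeff α.1 β *
        ∑ j, entryNorm u (β + Finsupp.single (Sum.inr j) 1) := by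
  classical
  set Z := ∑ β ∈ (multiIdx n m).erase α, leibnizCoeff α.1 β *
        ∑ j, entryNorm u (β + Finsupp.single (Sum.inr j) 1) with hZ
  have hint : Integrable fun S => ‖v S‖ * (‖S‖ + ‖S‖ ^ (m + 1)) :=
    hv.integrable_mul (by fun_prop)
  have hself : ∀ S, coeff α.1 (weylSub S (monomial α.1 1)) = 1 := fun S => by
    rw [coeff_weylSub_monomial]
    simp
  have hsplit : ∀ S, contract (weylSub S (monomial α.1 1)) u - u α =
      ∑ β ∈ Finset.univ.erase α, coeff β.1 (weylSub S (monomial α.1 1)) • u β := fun S => by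
    rw [contract_apply, ← Finset.add_sum_erase _ _ (Finset.mem_univ α), hself, one_smul,
      add_sub_cancel_left]
  have hle : ∀ S, ‖dif ε S (contract (weylSub S (monomial α.1 1)) u - u α)‖ ≤
      ε * (‖S‖ + ‖S‖ ^ (m + 1)) * Z := fun S => by
    rw [hsplit, map_sum, hZ, Finset.mul_sum]
    have hsum : ∑ β ∈ (multiIdx n m).erase α, ε * (‖S‖ + ‖S‖ ^ (m + 1)) *
        (leibnizCoeff α.1 β * ∑ j, entryNorm u (β + Finsupp.single (Sum.inr j) 1)) =
        ∑ β ∈ (Finset.univ : Finset (multiIdx n m)).erase α, ε * (‖S‖ + ‖S‖ ^ (m + 1)) *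
        (leibnizCoeff α.1 β.1 * ∑ j, entryNorm u (β.1 + Finsupp.single (Sum.inr j) 1)) := by
      rw [← Finset.sum_attach ((multiIdx n m).erase α.1)]
      refine Finset.sum_bij (fun β _ => ⟨β.1, (Finset.mem_erase.1 β.2).2⟩) ?_ ?_ ?_ ?_
      · intro β _
        refine Finset.mem_erase.2 ⟨fun h => (Finset.mem_erase.1 β.2).1 ?_, Finset.mem_univ _⟩
        exact congrArg (fun x : multiIdx n m => x.1) h
      · intro β _ β' _ h
        exact Subtype.ext (congrArg (fun x : multiIdx n m => x.1) h)
      · intro β hβ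
        exact ⟨⟨β.1, Finset.mem_erase.2 ⟨fun h => (Finset.mem_erase.1 hβ).1 (Subtype.ext h), β.2⟩⟩,
          Finset.mem_attach _ _, rfl⟩
      · intro β _
        rfl
    rw [hsum]
    refine norm_sum_le_of_le _ fun β hβ => ?_
    have hne : β.1 ≠ α.1 := fun h => (Finset.mem_erase.1 hβ).1 (Subtype.ext h)
    set E := ∑ j, entryNorm u (β.1 + Finsupp.single (Sum.inr j) 1) with hE
    have hE0 : 0 ≤ E := Finset.sum_nonneg fun j _ => entryNorm_nonneg _ _
    rw [map_smul, norm_smul]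
    by_cases hle : β.1 ≤ α.1
    · have hd := (degree_lt_of_le_of_ne hle hne).trans_le (mem_multiIdx.1 α.2)
      calc _ ≤ ‖coeff β.1 (weylSub S (monomial α.1 1))‖ * (ε * ‖S‖ * E) :=
            mul_le_mul_of_nonneg_left (norm_dif_le_entryNorm hε.le S hu hd) (norm_nonneg _)
        _ = ε * E * (‖coeff β.1 (weylSub S (monomial α.1 1))‖ * ‖S‖) := by ring
        _ ≤ ε * E * (leibnizCoeff α.1 β.1 * (‖S‖ + ‖S‖ ^ (m + 1))) :=
            mul_le_mul_of_nonneg_left (norm_coeff_weylSub_mul_le S α.2 hne) (by positivity)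
        _ = _ := by ring
    · have h0 : coeff β.1 (weylSub S (monomial α.1 1)) = 0 := by
        rw [Finsupp.le_def, not_forall] at hle
        obtain ⟨e, he⟩ := hle
        rw [coeff_weylSub_monomial]
        refine Finset.prod_eq_zero (Finset.mem_univ e) ?_
        rw [Nat.choose_eq_zero_of_lt (not_le.1 he), Nat.cast_zero, zero_mul]
      rw [h0, norm_zero, zero_mul]
      have := leibnizCoeff_nonneg α.1 β.1
      positivity
  have hεn : ‖Complex.I / (ε : ℂ)‖ = ε⁻¹ := by
    rw [norm_div, Complex.norm_I, Complex.norm_real, Real.norm_eq_abs, abs_of_pos hε, one_div]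
  rw [jetPot_apply, pot, ← smul_sub, ← integral_sub (integrable_jetPot ε hv u α)
    (integrable_smul_dif ε hv.integrable _), norm_smul, hεn]
  have : ‖∫ S, (v S • dif ε S (contract (weylSub S (monomial α.1 1)) u) - v S • dif ε S (u α))‖ ≤
      ∫ S, ‖v S‖ * (‖S‖ + ‖S‖ ^ (m + 1)) * (ε * Z) := by
    refine norm_integral_le_of_norm_le (hint.mul_const _) (Eventually.of_forall fun S => ?_)
    rw [← smul_sub, ← map_sub, norm_smul, mul_assoc]
    refine mul_le_mul_of_nonneg_left ((hle S).trans (le_of_eq ?_)) (norm_nonneg _)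
    ring
  rw [integral_mul_const] at this
  calc _ ≤ ε⁻¹ * ((∫ S, ‖v S‖ * (‖S‖ + ‖S‖ ^ (m + 1))) * (ε * Z)) := by gcongr
    _ = _ := by
      field_simp

/-- The symbol of the commutator with the transport term: one momentum derivative becomes a position
derivative. If `α (Sum.inr i) = 0`, the truncated subtraction gives a meaningless index, but its
coefficient is `0`. -/
theorem flowDer_monomial (α : Idx n →₀ ℕ) :
    flowDer (monomial α 1 : MvPolynomial (Idx n) ℂ) =
      ∑ i, ((-(2 * Real.pi : ℝ) : ℂ) * (α (Sum.inr i) : ℂ)) •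
        monomial (α - Finsupp.single (Sum.inr i) 1 + Finsupp.single (Sum.inl i) 1) 1 := by
  rw [flowDer, mkDerivation_monomial, one_smul, Finsupp.sum_fintype _ _ (by simp),
    Fintype.sum_sum_type]
  simp only [Sum.elim_inl, Sum.elim_inr, Pi.zero_apply, smul_zero, Finset.sum_const_zero, zero_add]
  refine Finset.sum_congr rfl fun i _ => ?_
  rw [smul_eq_mul, mul_smul_comm, X, monomial_mul, mul_one, smul_monomial, smul_monomial]
  simp

theorem degree_sub_single_add_single {α : Idx n →₀ ℕ} {e e' : Idx n} (h : α e ≠ 0) :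
    (α - Finsupp.single e 1 + Finsupp.single e' 1).degree = α.degree := by
  have h1 : Finsupp.single e 1 ≤ α := by
    rw [Finsupp.single_le_iff]
    omega
  have h2 := congrArg Finsupp.degree (tsub_add_cancel_of_le h1)
  rw [map_add, Finsupp.degree_single] at h2
  rw [map_add, Finsupp.degree_single, h2]

theorem totalDegree_flowDer_le (α : multiIdx n m) :
    (flowDer (monomial α.1 1)).totalDegree ≤ m := by
  rw [flowDer_monomial]
  refine (totalDegree_finsetSum _ _).trans (Finset.sup_le fun i _ => ?_)
  by_cases h : α.1 (Sum.inr i) = 0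
  · simp [h]
  · refine (totalDegree_smul_le _ _).trans ((totalDegree_monomial_le _ _).trans ?_)
    exact (degree_sub_single_add_single h).trans_le (mem_multiIdx.1 α.2)

theorem norm_contract_flowDer_le (u : Jet n m) (α : multiIdx n m) :
    ‖contract (flowDer (monomial α.1 1)) u‖ ≤ ∑ i, 2 * Real.pi * (α.1 (Sum.inr i) *
      entryNorm u (α.1 - Finsupp.single (Sum.inr i) 1 + Finsupp.single (Sum.inl i) 1)) := by
  have hs : ∀ (s : Finset (Fin n)) (P : Fin n → MvPolynomial (Idx n) ℂ),
      contract (∑ i ∈ s, P i) u = ∑ i ∈ s, contract (P i) u := fun s P => by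
    simp only [contract_apply, coeff_sum, Finset.sum_smul]
    exact Finset.sum_comm
  rw [flowDer_monomial, hs]
  refine norm_sum_le_of_le _ fun i _ => ?_
  rw [contract_smul, norm_smul, norm_mul, norm_neg, Complex.norm_real, Real.norm_eq_abs,
    abs_of_pos Real.two_pi_pos, RCLike.norm_natCast, mul_assoc]
  by_cases h : α.1 (Sum.inr i) = 0
  · simp [h]
  · have hm : α.1 - Finsupp.single (Sum.inr i) 1 + Finsupp.single (Sum.inl i) 1 ∈ multiIdx n m := by
      rw [mem_multiIdx, degree_sub_single_add_single h]
      exact mem_multiIdx.1 α.2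
    rw [contract_monomial ⟨_, hm⟩, entryNorm, dif_pos hm]

/-! ### The column sums of the growth estimate -/

/-- Conditions on `e` are required only where `f` is nonzero, because maps such as `α ↦ α - single +
single` are not injective where the subtraction truncates. -/
theorem sum_le_sum_of_injOn {ι κ : Type*} {s : Finset ι} {t : Finset κ} {f : ι → ℝ} {g : κ → ℝ}
    (e : ι → κ) (hg : ∀ k ∈ t, 0 ≤ g k) (hmem : ∀ i ∈ s, f i ≠ 0 → e i ∈ t)
    (hinj : ∀ i ∈ s, f i ≠ 0 → ∀ j ∈ s, f j ≠ 0 → e i = e j → i = j)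
    (hle : ∀ i ∈ s, f i ≠ 0 → f i ≤ g (e i)) : ∑ i ∈ s, f i ≤ ∑ k ∈ t, g k := by
  classical
  rw [← Finset.sum_filter_ne_zero]
  refine (Finset.sum_le_sum fun i hi => hle i (Finset.mem_filter.1 hi).1
    (Finset.mem_filter.1 hi).2).trans ?_
  rw [← Finset.sum_image (f := g) (g := e)]
  · refine Finset.sum_le_sum_of_subset_of_nonneg ?_ fun k hk _ => hg k hk
    intro k hk
    obtain ⟨i, hi, rfl⟩ := Finset.mem_image.1 hk
    exact hmem i (Finset.mem_filter.1 hi).1 (Finset.mem_filter.1 hi).2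
  · intro i hi j hj h
    exact hinj i (Finset.mem_filter.1 hi).1 (Finset.mem_filter.1 hi).2 j
      (Finset.mem_filter.1 hj).1 (Finset.mem_filter.1 hj).2 h

/-- The multinomial theorem for `(1 + ⋯ + 1)^l`, in which every multinomial coefficient is at least
`1`. -/
theorem card_piAntidiag_le (n l : ℕ) :
    (Finset.piAntidiag (Finset.univ : Finset (Fin n)) l).card ≤ n ^ l := by
  have h := Finset.sum_pow_eq_sum_piAntidiag (Finset.univ : Finset (Fin n)) (fun _ => (1 : ℕ)) l
  simp only [Finset.sum_const, Finset.card_univ, Fintype.card_fin, smul_eq_mul, mul_one, one_pow,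
    Finset.prod_const_one, Nat.cast_id] at h
  rw [h, Finset.card_eq_sum_ones]
  exact Finset.sum_le_sum fun c _ => Nat.multinomial_pos _ _

theorem degree_eq_add (α : Idx n →₀ ℕ) :
    α.degree = ∑ i, α (Sum.inl i) + ∑ i, α (Sum.inr i) := by
  rw [Finsupp.degree_eq_sum, Fintype.sum_sum_type]

theorem choose_le_factorial (a b : ℕ) : a.choose b ≤ a.factorial := by
  rcases le_or_gt b a with h | h
  · rw [← Nat.choose_mul_factorial_mul_factorial h, mul_assoc]
    exact Nat.le_mul_of_pos_right _ (Nat.mul_pos (Nat.factorial_pos _) (Nat.factorial_pos _))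
  · rw [Nat.choose_eq_zero_of_lt h]
    exact Nat.zero_le _

/-- A bound for the product of the binomial coefficients. -/
def binomBound (m : ℕ) (β : Idx n →₀ ℕ) : ℝ :=
  if ∀ i, β (Sum.inl i) = 0 then 1 else (m.factorial : ℝ)

theorem binomBound_nonneg (m : ℕ) (β : Idx n →₀ ℕ) : 0 ≤ binomBound m β := by
  unfold binomBound
  split_ifs <;> positivity

theorem binomBound_le (m : ℕ) (β : Idx n →₀ ℕ) : binomBound m β ≤ m.factorial := by
  unfold binomBound
  split_ifs
  · exact_mod_cast Nat.one_le_iff_ne_zero.2 (Nat.factorial_ne_zero m)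
  · exact le_rfl

/-- The base in the momentum variables is `0`, so `0 ^ (α e - β e)` survives only for equal
exponents: the character is hit by position derivatives alone. -/
theorem of_leibnizCoeff_ne_zero {α β : Idx n →₀ ℕ} (h : leibnizCoeff α β ≠ 0) :
    (∀ i, β (Sum.inl i) ≤ α (Sum.inl i)) ∧ ∀ i, β (Sum.inr i) = α (Sum.inr i) := by
  have hle : β ≤ α := by
    by_contra hc
    exact h (leibnizCoeff_eq_zero hc)
  refine ⟨fun i => hle _, fun i => le_antisymm (hle _) ?_⟩
  by_contra hc
  refine h (Finset.prod_eq_zero (Finset.mem_univ (Sum.inr i)) ?_)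
  rw [Sum.elim_inr, zero_pow (by omega), mul_zero]

/-- The product of binomials is at most `∏ α_i!`, which divides `(∑ α_i)!`, hence is at most `m!`.
If `β` has no position part, every binomial is `a.choose 0 = 1`; this gain is needed in
`column_coeff_le` for derivatives of order one. -/
theorem leibnizCoeff_le {α β : Idx n →₀ ℕ} (hα : α ∈ multiIdx n m) (h : leibnizCoeff α β ≠ 0) :
    leibnizCoeff α β ≤
      binomBound m β * (2 * Real.pi) ^ (∑ i, (α (Sum.inl i) - β (Sum.inl i))) := by
  obtain ⟨-, h2⟩ := of_leibnizCoeff_ne_zero h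
  have h3 : leibnizCoeff α β = (∏ i, ((α (Sum.inl i)).choose (β (Sum.inl i)) : ℝ)) *
      (2 * Real.pi) ^ (∑ i, (α (Sum.inl i) - β (Sum.inl i))) := by
    rw [leibnizCoeff, Fintype.prod_sum_type, ← Finset.prod_pow_eq_pow_sum]
    simp [h2, Finset.prod_mul_distrib]
  rw [h3]
  refine mul_le_mul_of_nonneg_right ?_ (by positivity)
  unfold binomBound
  split_ifs with h0
  · simp [h0]
  · rw [← Nat.cast_prod, Nat.cast_le]
    calc ∏ i, (α (Sum.inl i)).choose (β (Sum.inl i)) ≤ ∏ i, (α (Sum.inl i)).factorial :=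
          Finset.prod_le_prod' fun i _ => choose_le_factorial _ _
      _ ≤ (∑ i, α (Sum.inl i)).factorial :=
          Nat.le_of_dvd (Nat.factorial_pos _) (Nat.prod_factorial_dvd_factorial_sum _ _)
      _ ≤ m.factorial := Nat.factorial_le (by
          have := mem_multiIdx.1 hα
          rw [degree_eq_add] at this
          omega)

/-- A contributing `α` is determined by the position part of `α - β`. If that part has order `l`,
then `1 ≤ l ≤ m - |β|`, and there are at most `n ^ l` choices. -/
theorem sum_leibnizCoeff_le {β : Idx n →₀ ℕ} :
    ∑ α ∈ (multiIdx n m).erase β, leibnizCoeff α β ≤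
      binomBound m β * ∑ l ∈ Finset.Icc 1 (m - β.degree), (n * (2 * Real.pi)) ^ l := by
  classical
  have h1 : ∑ α ∈ (multiIdx n m).erase β, leibnizCoeff α β ≤
      ∑ x ∈ (Finset.Icc 1 (m - β.degree)).sigma
        fun l => Finset.piAntidiag (Finset.univ : Finset (Fin n)) l,
        binomBound m β * (2 * Real.pi) ^ x.1 := by
    refine sum_le_sum_of_injOn (fun α => ⟨∑ i, (α (Sum.inl i) - β (Sum.inl i)),
      fun i => α (Sum.inl i) - β (Sum.inl i)⟩) ?_ ?_ ?_ ?_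
    · intro x _
      have := binomBound_nonneg m β
      positivity
    · intro α hα h
      obtain ⟨h2, h3⟩ := of_leibnizCoeff_ne_zero h
      obtain ⟨hne, hα⟩ := Finset.mem_erase.1 hα
      have h4 := mem_multiIdx.1 hα
      have h5 : ∑ i, α (Sum.inl i) = ∑ i, (α (Sum.inl i) - β (Sum.inl i)) + ∑ i, β (Sum.inl i) := by
        rw [← Finset.sum_add_distrib]
        exact Finset.sum_congr rfl fun i _ => (Nat.sub_add_cancel (h2 i)).symm
      have h6 : ∑ i, (α (Sum.inl i) - β (Sum.inl i)) ≠ 0 := fun h0 => hne <| by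
        rw [Finset.sum_eq_zero_iff] at h0
        ext e
        rcases e with i | i
        · exact le_antisymm (by have := h0 i (Finset.mem_univ i); omega) (h2 i)
        · exact (h3 i).symm
      have h7 : ∑ i, α (Sum.inr i) = ∑ i, β (Sum.inr i) :=
        Finset.sum_congr rfl fun i _ => (h3 i).symm
      rw [degree_eq_add] at h4
      have h8 : ∑ i, (α (Sum.inl i) - β (Sum.inl i)) ≤ m - β.degree := by
        rw [degree_eq_add]
        omega
      exact Finset.mem_sigma.2 ⟨Finset.mem_Icc.2 ⟨Nat.one_le_iff_ne_zero.2 h6, h8⟩, by simp⟩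
    · intro α _ h α' _ h' he
      obtain ⟨h2, h3⟩ := of_leibnizCoeff_ne_zero h
      obtain ⟨h2', h3'⟩ := of_leibnizCoeff_ne_zero h'
      simp only [Sigma.mk.injEq, heq_eq_eq] at he
      ext e
      rcases e with i | i
      · have := congrFun he.2 i
        have := h2 i
        have := h2' i
        omega
      · rw [← h3, ← h3']
    · intro α hα h
      exact leibnizCoeff_le (Finset.mem_erase.1 hα).2 h
  refine h1.trans ?_
  rw [Finset.sum_sigma, Finset.mul_sum]
  refine Finset.sum_le_sum fun l _ => ?_
  simp only [Finset.sum_const, nsmul_eq_mul]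
  have h2 : ((Finset.piAntidiag (Finset.univ : Finset (Fin n)) l).card : ℝ) ≤ (n : ℝ) ^ l := by
    exact_mod_cast card_piAntidiag_le n l
  have h3 : 0 ≤ binomBound m β * (2 * Real.pi) ^ l := by
    have := binomBound_nonneg m β
    positivity
  calc _ ≤ (n : ℝ) ^ l * (binomBound m β * (2 * Real.pi) ^ l) := by gcongr
    _ = _ := by rw [mul_pow]; ring

/-- Geometric series of ratio at least `6`: the constant is `1 / (1 - 1/6) = 6/5`. -/
theorem sum_pow_Icc_le {y : ℝ} (hy : 6 ≤ y) (N : ℕ) :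
    ∑ l ∈ Finset.Icc 1 N, y ^ l ≤ 6 / 5 * y ^ N := by
  induction N with
  | zero => simp; norm_num
  | succ N ih =>
    rw [Finset.sum_Icc_succ_top (by omega), pow_succ]
    nlinarith [pow_nonneg (show 0 ≤ y by linarith) N]

theorem six_le_two_pi : (6 : ℝ) ≤ 2 * Real.pi := by
  linarith [Real.pi_gt_three]

theorem sum_momentum_add_one_le (γ : Idx n →₀ ℕ) :
    ∑ i, (if γ (Sum.inl i) ≠ 0 then (γ (Sum.inr i) : ℝ) + 1 else 0) ≤
      (γ.degree : ℝ) := by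
  rw [degree_eq_add, ← Finset.sum_add_distrib, Nat.cast_sum]
  refine Finset.sum_le_sum fun i _ => ?_
  split_ifs with h
  · have : (1 : ℝ) ≤ γ (Sum.inl i) := by exact_mod_cast Nat.one_le_iff_ne_zero.2 h
    push_cast
    linarith
  · positivity

theorem card_momentum_le (γ : Idx n →₀ ℕ) :
    (Finset.univ.filter fun j => γ (Sum.inr j) ≠ 0).card ≤ ∑ j, γ (Sum.inr j) := by
  rw [Finset.card_filter]
  refine Finset.sum_le_sum fun i _ => ?_
  split_ifs <;> omega

/-- For `m ≥ 2` this puts the transport contribution `2π·m` into half of `(2π)^m`. -/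
theorem pow_sub_one_ge (m : ℕ) (hm : 2 ≤ m) {X : ℝ} (hX : 6 ≤ X) : 2 * m * X ≤ X ^ m := by
  obtain ⟨k, rfl⟩ := Nat.exists_eq_add_of_le hm
  induction k with
  | zero => norm_num; nlinarith
  | succ k ih =>
    have h := ih (by omega)
    have h2 : X ^ (2 + (k + 1)) = X ^ (2 + k) * X := by ring
    rw [h2]
    push_cast at h ⊢
    have : (0 : ℝ) ≤ k := by positivity
    nlinarith [mul_nonneg this (show 0 ≤ X by linarith)]

/-- The coefficient of one derivative in the growth estimate. -/
theorem column_coeff_le {γ : Idx n →₀ ℕ} (hγ : γ ∈ multiIdx n m) :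
    2 * Real.pi * ∑ i, (if γ (Sum.inl i) ≠ 0 then (γ (Sum.inr i) : ℝ) + 1 else 0) +
      ((Finset.univ.filter fun j => γ (Sum.inr j) ≠ 0).card : ℝ) *
        (binomBound m γ * ∑ l ∈ Finset.Icc 1 (m + 1 - γ.degree), (n * (2 * Real.pi)) ^ l) ≤
      (2 * Real.pi) ^ m / 2 * (1 + (n : ℝ) ^ (m + 1) * (m.factorial : ℝ)) := by
  set X := 2 * Real.pi with hX
  have hX6 : 6 ≤ X := six_le_two_pi
  set k1 := ∑ i, (if γ (Sum.inl i) ≠ 0 then (γ (Sum.inr i) : ℝ) + 1 else 0) with hk1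
  set p := (Finset.univ.filter fun j => γ (Sum.inr j) ≠ 0).card with hp
  have hd := mem_multiIdx.1 hγ
  have hk1d : k1 ≤ γ.degree := sum_momentum_add_one_le γ
  have hpB : p ≤ ∑ j, γ (Sum.inr j) := card_momentum_le γ
  have hpn : p ≤ n := by simpa using Finset.card_filter_le (Finset.univ : Finset (Fin n)) _
  have hadd := degree_eq_add γ
  have hXm : 0 < X ^ m := by positivity
  rcases Nat.eq_zero_or_pos n with rfl | hn
  · have : k1 = 0 := by simp [hk1]
    rw [this, show p = 0 by omega]
    simp only [Nat.cast_zero, mul_zero, zero_mul, add_zero]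
    positivity
  have hn1 : (1 : ℝ) ≤ n := by exact_mod_cast hn
  have hy : 6 ≤ n * X := by nlinarith
  have hf1 : (1 : ℝ) ≤ m.factorial := by
    exact_mod_cast Nat.one_le_iff_ne_zero.2 (Nat.factorial_ne_zero m)
  have hnm : (1 : ℝ) ≤ (n : ℝ) ^ (m + 1) := one_le_pow₀ hn1
  have hnf : 1 ≤ (n : ℝ) ^ (m + 1) * m.factorial := one_le_mul_of_one_le_of_one_le hnm hf1
  -- If `γ` contains no momentum derivative, then `p = 0` and only transport contributes; `X ^ m`
  -- alone is enough, because `(1 + n^(m+1) m!) / 2 ≥ 1`.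
  rcases Nat.eq_zero_or_pos (∑ j, γ (Sum.inr j)) with hB | hB
  · rw [show p = 0 by omega, Nat.cast_zero, zero_mul, add_zero]
    have h1 : X * k1 ≤ X ^ m := by
      rcases Nat.lt_or_ge m 2 with hm | hm
      · interval_cases m
        · have : γ.degree = 0 := by omega
          rw [this, Nat.cast_zero] at hk1d
          nlinarith
        · have : (γ.degree : ℝ) ≤ 1 := by exact_mod_cast hd
          nlinarith
      · have h2 := pow_sub_one_ge m hm hX6
        have : (γ.degree : ℝ) ≤ m := by exact_mod_cast hd
        have : k1 * X ≤ m * X := by nlinarith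
        have : 0 ≤ (m : ℝ) * X := by positivity
        linarith
    nlinarith
  have hc := binomBound_le m γ
  have hc0 := binomBound_nonneg m γ
  rcases Nat.lt_or_ge γ.degree 2 with hd2 | hd2
  -- Here `γ` is a single momentum derivative: transport contributes nothing, `p ≤ 1` and
  -- `binomBound` is `1`, but the geometric sum extends up to `l = m`.
  · have hA : ∀ i, γ (Sum.inl i) = 0 := fun i => by
      have : ∑ i, γ (Sum.inl i) = 0 := by omega
      exact (Finset.sum_eq_zero_iff.1 this) i (Finset.mem_univ i)
    have hk0 : k1 = 0 := by simp [hk1, hA]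
    have hc1 : binomBound m γ = 1 := if_pos hA
    have hp1 : (p : ℝ) ≤ 1 := by exact_mod_cast (show p ≤ 1 by omega)
    rw [hk0, hc1, show m + 1 - γ.degree = m by omega, mul_zero, zero_add, one_mul]
    have hG0 : 0 ≤ ∑ l ∈ Finset.Icc 1 m, (n * X) ^ l := by positivity
    refine (mul_le_of_le_one_left hG0 hp1).trans ?_
    rcases Nat.lt_or_ge m 2 with hm | hm
    · have hm1 : m = 1 := by omega
      subst hm1
      simp only [Finset.Icc_self, Finset.sum_singleton, pow_one, Nat.factorial_one, Nat.cast_one,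
        mul_one]
      -- The claim is `nX ≤ X (1 + n²) / 2`, that is `(n - 1)² ≥ 0`, with equality for `n = 1`.
      nlinarith [mul_nonneg (show 0 ≤ X by linarith) (sq_nonneg ((n : ℝ) - 1))]
    · refine (sum_pow_Icc_le hy m).trans ?_
      have hf2 : (2 : ℝ) ≤ m.factorial := by
        exact_mod_cast (Nat.factorial_le hm : Nat.factorial 2 ≤ _)
      have h1 : 6 / 5 * (n : ℝ) ^ m ≤ 1 / 2 * (1 + (n : ℝ) ^ (m + 1) * m.factorial) := by
        have h2 : (n : ℝ) ^ (m + 1) * 2 ≤ (n : ℝ) ^ (m + 1) * m.factorial := by gcongr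
        have h3 : (1 : ℝ) ≤ (n : ℝ) ^ m := one_le_pow₀ hn1
        rcases Nat.lt_or_ge n 2 with hn2 | hn2
        · have : n = 1 := by omega
          subst this
          simp only [Nat.cast_one, one_pow, one_mul] at h2 ⊢
          linarith
        · have : (2 : ℝ) ≤ n := by exact_mod_cast hn2
          rw [pow_succ] at h2 ⊢
          nlinarith
      calc 6 / 5 * (n * X) ^ m = X ^ m * (6 / 5 * (n : ℝ) ^ m) := by ring
        _ ≤ X ^ m * (1 / 2 * (1 + (n : ℝ) ^ (m + 1) * m.factorial)) := by gcongr
        _ = _ := by ring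
  -- For order at least `2` the geometric sum ends at `l = m - 1` or earlier. Transport fits into
  -- the summand `1` of the rate and the potential into `n^(m+1) m!`; the latter reduces to `6/5 ≤
  -- nX/2`.
  · have hm2 : 2 ≤ m := by omega
    have h1 : X * k1 ≤ X ^ m / 2 := by
      have h2 := pow_sub_one_ge m hm2 hX6
      have : (γ.degree : ℝ) ≤ m := by exact_mod_cast hd
      have : k1 * X ≤ m * X := by nlinarith
      linarith
    obtain ⟨k, rfl⟩ := Nat.exists_eq_add_of_le hm2
    have hG : ∑ l ∈ Finset.Icc 1 (2 + k + 1 - γ.degree), (n * X) ^ l ≤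
        6 / 5 * (n * X) ^ (k + 1) := by
      refine (sum_pow_Icc_le hy _).trans ?_
      have : (n * X) ^ (2 + k + 1 - γ.degree) ≤ (n * X) ^ (k + 1) :=
        pow_le_pow_right₀ (by linarith) (by omega)
      linarith
    have hpn' : (p : ℝ) ≤ n := by exact_mod_cast hpn
    have hG0 : 0 ≤ ∑ l ∈ Finset.Icc 1 (2 + k + 1 - γ.degree), (n * X) ^ l := by positivity
    have h3 : (p : ℝ) * (binomBound (2 + k) γ *
        ∑ l ∈ Finset.Icc 1 (2 + k + 1 - γ.degree), (n * X) ^ l) ≤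
        n * ((2 + k).factorial * (6 / 5 * (n * X) ^ (k + 1))) := by
      gcongr
    have h4 : (n : ℝ) * ((2 + k).factorial * (6 / 5 * (n * X) ^ (k + 1))) ≤
        X ^ (2 + k) / 2 * ((n : ℝ) ^ (2 + k + 1) * (2 + k).factorial) := by
      have h5 : (n : ℝ) * ((2 + k).factorial * (6 / 5 * (n * X) ^ (k + 1))) =
        (n : ℝ) ^ (2 + k) * X ^ (k + 1) * (2 + k).factorial * (6 / 5) := by ring
      have h6 : X ^ (2 + k) / 2 * ((n : ℝ) ^ (2 + k + 1) * (2 + k).factorial) =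
        (n : ℝ) ^ (2 + k) * X ^ (k + 1) * (2 + k).factorial * (X * n / 2) := by ring
      rw [h5, h6]
      refine mul_le_mul_of_nonneg_left ?_ (by positivity)
      nlinarith
    linarith

/-- Interchange of summation, collecting the coefficient of each `w γ`. Transport reaches `γ` from
one `α` for each `i` with `γ (Sum.inl i) ≠ 0`, and then `α (Sum.inr i) = γ (Sum.inr i) + 1`. The
potential reaches it from `β = γ - single (Sum.inr j) 1` for each `j` with `γ (Sum.inr j) ≠ 0`,
which shifts the upper limit to `m + 1 - γ.degree`. -/
theorem column_sum_le {M : ℝ} (hM : 0 ≤ M) {w : (Idx n →₀ ℕ) → ℝ} (hw : ∀ β, 0 ≤ w β)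
    (hw0 : ∀ β, β ∉ multiIdx n m → w β = 0) :
    ∑ α ∈ multiIdx n m, (∑ i, 2 * Real.pi * (α (Sum.inr i) *
        w (α - Finsupp.single (Sum.inr i) 1 + Finsupp.single (Sum.inl i) 1)) +
      M * ∑ β ∈ (multiIdx n m).erase α, leibnizCoeff α β *
        ∑ j, w (β + Finsupp.single (Sum.inr j) 1)) ≤
      (2 * Real.pi) ^ m / 2 * (1 + (n : ℝ) ^ (m + 1) * (m.factorial : ℝ)) * max 1 M *
        ∑ γ ∈ multiIdx n m, w γ := by
  classical
  have h1 : ∑ α ∈ multiIdx n m, ∑ i, 2 * Real.pi * (α (Sum.inr i) *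
        w (α - Finsupp.single (Sum.inr i) 1 + Finsupp.single (Sum.inl i) 1)) ≤
      ∑ γ ∈ multiIdx n m, (2 * Real.pi *
        ∑ i, (if γ (Sum.inl i) ≠ 0 then (γ (Sum.inr i) : ℝ) + 1 else 0)) * w γ := by
    simp only [Finset.mul_sum, Finset.sum_mul]
    rw [Finset.sum_comm, Finset.sum_comm (s := multiIdx n m)]
    refine Finset.sum_le_sum fun i _ => ?_
    refine sum_le_sum_of_injOn
      (fun α => α - Finsupp.single (Sum.inr i) 1 + Finsupp.single (Sum.inl i) 1) ?_ ?_ ?_ ?_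
    · intro γ _
      refine mul_nonneg (mul_nonneg (by positivity) ?_) (hw γ)
      split_ifs <;> positivity
    · intro α _ h
      by_contra hc
      exact h (by rw [hw0 _ hc, mul_zero, mul_zero])
    · intro α _ h α' _ h' he
      have hne : ∀ α : Idx n →₀ ℕ, 2 * Real.pi * (α (Sum.inr i) *
          w (α - Finsupp.single (Sum.inr i) 1 + Finsupp.single (Sum.inl i) 1)) ≠ 0 →
          Finsupp.single (Sum.inr i) 1 ≤ α := fun α h => by
        rw [Finsupp.single_le_iff, Nat.one_le_iff_ne_zero]
        intro h0
        exact h (by rw [h0]; simp)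
      have he' := add_right_cancel he
      rw [← tsub_add_cancel_of_le (hne α h), he', tsub_add_cancel_of_le (hne α' h')]
    · intro α _ h
      have h0 : α (Sum.inr i) ≠ 0 := fun h0 => h (by rw [h0]; simp)
      have h2 : (α - Finsupp.single (Sum.inr i) 1 + Finsupp.single (Sum.inl i) 1 : Idx n →₀ ℕ) (Sum.inl i) ≠ 0 := by
        simp
      have h3 : (((α - Finsupp.single (Sum.inr i) 1 + Finsupp.single (Sum.inl i) 1 : Idx n →₀ ℕ)
          (Sum.inr i) : ℕ) : ℝ) + 1 = α (Sum.inr i) := by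
        have : (α - Finsupp.single (Sum.inr i) 1 + Finsupp.single (Sum.inl i) 1 : Idx n →₀ ℕ) (Sum.inr i) + 1 =
          α (Sum.inr i) := by
          simp
          omega
        exact_mod_cast this
      rw [if_pos h2, h3, mul_assoc (2 * Real.pi)]
  have h2 : ∑ α ∈ multiIdx n m, ∑ β ∈ (multiIdx n m).erase α, leibnizCoeff α β *
        ∑ j, w (β + Finsupp.single (Sum.inr j) 1) ≤
      ∑ γ ∈ multiIdx n m, (((Finset.univ.filter fun j => γ (Sum.inr j) ≠ 0).card : ℝ) *
        (binomBound m γ * ∑ l ∈ Finset.Icc 1 (m + 1 - γ.degree), (n * (2 * Real.pi)) ^ l)) *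
          w γ := by
    have h3 : ∑ α ∈ multiIdx n m, ∑ β ∈ (multiIdx n m).erase α, leibnizCoeff α β *
        ∑ j, w (β + Finsupp.single (Sum.inr j) 1) =
        ∑ j, ∑ β ∈ multiIdx n m, (∑ α ∈ (multiIdx n m).erase β, leibnizCoeff α β) *
          w (β + Finsupp.single (Sum.inr j) 1) := by
      rw [Finset.sum_comm (s := Finset.univ)]
      simp only [← Finset.mul_sum]
      simp only [Finset.sum_mul]
      rw [Finset.sum_comm' (t' := multiIdx n m) (s' := fun β => (multiIdx n m).erase β)]
      intro α β
      simp only [Finset.mem_erase]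
      tauto
    rw [h3]
    have h4 : ∀ γ : Idx n →₀ ℕ, (((Finset.univ.filter fun j => γ (Sum.inr j) ≠ 0).card : ℝ) *
        (binomBound m γ * ∑ l ∈ Finset.Icc 1 (m + 1 - γ.degree), (n * (2 * Real.pi)) ^ l)) * w γ =
        ∑ j, if γ (Sum.inr j) ≠ 0 then (binomBound m γ *
          ∑ l ∈ Finset.Icc 1 (m + 1 - γ.degree), (n * (2 * Real.pi)) ^ l) * w γ else 0 := fun γ => by
      rw [← Finset.sum_filter, Finset.sum_const, nsmul_eq_mul, mul_assoc]
    simp only [h4]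
    rw [Finset.sum_comm (s := multiIdx n m)]
    refine Finset.sum_le_sum fun j _ => ?_
    refine sum_le_sum_of_injOn (fun β => β + Finsupp.single (Sum.inr j) 1) ?_ ?_ ?_ ?_
    · intro γ _
      split_ifs
      · refine mul_nonneg (mul_nonneg (binomBound_nonneg m γ) (by positivity)) (hw γ)
      · exact le_rfl
    · intro β _ h
      by_contra hc
      exact h (by rw [hw0 _ hc, mul_zero])
    · intro β _ _ β' _ _ he
      exact add_right_cancel he
    · intro β _ _
      rw [if_pos (by simp)]
      refine mul_le_mul_of_nonneg_right (sum_leibnizCoeff_le.trans (le_of_eq ?_)) (hw _)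
      rw [map_add, Finsupp.degree_single, show m + 1 - (β.degree + 1) = m - β.degree by omega]
      congr 1
      simp [binomBound]
  rw [Finset.sum_add_distrib, Finset.mul_sum (multiIdx n m) w]
  have h1M : (1 : ℝ) ≤ max 1 M := le_max_left _ _
  set A := ∑ γ ∈ multiIdx n m, (2 * Real.pi *
        ∑ i, (if γ (Sum.inl i) ≠ 0 then (γ (Sum.inr i) : ℝ) + 1 else 0)) * w γ with hA
  have hA0 : 0 ≤ A := by
    refine Finset.sum_nonneg fun γ _ => mul_nonneg (mul_nonneg (by positivity) ?_) (hw γ)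
    refine Finset.sum_nonneg fun i _ => ?_
    split_ifs <;> positivity
  set B := ∑ γ ∈ multiIdx n m, (((Finset.univ.filter fun j => γ (Sum.inr j) ≠ 0).card : ℝ) *
        (binomBound m γ * ∑ l ∈ Finset.Icc 1 (m + 1 - γ.degree), (n * (2 * Real.pi)) ^ l)) *
          w γ with hB
  have hB0 : 0 ≤ B := by
    refine Finset.sum_nonneg fun γ _ => mul_nonneg (mul_nonneg (by positivity)
      (mul_nonneg (binomBound_nonneg m γ) (by positivity))) (hw γ)
  have hAB : max 1 M * (A + B) ≤ ∑ γ ∈ multiIdx n m, (2 * Real.pi) ^ m / 2 *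
      (1 + (n : ℝ) ^ (m + 1) * (m.factorial : ℝ)) * max 1 M * w γ := by
    rw [hA, hB, ← Finset.sum_add_distrib, Finset.mul_sum]
    refine Finset.sum_le_sum fun γ hγ => ?_
    rw [← add_mul, ← mul_assoc, mul_comm (max 1 M)]
    exact mul_le_mul_of_nonneg_right (mul_le_mul_of_nonneg_right (column_coeff_le hγ)
      (by positivity)) (hw γ)
  have h5 : M * ∑ α ∈ multiIdx n m, ∑ β ∈ (multiIdx n m).erase α, leibnizCoeff α β *
        ∑ j, w (β + Finsupp.single (Sum.inr j) 1) ≤ max 1 M * B :=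
    (mul_le_mul_of_nonneg_left h2 hM).trans
      (mul_le_mul_of_nonneg_right (le_max_right _ _) hB0)
  rw [Finset.mul_sum] at h5
  have h6 : A ≤ max 1 M * A := le_mul_of_one_le_left hA0 h1M
  linarith

/-! ### Growth of the derivatives of the truncated evolution -/

/-- The growth rate for a bound `M` of the moment of the potential. -/
def growthRate (m n : ℕ) (M : ℝ) : ℝ :=
  (2 * Real.pi) ^ m / 2 * (1 + (n : ℝ) ^ (m + 1) * (m.factorial : ℝ)) * max 1 M

theorem growthRate_nonneg (m n : ℕ) (M : ℝ) : 0 ≤ growthRate m n M := by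
  unfold growthRate
  have : (0 : ℝ) ≤ max 1 M := zero_le_one.trans (le_max_left _ _)
  positivity

/-- The moment of the potential. -/
def moment (m : ℕ) (v : Config n → ℂ) : ℝ := ∫ S, ‖v S‖ * (‖S‖ + ‖S‖ ^ (m + 1))

theorem moment_nonneg (m : ℕ) (v : Config n → ℂ) : 0 ≤ moment m v :=
  integral_nonneg fun S => by positivity

theorem sum_norm_error_le {ε : ℝ} (hε : 0 < ε) {v : Config n → ℂ} (hv : IsTruncated v) {M : ℝ}
    (hM : moment m v ≤ M) {u : Jet n m} (hu : u ∈ weakJets n m) :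
    ∑ α : multiIdx n m, (‖contract (flowDer (monomial α.1 1)) u‖ +
      ‖jetPot m ε hv u α - pot ε v (u α)‖) ≤ growthRate m n M * ∑ α, ‖u α‖ := by
  have h0 := moment_nonneg m v
  have h1 : ∑ α : multiIdx n m, ‖u α‖ = ∑ α ∈ multiIdx n m, entryNorm u α := by
    rw [← Finset.sum_coe_sort (multiIdx n m)]
    exact Finset.sum_congr rfl fun α _ => (entryNorm_coe u α).symm
  rw [h1]
  refine le_trans ?_ (column_sum_le (h0.trans hM) (entryNorm_nonneg u)
    fun β hβ => by rw [entryNorm, dif_neg hβ])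
  rw [← Finset.sum_coe_sort (multiIdx n m)]
  refine Finset.sum_le_sum fun α _ => add_le_add (norm_contract_flowDer_le u α) ?_
  refine (norm_jetPot_sub_le hε hv hu α).trans (mul_le_mul_of_nonneg_right hM ?_)
  exact Finset.sum_nonneg fun β _ => mul_nonneg (leibnizCoeff_nonneg _ _)
    (Finset.sum_nonneg fun j _ => entryNorm_nonneg _ _)

/-- The evolution of jets in the physical picture. -/
theorem jetFlow_evol_hasDerivAt {ε : ℝ} {v : Config n → ℂ} (hv : IsTruncated v)
    {y : ℝ → Jet n m} {t : ℝ} (hy : HasDerivAt y (jetGen m ε hv t (y t)) t) (α : multiIdx n m) :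
    HasDerivAt (fun t => contract (flowSub t (monomial α.1 1)) (y t))
      ((flow (-t)).onL2 (contract (flowDer (monomial α.1 1)) (jetFlow m t (y t)) -
        jetPot m ε hv (jetFlow m t (y t)) α)) t := by
  have h := (((isBoundedBilinearMap_apply (𝕜 := ℂ) (E := Jet n m) (F := L2 n)).hasFDerivAt
    (contract (flowSub t (monomial α.1 1)), y t)).restrictScalars ℝ).comp_hasDerivAt t
    ((hasDerivAt_contract_flowSub (m := m) (monomial α.1 1) t).prodMk hy)
  refine h.congr_deriv ?_
  have h1 : (flow (-t)).onL2 (contract (flowDer (monomial α.1 1)) (jetFlow m t (y t))) =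
      contract (flowSub t (flowDer (monomial α.1 1))) (y t) := by
    rw [jetFlow, contract_jetMap (totalDegree_flowDer_le α), flow_neg_flow]
  have h2 : (flow (-t)).onL2 (jetPot m ε hv (jetFlow m t (y t)) α) =
      contract (flowSub t (monomial α.1 1))
        (jetFlow m (-t) (jetPot m ε hv (jetFlow m t (y t)))) := by
    conv_lhs => rw [← jetFlow_jetFlow_neg t (jetPot m ε hv (jetFlow m t (y t)))]
    rw [jetFlow, jetMap_apply, flow_neg_flow, jetFlow]
  rw [map_sub, h1, h2]
  change contract (flowSub t (monomial α.1 1)) (jetGen m ε hv t (y t)) +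
    contract (flowSub t (flowDer (monomial α.1 1))) (y t) = _
  rw [jetGen_apply, map_neg]
  abel

/-- The growth lemma is applied to the derivatives of the solution, each carried back by the unitary
free flow. There the time derivative consists of the transport commutator and the potential, with no
unbounded term left. -/
theorem sum_norm_evol_le {ε : ℝ} (hε : 0 < ε) {v : Config n → ℂ} (hv : IsTruncated v) {M : ℝ}
    (hM : moment m v ≤ M) {p : ℝ → L2 n} (hp : IsEvol ε v p) {K : Submodule ℂ (Jet n m)}
    (hK : IsInvariant ε K) (hKw : K ≤ weakJets n m) {u : Jet n m} (hu : u ∈ K)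
    (hup : u zeroIdx = p 0) (t : ℝ) :
    ∃ z ∈ K, z zeroIdx = (flow t).onL2 (p t) ∧
      ∑ α, ‖z α‖ ≤ Real.exp (growthRate m n M * |t|) * ∑ α, ‖u α‖ := by
  obtain ⟨y, hy0, hyK, hy, hyp⟩ := exists_jet_evol hv hK hp hu hup |t|
  have ht : t ∈ Set.Icc (-|t|) |t| := ⟨neg_abs_le t, le_abs_self t⟩
  refine ⟨jetFlow m t (y t), hK.jetFlow_mem _ _ (hyK t), ?_, ?_⟩
  · rw [jetFlow, jetMap_zeroIdx, hyp t ht]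
  have hnorm : ∀ s (α : multiIdx n m), ‖contract (flowSub s (monomial α.1 1)) (y s)‖ =
      ‖jetFlow m s (y s) α‖ := fun s α => by
    rw [jetFlow, jetMap_apply, Twist.norm_onL2]
  -- Negative times are treated by reversing time; the estimate is insensitive to the sign, since
  -- the commutator terms enter through their norms.
  obtain ⟨σ, hσ, hσt⟩ : ∃ σ : ℝ, (σ = 1 ∨ σ = -1) ∧ t = σ * |t| := by
    rcases le_total 0 t with h | h
    · exact ⟨1, Or.inl rfl, by rw [one_mul, abs_of_nonneg h]⟩
    · exact ⟨-1, Or.inr rfl, by rw [abs_of_nonpos h]; ring⟩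
  have hσ1 : |σ| = 1 := by rcases hσ with rfl | rfl <;> simp
  have hmem : ∀ s ∈ Set.Icc 0 |t|, σ * s ∈ Set.Icc (-|t|) |t| := fun s hs => by
    rcases hσ with rfl | rfl
    · exact ⟨by linarith [hs.1, hs.2], by linarith [hs.1, hs.2]⟩
    · exact ⟨by linarith [hs.1, hs.2], by linarith [hs.1, hs.2]⟩
  have key := sum_norm_le_of_re_inner_le (T := |t|) (η := 0) (growthRate_nonneg m n M) le_rfl
    (q := fun (α : multiIdx n m) s => contract (flowSub (σ * s) (monomial α.1 1)) (y (σ * s)))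
    (b := fun α s => ‖contract (flowDer (monomial α.1 1)) (jetFlow m (σ * s) (y (σ * s)))‖ +
      ‖jetPot m ε hv (jetFlow m (σ * s) (y (σ * s))) α -
        pot ε v (jetFlow m (σ * s) (y (σ * s)) α)‖)
    (fun α s hs => HasDerivAt.scomp s (jetFlow_evol_hasDerivAt hv (hy _ (hmem s hs)) α)
      ((hasDerivAt_id s).const_mul σ)) (fun α s _ => by positivity) ?_ ?_
    (t := |t|) ⟨abs_nonneg t, le_rfl⟩
  · simp only [mul_zero, zero_mul, add_zero, hnorm, ← hσt] at key
    refine key.trans (le_of_eq ?_)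
    congr 1
    refine Finset.sum_congr rfl fun α _ => ?_
    have h0 := hnorm 0 α
    rw [flowSub_zero, contract_monomial, hy0] at h0
    rw [hy0, h0]
  · intro α s _
    set W := jetFlow m (σ * s) (y (σ * s)) with hW
    set A := contract (flowDer (monomial α.1 1)) W
    set B := jetPot m ε hv W α
    have h1 : (flow (σ * s)).onL2 (contract (flowSub (σ * s) (monomial α.1 1)) (y (σ * s))) = W α :=
      rfl
    have h2 : ‖inner ℂ (W α) (A - B + pot ε v (W α))‖ ≤ ‖W α‖ * (‖A‖ + ‖B - pot ε v (W α)‖) := by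
      refine (norm_inner_le_norm _ _).trans (mul_le_mul_of_nonneg_left ?_ (norm_nonneg _))
      rw [sub_add]
      exact norm_sub_le _ _
    -- Adding the skew-adjoint `pot ε v (W α)` does not change the real part, and it replaces the
    -- full potential term `B` by the commutator `B - pot ε v (W α)`.
    have h3 : (inner ℂ (W α) (A - B)).re = (inner ℂ (W α) (A - B + pot ε v (W α))).re := by
      rw [inner_add_right, Complex.add_re, re_inner_pot hv.integrable hv.herm, add_zero]
    rw [mul_one, RCLike.real_smul_eq_coe_smul (K := ℂ), inner_smul_right, inner_flow_neg, h1,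
      hnorm, ← hW]
    have h4 : ((σ : ℂ) * inner ℂ (W α) (A - B)).re = σ * (inner ℂ (W α) (A - B)).re := by simp
    refine (le_of_eq h4).trans ((le_abs_self _).trans ?_)
    rw [abs_mul, hσ1, one_mul, h3]
    exact (Complex.abs_re_le_norm _).trans h2
  · intro s _
    simp only [hnorm, add_zero]
    exact sum_norm_error_le hε hv hM (hKw (hK.jetFlow_mem _ _ (hyK _)))

end

/-! ### Truncations of the potential -/

/-- Fourier transforms of real potentials for which the potential term of the Wigner equation makes
sense for smooth functions. -/
structure IsPotential (V : Config n → ℂ) : Prop where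
  aestronglyMeasurable : AEStronglyMeasurable V
  herm : ∀ᵐ S, V (-S) = (starRingEnd ℂ) (V S)
  integrable : Integrable fun S => ‖V S‖ * ‖S‖

/-- The index of the derivative in the `j`-th momentum variable. -/
def momentumIdx (j : Fin n) : multiIdx n 1 :=
  ⟨Finsupp.single (Sum.inr j) 1, mem_multiIdx.2 (by rw [Finsupp.degree_single])⟩

theorem sum_momentumIdx_le (u : Jet n 1) : ∑ j, ‖u (momentumIdx j)‖ ≤ ∑ α, ‖u α‖ := by
  refine sum_le_sum_of_injOn momentumIdx (fun _ _ => norm_nonneg _) (fun _ _ _ => Finset.mem_univ _)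
    (fun i _ _ j _ _ h => ?_) (fun _ _ _ => le_rfl)
  have h1 := congrArg (fun β : multiIdx n 1 => β.1) h
  simpa [momentumIdx, Finsupp.single_left_inj] using h1

theorem norm_dif_zeroIdx_le {ε : ℝ} (hε : 0 ≤ ε) (S : Config n) {u : Jet n 1}
    (hu : u ∈ weakJets n 1) : ‖dif ε S (u zeroIdx)‖ ≤ ε * ‖S‖ * ∑ α, ‖u α‖ :=
  (norm_dif_le_of_mem_weakJets hε S hu (β := momentumIdx) fun i => (zero_add _).symm).trans
    (mul_le_mul_of_nonneg_left (sum_momentumIdx_le u) (by positivity))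

/-- `V` itself may fail to be integrable near `S = 0`; one momentum derivative supplies the missing
factor `‖S‖`. -/
theorem IsPotential.integrable_smul_dif {V : Config n → ℂ} (hV : IsPotential V) {ε : ℝ}
    (hε : 0 ≤ ε) {u : Jet n 1} (hu : u ∈ weakJets n 1) :
    Integrable fun S => V S • dif ε S (u zeroIdx) := by
  refine (hV.integrable.mul_const (ε * ∑ α, ‖u α‖)).mono' (hV.aestronglyMeasurable.smul
    (continuous_dif ε continuous_const).aestronglyMeasurable) (Eventually.of_forall fun S => ?_)
  rw [norm_smul, mul_assoc]
  refine mul_le_mul_of_nonneg_left ((norm_dif_zeroIdx_le hε S hu).trans (le_of_eq ?_))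
    (norm_nonneg _)
  ring

theorem norm_I_div {ε : ℝ} (hε : 0 < ε) : ‖Complex.I / (ε : ℂ)‖ = ε⁻¹ := by
  rw [norm_div, Complex.norm_I, Complex.norm_real, Real.norm_eq_abs, abs_of_pos hε, one_div]

theorem IsPotential.norm_pot_le {V : Config n → ℂ} (hV : IsPotential V) {ε : ℝ} (hε : 0 < ε)
    {u : Jet n 1} (hu : u ∈ weakJets n 1) :
    ‖pot ε V (u zeroIdx)‖ ≤ (∫ S, ‖V S‖ * ‖S‖) * ∑ α, ‖u α‖ := by
  have h : ‖∫ S, V S • dif ε S (u zeroIdx)‖ ≤ ∫ S, ‖V S‖ * ‖S‖ * (ε * ∑ α, ‖u α‖) := by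
    refine norm_integral_le_of_norm_le (hV.integrable.mul_const _) (Eventually.of_forall fun S => ?_)
    rw [norm_smul, mul_assoc]
    refine mul_le_mul_of_nonneg_left ((norm_dif_zeroIdx_le hε.le S hu).trans (le_of_eq ?_))
      (norm_nonneg _)
    ring
  rw [integral_mul_const] at h
  rw [pot, norm_smul, norm_I_div hε]
  calc _ ≤ ε⁻¹ * ((∫ S, ‖V S‖ * ‖S‖) * (ε * ∑ α, ‖u α‖)) := by gcongr
    _ = _ := by field_simp

theorem IsPotential.pot_sub {V : Config n → ℂ} (hV : IsPotential V) {ε : ℝ} (hε : 0 ≤ ε)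
    {u w : Jet n 1} (hu : u ∈ weakJets n 1) (hw : w ∈ weakJets n 1) :
    pot ε V ((u - w) zeroIdx) = pot ε V (u zeroIdx) - pot ε V (w zeroIdx) := by
  simp only [pot, Pi.sub_apply, map_sub, smul_sub]
  rw [integral_sub (hV.integrable_smul_dif hε hu) (hV.integrable_smul_dif hε hw), smul_sub]

/-- The restriction of the potential to an annulus. -/
def trunc (V : Config n → ℂ) (δ R : ℝ) : Config n → ℂ :=
  {S | δ ≤ ‖S‖ ∧ ‖S‖ ≤ R}.indicator V

theorem norm_trunc_le (V : Config n → ℂ) (δ R : ℝ) (S : Config n) : ‖trunc V δ R S‖ ≤ ‖V S‖ :=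
  norm_indicator_le_norm_self V S

theorem measurableSet_annulus (δ R : ℝ) : MeasurableSet {S : Config n | δ ≤ ‖S‖ ∧ ‖S‖ ≤ R} :=
  (measurableSet_le measurable_const measurable_norm).inter
    (measurableSet_le measurable_norm measurable_const)

theorem IsPotential.aestronglyMeasurable_trunc {V : Config n → ℂ} (hV : IsPotential V) (δ R : ℝ) :
    AEStronglyMeasurable (trunc V δ R) :=
  hV.aestronglyMeasurable.indicator (measurableSet_annulus δ R)

theorem IsPotential.isTruncated_trunc {V : Config n → ℂ} (hV : IsPotential V) {δ : ℝ} (hδ : 0 < δ)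
    (R : ℝ) : IsTruncated (trunc V δ R) where
  integrable := by
    refine (hV.integrable.mul_const δ⁻¹).mono' (hV.aestronglyMeasurable_trunc δ R)
      (Eventually.of_forall fun S => ?_)
    by_cases h : S ∈ {S : Config n | δ ≤ ‖S‖ ∧ ‖S‖ ≤ R}
    · rw [trunc, Set.indicator_of_mem h, mul_assoc]
      refine le_mul_of_one_le_right (norm_nonneg _) ?_
      rw [← div_eq_mul_inv]
      exact (one_le_div hδ).2 h.1
    · rw [trunc, Set.indicator_of_notMem h, norm_zero]
      positivity
  bounded := ⟨R, fun S hS => Set.indicator_of_notMem (fun h => absurd h.2 (not_le.2 hS)) _⟩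
  herm := by
    filter_upwards [hV.herm] with S hS
    by_cases h : S ∈ {S : Config n | δ ≤ ‖S‖ ∧ ‖S‖ ≤ R}
    · have h' : -S ∈ {S : Config n | δ ≤ ‖S‖ ∧ ‖S‖ ≤ R} := by simpa using h
      rw [trunc, Set.indicator_of_mem h, Set.indicator_of_mem h', hS]
    · have h' : -S ∉ {S : Config n | δ ≤ ‖S‖ ∧ ‖S‖ ≤ R} := by simpa using h
      rw [trunc, Set.indicator_of_notMem h, Set.indicator_of_notMem h', map_zero]

theorem IsPotential.moment_trunc_le {V : Config n → ℂ} (hV : IsPotential V) {δ R : ℝ}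
    (hR : 0 ≤ R) : moment 1 (trunc V δ R) ≤ (1 + R) * ∫ S, ‖V S‖ * ‖S‖ := by
  rw [moment, ← integral_const_mul]
  refine integral_mono_of_nonneg (Eventually.of_forall fun S => by positivity)
    (hV.integrable.const_mul _) (Eventually.of_forall fun S => ?_)
  have h0 : 0 ≤ ‖V S‖ * ‖S‖ := by positivity
  by_cases h : S ∈ {S : Config n | δ ≤ ‖S‖ ∧ ‖S‖ ≤ R}
  · simp only [trunc, Set.indicator_of_mem h]
    have h1 := mul_le_mul_of_nonneg_left h.2 h0
    simp only [Nat.reduceAdd]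
    linarith
  · simp only [trunc, Set.indicator_of_notMem h, norm_zero, zero_mul]
    positivity

/-- Large frequencies need no derivative: `1 ≤ ‖S‖ / R` there, at the price of `1/ε`. Only the small
frequencies use the bound by first derivatives. This asymmetry is what allows the two cutoffs to be
chosen one after the other. -/
theorem IsPotential.norm_pot_sub_trunc_le {V : Config n → ℂ} (hV : IsPotential V) {ε : ℝ}
    (hε : 0 < ε) {δ R : ℝ} (hδ : 0 < δ) (hR : 0 < R) {u : Jet n 1} (hu : u ∈ weakJets n 1) :
    ‖pot ε V (u zeroIdx) - pot ε (trunc V δ R) (u zeroIdx)‖ ≤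
      2 / (ε * R) * (∫ S, ‖V S‖ * ‖S‖) * ‖u zeroIdx‖ +
        (∫ S in {S | ‖S‖ < δ}, ‖V S‖ * ‖S‖) * ∑ α, ‖u α‖ := by
  have hs : MeasurableSet {S : Config n | ‖S‖ < δ} :=
    measurableSet_lt measurable_norm measurable_const
  have hi := hV.integrable.indicator hs
  have hb : ∀ S, ‖V S • dif ε S (u zeroIdx) - trunc V δ R S • dif ε S (u zeroIdx)‖ ≤
      ‖V S‖ * ‖S‖ * (2 / R * ‖u zeroIdx‖) +
        {S : Config n | ‖S‖ < δ}.indicator (fun S => ‖V S‖ * ‖S‖) S * (ε * ∑ α, ‖u α‖) := fun S => by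
    have h1 : 0 ≤ ‖V S‖ * ‖S‖ * (2 / R * ‖u zeroIdx‖) := by positivity
    have h2 : 0 ≤ {S : Config n | ‖S‖ < δ}.indicator (fun S => ‖V S‖ * ‖S‖) S *
        (ε * ∑ α, ‖u α‖) :=
      mul_nonneg (Set.indicator_nonneg (fun _ _ => by positivity) _) (by positivity)
    rcases lt_or_ge ‖S‖ δ with h | h
    · have h' : S ∉ {S : Config n | δ ≤ ‖S‖ ∧ ‖S‖ ≤ R} := fun hc => absurd hc.1 (not_le.2 h)
      rw [trunc, Set.indicator_of_notMem h', zero_smul, sub_zero, norm_smul,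
        Set.indicator_of_mem (show S ∈ {S : Config n | ‖S‖ < δ} from h)]
      have h3 : ‖V S‖ * ‖dif ε S (u zeroIdx)‖ ≤ ‖V S‖ * (ε * ‖S‖ * ∑ α, ‖u α‖) :=
        mul_le_mul_of_nonneg_left (norm_dif_zeroIdx_le hε.le S hu) (norm_nonneg _)
      have h4 : ‖V S‖ * (ε * ‖S‖ * ∑ α, ‖u α‖) = ‖V S‖ * ‖S‖ * (ε * ∑ α, ‖u α‖) := by ring
      linarith
    rcases le_or_gt ‖S‖ R with h' | h'
    · rw [trunc, Set.indicator_of_mem (show S ∈ {S : Config n | δ ≤ ‖S‖ ∧ ‖S‖ ≤ R} from ⟨h, h'⟩),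
        sub_self, norm_zero]
      positivity
    · have h3 : S ∉ {S : Config n | δ ≤ ‖S‖ ∧ ‖S‖ ≤ R} := fun hc => absurd hc.2 (not_le.2 h')
      rw [trunc, Set.indicator_of_notMem h3, zero_smul, sub_zero, norm_smul]
      have h4 : ‖V S‖ * ‖dif ε S (u zeroIdx)‖ ≤ ‖V S‖ * (‖S‖ * (2 / R * ‖u zeroIdx‖)) := by
        refine mul_le_mul_of_nonneg_left ((norm_dif_le _ _ _).trans ?_) (norm_nonneg _)
        have : 2 * ‖u zeroIdx‖ * 1 ≤ 2 * ‖u zeroIdx‖ * (‖S‖ / R) :=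
          mul_le_mul_of_nonneg_left ((one_le_div hR).2 h'.le) (by positivity)
        calc 2 * ‖u zeroIdx‖ ≤ 2 * ‖u zeroIdx‖ * (‖S‖ / R) := by linarith
          _ = _ := by ring
      have h5 : ‖V S‖ * (‖S‖ * (2 / R * ‖u zeroIdx‖)) = ‖V S‖ * ‖S‖ * (2 / R * ‖u zeroIdx‖) := by
        ring
      linarith
  rw [pot, pot, ← smul_sub, ← integral_sub (hV.integrable_smul_dif hε.le hu)
    (Wigner.integrable_smul_dif ε (hV.isTruncated_trunc hδ R).integrable _), norm_smul, norm_I_div hε]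
  have h := norm_integral_le_of_norm_le ((hV.integrable.mul_const (2 / R * ‖u zeroIdx‖)).add
    (hi.mul_const (ε * ∑ α, ‖u α‖))) (Eventually.of_forall hb)
  rw [integral_add' (hV.integrable.mul_const _) (hi.mul_const _), integral_mul_const,
    integral_mul_const, integral_indicator hs] at h
  refine (mul_le_mul_of_nonneg_left h (inv_nonneg.2 hε.le)).trans (le_of_eq ?_)
  field_simp

/-- Truncated potentials which approximate `V` so fast that the growth of the first derivatives
for times up to `T` is compensated. -/
structure Approx (ε T : ℝ) (V : Config n → ℂ) where
  /-- The truncated potentials. -/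
  v : ℕ → Config n → ℂ
  /-- The error in terms of the function. -/
  a : ℕ → ℝ
  /-- The error in terms of the derivatives. -/
  b : ℕ → ℝ
  isTruncated : ∀ j, IsTruncated (v j)
  norm_le : ∀ j S, ‖v j S‖ ≤ ‖V S‖
  a_nonneg : ∀ j, 0 ≤ a j
  b_nonneg : ∀ j, 0 ≤ b j
  a_anti : Antitone a
  b_anti : Antitone b
  norm_pot_sub_le : ∀ j, ∀ u ∈ weakJets n 1, ‖pot ε V (u zeroIdx) - pot ε (v j) (u zeroIdx)‖ ≤
    a j * ‖u zeroIdx‖ + b j * ∑ α, ‖u α‖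
  tendsto : Tendsto (fun j => a j + b j * Real.exp (growthRate 1 n (moment 1 (v j)) * T))
    atTop (𝓝 0)

theorem growthRate_mono (m n : ℕ) : Monotone (growthRate m n) := fun M M' h => by
  exact mul_le_mul_of_nonneg_left (max_le_max le_rfl h) (by positivity)

theorem IsPotential.tendsto_setIntegral {V : Config n → ℂ} (hV : IsPotential V) :
    Tendsto (fun k : ℕ => ∫ S in {S | ‖S‖ < 1 / ((k : ℝ) + 1)}, ‖V S‖ * ‖S‖) atTop (𝓝 0) := by
  have h := tendsto_setIntegral_of_antitone (μ := (volume : Measure (Config n)))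
    (f := fun S : Config n => ‖V S‖ * ‖S‖)
    (s := fun k : ℕ => {S | ‖S‖ < 1 / ((k : ℝ) + 1)})
    (fun k => measurableSet_lt measurable_norm measurable_const)
    (fun j k hjk S (hS : ‖S‖ < 1 / ((k : ℝ) + 1)) =>
      show ‖S‖ < 1 / ((j : ℝ) + 1) from hS.trans_le (Nat.one_div_le_one_div hjk)) ⟨0, hV.integrable.integrableOn⟩
  -- The intersection is the origin, where the integrand vanishes; this argument also covers `n =
  -- 0`, where the origin has positive measure.
  have h0 : ∫ S in ⋂ k : ℕ, {S : Config n | ‖S‖ < 1 / ((k : ℝ) + 1)}, ‖V S‖ * ‖S‖ = 0 := by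
    refine setIntegral_eq_zero_of_forall_eq_zero fun S hS => ?_
    rw [Set.mem_iInter] at hS
    have : ‖S‖ ≤ 0 := ge_of_tendsto' tendsto_one_div_add_atTop_nhds_zero_nat fun k => (hS k).le
    rw [le_antisymm this (norm_nonneg _), mul_zero]
  rwa [h0] at h

/-- The first derivatives may grow at a rate proportional to the outer radius, because only the
first moment of `V` is assumed finite. The outer radius `j + 1` is fixed first; it bounds the growth
factor by `C j` whatever the inner radius. The inner radius is then made so small that its error
beats `C j`. -/
theorem IsPotential.nonempty_approx {V : Config n → ℂ} (hV : IsPotential V) {ε : ℝ} (hε : 0 < ε)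
    {T : ℝ} (hT : 0 ≤ T) : Nonempty (Approx ε T V) := by
  set M := ∫ S, ‖V S‖ * ‖S‖ with hM
  have hM0 : 0 ≤ M := integral_nonneg fun S => by positivity
  set C : ℕ → ℝ := fun j => Real.exp (growthRate 1 n ((1 + ((j : ℝ) + 1)) * M) * T)
  set I : ℕ → ℝ := fun k => ∫ S in {S : Config n | ‖S‖ < 1 / ((k : ℝ) + 1)}, ‖V S‖ * ‖S‖ with hI
  have hI0 : ∀ k, 0 ≤ I k := fun k => integral_nonneg fun S => by positivity
  have hIanti : Antitone I := fun j k hjk => by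
    refine setIntegral_mono_set hV.integrable.integrableOn
      (Eventually.of_forall fun S => by positivity) (Eventually.of_forall fun S hS => ?_)
    exact lt_of_lt_of_le hS (Nat.one_div_le_one_div hjk)
  -- A strictly increasing choice of inner radii keeps the errors `b` antitone.
  obtain ⟨φ, hφ, hφI⟩ := extraction_forall_of_eventually
    (P := fun j k => I k * C j < 1 / ((j : ℝ) + 1)) fun j => by
      have h := (hV.tendsto_setIntegral).mul_const (C j)
      rw [zero_mul] at h
      exact h.eventually_lt_const (by positivity)
  have hδ : ∀ j, (0 : ℝ) < 1 / ((φ j : ℝ) + 1) := fun j => by positivity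
  have hR : ∀ j : ℕ, (0 : ℝ) < (j : ℝ) + 1 := fun j => by positivity
  refine ⟨{
    v := fun j => trunc V (1 / ((φ j : ℝ) + 1)) (j + 1)
    a := fun j => 2 / (ε * (j + 1)) * M
    b := fun j => I (φ j)
    isTruncated := fun j => hV.isTruncated_trunc (hδ j) _
    norm_le := fun j => norm_trunc_le V _ _
    a_nonneg := fun j => by positivity
    b_nonneg := fun j => hI0 _
    a_anti := fun j k hjk => by
      dsimp only
      gcongr
    b_anti := fun j k hjk => hIanti (hφ.monotone hjk)
    norm_pot_sub_le := fun j u hu => hV.norm_pot_sub_trunc_le hε (hδ j) (hR j) hu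
    tendsto := ?_ }⟩
  have h1 : Tendsto (fun j : ℕ => 2 / (ε * (j + 1)) * M + 1 / ((j : ℝ) + 1)) atTop (𝓝 0) := by
    have h2 : ∀ j : ℕ, 2 / (ε * (j + 1)) * M + 1 / ((j : ℝ) + 1) =
        (2 / ε * M + 1) * (1 / ((j : ℝ) + 1)) := fun j => by
      field_simp
    simp only [h2]
    simpa using tendsto_one_div_add_atTop_nhds_zero_nat.const_mul (2 / ε * M + 1)
  refine squeeze_zero (fun j => ?_) (fun j => ?_) h1
  · have := hI0 (φ j)
    positivity
  · refine add_le_add le_rfl (le_trans ?_ (hφI j).le)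
    refine mul_le_mul_of_nonneg_left (Real.exp_le_exp.2 (mul_le_mul_of_nonneg_right ?_ hT)) (hI0 _)
    exact growthRate_mono _ _ (hV.moment_trunc_le (hR j).le)

section

/-! ### The propagator of a truncated potential -/

/-- The evolution in the interaction picture. -/
def evol (ε : ℝ) {v : Config n → ℂ} (hv : IsTruncated v) (f : L2 n) : ℝ → L2 n :=
  Classical.choose (exists_isEvol ε hv.integrable f)

theorem evol_zero (ε : ℝ) {v : Config n → ℂ} (hv : IsTruncated v) (f : L2 n) :
    evol ε hv f 0 = f :=
  (Classical.choose_spec (exists_isEvol ε hv.integrable f)).1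

theorem isEvol_evol (ε : ℝ) {v : Config n → ℂ} (hv : IsTruncated v) (f : L2 n) :
    IsEvol ε v (evol ε hv f) :=
  (Classical.choose_spec (exists_isEvol ε hv.integrable f)).2

/-- The propagator of the Wigner equation with a truncated potential. -/
def propagator (ε : ℝ) {v : Config n → ℂ} (hv : IsTruncated v) (t : ℝ) (f : L2 n) : L2 n :=
  (flow t).onL2 (evol ε hv f t)

theorem pair_flow_neg (t : ℝ) (f g : L2 n) :
    pair ((flow (-t)).onL2 f) g = pair f ((flow t).onL2 g) := by
  rw [(isTranspose_flow (-t)).pair_onL2, neg_neg]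

theorem pair_gen {ε : ℝ} {v : Config n → ℂ} (hv : IsTruncated v) (t : ℝ) (f g : L2 n) :
    pair (gen ε v t f) g = -pair f (gen ε v t g) := by
  rw [gen, gen, map_neg, map_neg, neg_apply, neg_neg, pair_flow_neg,
    pair_pot (integrable_smul_dif ε hv.integrable _) (integrable_smul_dif ε hv.integrable _),
    neg_neg, pair_comm f, pair_flow_neg, pair_comm]

/-- The equation is autonomous in the physical picture, so in the interaction picture a time shift
is conjugation with the free flow. -/
theorem gen_shift (ε : ℝ) (v : Config n → ℂ) (t s : ℝ) (f : L2 n) :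
    (flow (-t)).onL2 (gen ε v (s - t) f) = gen ε v s ((flow (-t)).onL2 f) := by
  have h1 : -t + -(s - t) = -s := by ring
  have h2 : s + -t = s - t := by ring
  rw [gen, gen, map_neg, flow_add, flow_add, h1, h2]

theorem IsEvol.shift {ε : ℝ} {v : Config n → ℂ} {p : ℝ → L2 n} (hp : IsEvol ε v p) (t : ℝ) :
    IsEvol ε v fun s => (flow (-t)).onL2 (p (s - t)) := fun s => by
  have h := (((flow (-t)).onL2 : L2 n →L[ℂ] L2 n).restrictScalars ℝ).hasFDerivAt.comp_hasDerivAt s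
    ((hp (s - t)).comp_sub_const s t)
  refine h.congr_deriv ?_
  exact gen_shift ε v t s _

theorem tendsto_pair {ι : Type*} {l : Filter ι} {p q : ι → L2 n} {f g : L2 n}
    (hp : Tendsto p l (𝓝 f)) (hq : Tendsto q l (𝓝 g)) :
    Tendsto (fun i => pair (p i) (q i)) l (𝓝 (pair f g)) := by
  rw [tendsto_iff_norm_sub_tendsto_zero] at *
  have h : Tendsto (fun i => ‖p i - f‖ * ‖q i - g‖ + ‖f‖ * ‖q i - g‖ + ‖p i - f‖ * ‖g‖) l (𝓝 0) := by
    simpa using ((hp.mul hq).add (hq.const_mul ‖f‖)).add (hp.mul_const ‖g‖)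
  refine squeeze_zero (fun _ => norm_nonneg _) (fun i => ?_) h
  have h2 : pair (p i) (q i) - pair f g = pair (p i - f) (q i - g) + pair f (q i - g) +
      pair (p i - f) g := by
    simp only [map_sub, sub_apply]
    ring
  rw [h2]
  exact norm_add₃_le.trans (add_le_add (add_le_add (norm_pair_le _ _) (norm_pair_le _ _))
    (norm_pair_le _ _))

theorem hasDerivAt_pair {p q : ℝ → L2 n} {p' q' : L2 n} {t : ℝ} (hp : HasDerivAt p p' t)
    (hq : HasDerivAt q q' t) :
    HasDerivAt (fun t => pair (p t) (q t)) (pair (p t) q' + pair p' (q t)) t := by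
  exact
  (((pair : L2 n →L[ℂ] L2 n →L[ℂ] ℂ).isBoundedBilinearMap.hasFDerivAt
    (p t, q t)).restrictScalars ℝ).comp_hasDerivAt t (hp.prodMk hq)

/-- The propagator for `-t` is the transpose of the propagator for `t`. -/
theorem pair_propagator {ε : ℝ} {v : Config n → ℂ} (hv : IsTruncated v) (t : ℝ) (f g : L2 n) :
    pair (propagator ε hv t f) g = pair f (propagator ε hv (-t) g) := by
  -- A second solution of the same equation. As `gen` is antisymmetric for the pairing, `pair (evol
  -- ε hv f s) (r s)` is constant in `s`; its values at `s = t` and `s = 0` are the two sides.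
  set r : ℝ → L2 n := fun s => (flow (-t)).onL2 (evol ε hv g (s - t)) with hr
  have h : ∀ s, HasDerivAt (fun s => pair (evol ε hv f s) (r s)) 0 s := fun s => by
    refine (hasDerivAt_pair (isEvol_evol ε hv f s) ((isEvol_evol ε hv g).shift t s)).congr_deriv ?_
    rw [pair_gen hv]
    exact add_neg_cancel _
  have hc := is_const_of_deriv_eq_zero (fun s => (h s).differentiableAt) (fun s => (h s).deriv) t 0
  simp only [hr, sub_self, evol_zero, zero_sub] at hc
  rw [propagator, propagator, ← hc, pair_comm _ ((flow (-t)).onL2 g), pair_flow_neg, pair_comm]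

theorem norm_propagator_sub {ε : ℝ} {v : Config n → ℂ} (hv : IsTruncated v) (t : ℝ) (f g : L2 n) :
    ‖propagator ε hv t f - propagator ε hv t g‖ = ‖f - g‖ := by
  rw [propagator, propagator, ← map_sub, Twist.norm_onL2,
    (isEvol_evol ε hv f).norm_sub_eq hv (isEvol_evol ε hv g), evol_zero, evol_zero]

theorem norm_propagator {ε : ℝ} {v : Config n → ℂ} (hv : IsTruncated v) (t : ℝ) (f : L2 n) :
    ‖propagator ε hv t f‖ = ‖f‖ := by
  rw [propagator, Twist.norm_onL2, norm_eq_of_re_inner_eq_zero (T := |t|)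
    (fun s _ => isEvol_evol ε hv f s) (fun s _ => re_inner_gen hv s _)
    ⟨neg_abs_le t, le_abs_self t⟩, evol_zero]

theorem continuous_evol (ε : ℝ) {v : Config n → ℂ} (hv : IsTruncated v) (f : L2 n) :
    Continuous (evol ε hv f) :=
  continuous_iff_continuousAt.2 fun t => (isEvol_evol ε hv f t).continuousAt

theorem continuous_propagator (ε : ℝ) {v : Config n → ℂ} (hv : IsTruncated v) (f : L2 n) :
    Continuous fun t => propagator ε hv t f :=
  Twist.continuous_onL2_comp continuous_flow (continuous_evol ε hv f)

theorem propagator_zero (ε : ℝ) {v : Config n → ℂ} (hv : IsTruncated v) (f : L2 n) :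
    propagator ε hv 0 f = f := by
  rw [propagator, evol_zero, flow_zero]

/-- The growth of the derivatives under the propagator. -/
theorem exists_jet_propagator {ε : ℝ} (hε : 0 < ε) {v : Config n → ℂ} (hv : IsTruncated v) {M : ℝ}
    (hM : moment m v ≤ M) {K : Submodule ℂ (Jet n m)} (hK : IsInvariant ε K)
    (hKw : K ≤ weakJets n m) {u : Jet n m} (hu : u ∈ K) (t : ℝ) :
    ∃ z ∈ K, z zeroIdx = propagator ε hv t (u zeroIdx) ∧
      ∑ α, ‖z α‖ ≤ Real.exp (growthRate m n M * |t|) * ∑ α, ‖u α‖ :=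
  sum_norm_evol_le hε hv hM (isEvol_evol ε hv _) hK hKw hu (evol_zero ε hv _).symm t

theorem transport_onTest_flow (t : ℝ) (φ : Test n) :
    transport ((flow t).onTest φ) = (flow t).onTest (transport φ) := by
  ext z
  have h := congrArg (fun ψ : Test n => ψ.1 z) (dirDeriv_flow t (z.2, 0) φ)
  simp only [dirDeriv_apply, Twist.onTest_apply, flow_χ, flow_A] at h
  simp only [transport_apply, Twist.onTest_apply, flow_χ, flow_A, h]
  simp

/-- The free flow is put on the test function, so that `2πk·∂_x` is applied only to `φ`; the
solution need not lie in the domain of the transport operator. -/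
theorem hasDerivAt_pair_propagator {ε : ℝ} {v : Config n → ℂ} (hv : IsTruncated v) (f : L2 n)
    (φ : Test n) (t : ℝ) :
    HasDerivAt (fun t => pair (propagator ε hv t f) (toL2 φ))
      (pair (propagator ε hv t f) (toL2 (transport φ) + pot ε v (toL2 φ))) t := by
  have h1 : (fun t => pair (propagator ε hv t f) (toL2 φ)) =
      fun t => pair (evol ε hv f t) (toL2 ((flow (-t)).onTest φ)) := by
    ext t
    rw [propagator, (isTranspose_flow t).pair_onL2, Twist.onL2_toL2]
  have h2 : HasDerivAt (fun t => toL2 ((flow (-t)).onTest φ))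
      (toL2 ((flow (-t)).onTest (transport φ))) t := by
    have h := (hasDerivAt_flow φ (-t)).scomp t (hasDerivAt_neg t)
    rw [neg_smul, one_smul, neg_neg] at h
    exact h
  rw [h1]
  refine (hasDerivAt_pair (isEvol_evol ε hv f t) h2).congr_deriv ?_
  rw [map_add, propagator, (isTranspose_flow t).pair_onL2, Twist.onL2_toL2]
  congr 1
  rw [gen, map_neg, neg_apply, pair_flow_neg, ← Twist.onL2_toL2, flow_flow_neg,
    pair_pot (integrable_smul_dif ε hv.integrable _) (integrable_smul_dif ε hv.integrable _),
    neg_neg]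

theorem pair_propagator_sub_eq_integral {ε : ℝ} {v : Config n → ℂ} (hv : IsTruncated v) (f : L2 n)
    (φ : Test n) (t : ℝ) :
    pair (propagator ε hv t f) (toL2 φ) - pair f (toL2 φ) =
      ∫ s in (0 : ℝ)..t, pair (propagator ε hv s f) (toL2 (transport φ) + pot ε v (toL2 φ)) := by
  have hc : Continuous fun s => pair (propagator ε hv s f)
      (toL2 (transport φ) + pot ε v (toL2 φ)) :=
    ((pair.flip _).continuous).comp (continuous_propagator ε hv f)
  rw [intervalIntegral.integral_eq_sub_of_hasDerivAt
    (fun s _ => hasDerivAt_pair_propagator hv f φ s) (hc.intervalIntegrable _ _), propagator_zero]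

/-! ### Passage to the limit -/

namespace Approx

variable {ε T : ℝ} {V : Config n → ℂ}

/-- The propagators of the truncated potentials. -/
def prop (A : Approx ε T V) (j : ℕ) (t : ℝ) (f : L2 n) : L2 n :=
  propagator ε (A.isTruncated j) t f

/-- The bound for the error of the truncation. -/
def err (A : Approx ε T V) (j : ℕ) : ℝ :=
  A.a j + A.b j * Real.exp (growthRate 1 n (moment 1 (A.v j)) * T)

theorem err_nonneg (A : Approx ε T V) (j : ℕ) : 0 ≤ A.err j := by
  have h1 := A.a_nonneg j
  have h2 := A.b_nonneg j
  unfold err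
  positivity

theorem exists_jet_prop (A : Approx ε T V) (hε : 0 < ε) {K : Submodule ℂ (Jet n 1)}
    (hK : IsInvariant ε K) (hKw : K ≤ weakJets n 1) {u : Jet n 1} (hu : u ∈ K) {t : ℝ}
    (ht : |t| ≤ T) (j : ℕ) :
    ∃ z ∈ K, z zeroIdx = A.prop j t (u zeroIdx) ∧
      ∑ α, ‖z α‖ ≤ Real.exp (growthRate 1 n (moment 1 (A.v j)) * T) * ∑ α, ‖u α‖ := by
  obtain ⟨z, hz, hz0, hzu⟩ := exists_jet_propagator hε (A.isTruncated j) le_rfl hK hKw hu t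
  refine ⟨z, hz, hz0, hzu.trans ?_⟩
  gcongr
  exact growthRate_nonneg _ _ _

/-- Along the `j`-th evolution the first derivatives grow at most by the exponential in `err j`,
while the `L²` norm is conserved. -/
theorem norm_pot_sub_pot_prop_le (A : Approx ε T V) (hε : 0 < ε) {u : Jet n 1}
    (hu : u ∈ weakJets n 1) {t : ℝ} (ht : |t| ≤ T) (j : ℕ) :
    ‖pot ε V (A.prop j t (u zeroIdx)) - pot ε (A.v j) (A.prop j t (u zeroIdx))‖ ≤
      A.err j * ∑ α, ‖u α‖ := by
  obtain ⟨z, hz, hz0, hzu⟩ := A.exists_jet_prop hε (isInvariant_weakJets ε) le_rfl hu ht j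
  have h0 : ‖z zeroIdx‖ ≤ ∑ α, ‖u α‖ := by
    rw [hz0, prop, norm_propagator]
    exact Finset.single_le_sum (f := fun α => ‖u α‖) (fun _ _ => norm_nonneg _) (Finset.mem_univ _)
  rw [← hz0, err, add_mul, mul_assoc]
  exact (A.norm_pot_sub_le j z hz).trans (add_le_add (mul_le_mul_of_nonneg_left h0 (A.a_nonneg j))
    (mul_le_mul_of_nonneg_left hzu (A.b_nonneg j)))

/-- Both truncations are compared with `V` along the `j`-th evolution only. Since `a` and `b` are
antitone, the error of `v k` costs no more than that of `v j`, and the growth factor of index `k`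
never appears. -/
theorem norm_pot_sub_prop_le (A : Approx ε T V) (hε : 0 < ε) {u : Jet n 1} (hu : u ∈ weakJets n 1)
    {t : ℝ} (ht : |t| ≤ T) {j k : ℕ} (hjk : j ≤ k) :
    ‖pot ε (A.v j) (A.prop j t (u zeroIdx)) - pot ε (A.v k) (A.prop j t (u zeroIdx))‖ ≤
      2 * A.err j * ∑ α, ‖u α‖ := by
  obtain ⟨z, hz, hz0, hzu⟩ := A.exists_jet_prop hε (isInvariant_weakJets ε) le_rfl hu ht j
  have h0 : ‖z zeroIdx‖ ≤ ∑ α, ‖u α‖ := by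
    rw [hz0, prop, norm_propagator]
    exact Finset.single_le_sum (f := fun α => ‖u α‖) (fun _ _ => norm_nonneg _) (Finset.mem_univ _)
  rw [← hz0]
  set U := ∑ α, ‖u α‖
  set Z := ∑ α, ‖z α‖
  set E := Real.exp (growthRate 1 n (moment 1 (A.v j)) * T) with hE
  have hZ0 : 0 ≤ Z := Finset.sum_nonneg fun _ _ => norm_nonneg _
  have hj := A.norm_pot_sub_le j z hz
  have hk := A.norm_pot_sub_le k z hz
  have ha : A.a k * ‖z zeroIdx‖ ≤ A.a j * ‖z zeroIdx‖ :=
    mul_le_mul_of_nonneg_right (A.a_anti hjk) (norm_nonneg _)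
  have hb : A.b k * Z ≤ A.b j * Z := mul_le_mul_of_nonneg_right (A.b_anti hjk) hZ0
  have ha' : A.a j * ‖z zeroIdx‖ ≤ A.a j * U := mul_le_mul_of_nonneg_left h0 (A.a_nonneg j)
  have hb' : A.b j * Z ≤ A.b j * (E * U) := mul_le_mul_of_nonneg_left hzu (A.b_nonneg j)
  have h3 := norm_sub_le (pot ε V (z zeroIdx) - pot ε (A.v k) (z zeroIdx))
    (pot ε V (z zeroIdx) - pot ε (A.v j) (z zeroIdx))
  rw [sub_sub_sub_cancel_left] at h3
  have h4 : 2 * A.err j * U = 2 * (A.a j * U) + 2 * (A.b j * (E * U)) := by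
    rw [err, ← hE]
    ring
  linarith

/-- The difference solves the skew-adjoint equation of `v k` with the error of the potentials,
evaluated on the `j`-th solution, as forcing; the growth lemma with `D = 0` integrates it. -/
theorem norm_prop_sub_le (A : Approx ε T V) (hε : 0 < ε) {u : Jet n 1} (hu : u ∈ weakJets n 1)
    {t : ℝ} (ht : t ∈ Set.Icc 0 T) {j k : ℕ} (hjk : j ≤ k) :
    ‖A.prop j t (u zeroIdx) - A.prop k t (u zeroIdx)‖ ≤ 2 * A.err j * (∑ α, ‖u α‖) * T := by
  set η := 2 * A.err j * ∑ α, ‖u α‖ with hη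
  have hη0 : 0 ≤ η := by
    have := A.err_nonneg j
    positivity
  set p := evol ε (A.isTruncated j) (u zeroIdx) with hp
  set r := evol ε (A.isTruncated k) (u zeroIdx) with hr
  have hT : ∀ s ∈ Set.Icc 0 T, |s| ≤ T := fun s hs => by
    rw [abs_of_nonneg hs.1]
    exact hs.2
  have key := sum_norm_le_of_re_inner_le (ι := Unit) (D := 0) (η := η) (T := T) le_rfl hη0
    (q := fun _ s => p s - r s) (b := fun _ _ => η)
    (fun _ s _ => (isEvol_evol ε (A.isTruncated j) (u zeroIdx) s).sub
      (isEvol_evol ε (A.isTruncated k) (u zeroIdx) s)) (fun _ _ _ => hη0) ?_ (by simp) ht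
  · simp only [Finset.univ_unique, Finset.sum_singleton, zero_mul, Real.exp_zero, one_mul, hp, hr,
      evol_zero, sub_self, norm_zero, zero_add] at key
    rw [prop, prop, propagator, propagator, ← map_sub, Twist.norm_onL2]
    exact key.trans (mul_le_mul_of_nonneg_left ht.2 hη0)
  · intro _ s hs
    rw [← hp, ← hr]
    have h1 : gen ε (A.v j) s (p s) - gen ε (A.v k) s (r s) = gen ε (A.v k) s (p s - r s) +
        (gen ε (A.v j) s (p s) - gen ε (A.v k) s (p s)) := by
      rw [gen_sub (A.isTruncated k).integrable]
      abel
    have h2 : ‖gen ε (A.v j) s (p s) - gen ε (A.v k) s (p s)‖ ≤ η := by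
      rw [gen, gen, neg_sub_neg, ← map_sub, Twist.norm_onL2, norm_sub_rev]
      exact A.norm_pot_sub_prop_le hε hu (hT s hs) hjk
    rw [h1, inner_add_right, Complex.add_re, re_inner_gen (A.isTruncated k), zero_add]
    exact (Complex.re_le_norm _).trans ((norm_inner_le_norm _ _).trans
      (mul_le_mul_of_nonneg_left h2 (norm_nonneg _)))

theorem tendsto_err (A : Approx ε T V) : Tendsto A.err atTop (𝓝 0) := A.tendsto

/-- For test functions the error bound applies directly; isometry of the propagators extends the
Cauchy property to all of `L²`, uniformly in time. -/
theorem uniformCauchySeqOn (A : Approx ε T V) (hε : 0 < ε) (f : L2 n) :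
    UniformCauchySeqOn (fun j t => A.prop j t f) atTop (Set.Icc 0 T) := by
  rw [Metric.uniformCauchySeqOn_iff]
  intro κ hκ
  obtain ⟨φ, hφ⟩ := denseRange_toL2.exists_dist_lt f (show 0 < κ / 4 by positivity)
  set U := ∑ α, ‖jet n 1 φ α‖
  have hlim : Tendsto (fun j => 2 * A.err j * U * T) atTop (𝓝 0) := by
    simpa using ((A.tendsto_err.const_mul 2).mul_const U).mul_const T
  obtain ⟨N, hN⟩ := eventually_atTop.1 (hlim.eventually_lt_const (show 0 < κ / 4 by positivity))
  refine ⟨N, ?_⟩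
  have hf : ∀ j t, dist (A.prop j t f) (A.prop j t (toL2 φ)) < κ / 4 := fun j t => by
    rw [dist_eq_norm, prop, prop, norm_propagator_sub, ← dist_eq_norm]
    exact hφ
  have hφN : ∀ j ≥ N, ∀ t ∈ Set.Icc 0 T,
      dist (A.prop N t (toL2 φ)) (A.prop j t (toL2 φ)) < κ / 4 := fun j hj t ht => by
    have h := A.norm_prop_sub_le hε (testJets_le_weakJets (jet_mem_testJets φ)) ht hj
    rw [jet_zeroIdx] at h
    rw [dist_eq_norm]
    exact h.trans_lt (hN N le_rfl)
  intro j hj k hk t ht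
  have h1 := hf j t
  have h2 := hf k t
  have h3 := hφN j hj t ht
  have h4 := hφN k hk t ht
  rw [dist_comm] at h2 h3
  have h5 := dist_triangle4 (A.prop j t f) (A.prop j t (toL2 φ)) (A.prop N t (toL2 φ))
    (A.prop k t f)
  have h6 := dist_triangle (A.prop N t (toL2 φ)) (A.prop k t (toL2 φ)) (A.prop k t f)
  linarith

/-- The limit of the truncated evolutions. -/
theorem exists_limit (A : Approx ε T V) (hε : 0 < ε) (f : L2 n) :
    ∃ W : ℝ → L2 n, TendstoUniformlyOn (fun j t => A.prop j t f) W atTop (Set.Icc 0 T) := by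
  have h := A.uniformCauchySeqOn hε f
  have h1 : ∀ t, ∃ w, t ∈ Set.Icc 0 T → Tendsto (fun j => A.prop j t f) atTop (𝓝 w) := fun t => by
    by_cases ht : t ∈ Set.Icc 0 T
    · obtain ⟨w, hw⟩ := cauchySeq_tendsto_of_complete (h.cauchySeq ht)
      exact ⟨w, fun _ => hw⟩
    · exact ⟨0, fun h => absurd h ht⟩
  choose W hW using h1
  exact ⟨W, h.tendstoUniformlyOn_of_tendsto fun t ht => hW t ht⟩

theorem tendsto_pot (A : Approx ε T V) (hT : 0 ≤ T) {u : Jet n 1} (hu : u ∈ weakJets n 1) :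
    Tendsto (fun j => pot ε (A.v j) (u zeroIdx)) atTop (𝓝 (pot ε V (u zeroIdx))) := by
  rw [tendsto_iff_norm_sub_tendsto_zero]
  have hlim : Tendsto (fun j => A.err j * ∑ α, ‖u α‖) atTop (𝓝 0) := by
    simpa using A.tendsto_err.mul_const (∑ α, ‖u α‖)
  refine squeeze_zero (fun _ => norm_nonneg _) (fun j => ?_) hlim
  rw [norm_sub_rev]
  refine (A.norm_pot_sub_le j u hu).trans ?_
  have h0 : ‖u zeroIdx‖ ≤ ∑ α, ‖u α‖ :=
    Finset.single_le_sum (f := fun α => ‖u α‖) (fun _ _ => norm_nonneg _) (Finset.mem_univ _)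
  have h1 : 1 ≤ Real.exp (growthRate 1 n (moment 1 (A.v j)) * T) :=
    Real.one_le_exp (mul_nonneg (growthRate_nonneg _ _ _) hT)
  rw [err, add_mul]
  refine add_le_add (mul_le_mul_of_nonneg_left h0 (A.a_nonneg j))
    (mul_le_mul_of_nonneg_right (le_mul_of_one_le_right (A.b_nonneg j) h1) ?_)
  exact Finset.sum_nonneg fun _ _ => norm_nonneg _

/-- The limit solves the weak form of the Wigner equation. -/
theorem pair_limit_sub_eq_integral (A : Approx ε T V) {f : L2 n} {W : ℝ → L2 n}
    (hW : TendstoUniformlyOn (fun j t => A.prop j t f) W atTop (Set.Icc 0 T)) (φ : Test n) {t : ℝ}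
    (ht : t ∈ Set.Icc 0 T) :
    pair (W t) (toL2 φ) - pair f (toL2 φ) =
      ∫ s in (0 : ℝ)..t, pair (W s) (toL2 (transport φ) + pot ε V (toL2 φ)) := by
  have hT : 0 ≤ T := ht.1.trans ht.2
  have hpot : Tendsto (fun j => toL2 (transport φ) + pot ε (A.v j) (toL2 φ)) atTop
      (𝓝 (toL2 (transport φ) + pot ε V (toL2 φ))) := by
    have h := A.tendsto_pot hT (testJets_le_weakJets (jet_mem_testJets φ))
    rw [jet_zeroIdx] at h
    exact h.const_add _
  obtain ⟨C, hC⟩ := hpot.norm.bddAbove_range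
  have h1 : Tendsto (fun j => pair (A.prop j t f) (toL2 φ) - pair f (toL2 φ)) atTop
      (𝓝 (pair (W t) (toL2 φ) - pair f (toL2 φ))) :=
    ((((pair.flip (toL2 φ)).continuous.tendsto _).comp (hW.tendsto_at ht))).sub_const _
  refine tendsto_nhds_unique h1 ?_
  have h2 : ∀ j, pair (A.prop j t f) (toL2 φ) - pair f (toL2 φ) = ∫ s in (0 : ℝ)..t,
      pair (A.prop j s f) (toL2 (transport φ) + pot ε (A.v j) (toL2 φ)) := fun j =>
    pair_propagator_sub_eq_integral _ f φ t
  simp only [h2]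
  refine intervalIntegral.tendsto_integral_filter_of_dominated_convergence (fun _ => ‖f‖ * C)
    (Eventually.of_forall fun j => ?_) (Eventually.of_forall fun j => ?_) (by simp) ?_
  · exact (((pair.flip _).continuous).comp
      (continuous_propagator ε (A.isTruncated j) f)).aestronglyMeasurable
  · refine Eventually.of_forall fun s _ => (norm_pair_le _ _).trans ?_
    rw [prop, norm_propagator]
    exact mul_le_mul_of_nonneg_left (hC ⟨j, rfl⟩) (norm_nonneg _)
  · refine Eventually.of_forall fun s hs => ?_
    rw [Set.uIoc_of_le ht.1] at hs
    have h3 := hW.tendsto_at (show s ∈ Set.Icc 0 T from ⟨hs.1.le, hs.2.trans ht.2⟩)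
    exact tendsto_pair h3 hpot

end Approx

end

section

/-! ### The potential term of a test function -/

/-- The function `e^{2πi S·x} (φ (x, k - εS/2) - φ (x, k + εS/2))`. -/
def difTest (ε : ℝ) (S : Config n) (φ : Test n) : Test n :=
  (weyl (-(ε / 2)) S).onTest φ - (weyl (ε / 2) S).onTest φ

theorem dif_toL2 (ε : ℝ) (S : Config n) (φ : Test n) :
    dif ε S (toL2 φ) = toL2 (difTest ε S φ) := by
  rw [dif_apply, Twist.onL2_toL2, Twist.onL2_toL2, difTest, map_sub]

theorem difTest_apply (ε : ℝ) (S : Config n) (φ : Test n) (z : Phase n) :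
    (difTest ε S φ).1 z = Complex.exp ((2 * Real.pi * inner ℝ S z.1 : ℝ) * Complex.I) *
      (φ.1 (z.1, z.2 - (ε / 2) • S) - φ.1 (z.1, z.2 + (ε / 2) • S)) := by
  have h : (difTest ε S φ).1 z =
    ((weyl (-(ε / 2)) S).onTest φ).1 z - ((weyl (ε / 2) S).onTest φ).1 z := rfl
  rw [h, Twist.onTest_apply, Twist.onTest_apply, weyl_χ, weyl_χ, weyl_A, weyl_A, neg_smul,
    ← sub_eq_add_neg, mul_sub]

theorem exists_norm_difTest_le {ε : ℝ} (hε : 0 ≤ ε) (φ : Test n) :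
    ∃ C, 0 ≤ C ∧ ∀ S z, ‖(difTest ε S φ).1 z‖ ≤ C * ‖S‖ := by
  obtain ⟨C, hC⟩ := φ.contDiff.lipschitzWith_of_hasCompactSupport φ.hasCompactSupport (by simp)
  refine ⟨C * ε, by positivity, fun S z => ?_⟩
  rw [difTest_apply, norm_mul, Complex.norm_exp_ofReal_mul_I, one_mul]
  refine (hC.norm_sub_le _ _).trans ?_
  rw [mul_assoc]
  refine mul_le_mul_of_nonneg_left ?_ C.2
  have h : z.2 - (ε / 2) • S - (z.2 + (ε / 2) • S) = (-ε) • S := by module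
  rw [Prod.mk_sub_mk, sub_self, h, Prod.norm_mk, norm_zero, norm_smul, norm_neg, Real.norm_eq_abs,
    abs_of_nonneg hε]
  exact (max_eq_right (by positivity)).le

theorem continuous_difTest (ε : ℝ) (φ : Test n) :
    Continuous fun x : Phase n × Config n => (difTest ε x.2 φ).1 x.1 := by
  simp only [difTest_apply]
  have := φ.continuous
  fun_prop

variable {V : Config n → ℂ}

theorem IsPotential.integrable_mul_difTest (hV : IsPotential V) {ε : ℝ} (hε : 0 ≤ ε) (φ : Test n)
    (z : Phase n) : Integrable fun S => V S * (difTest ε S φ).1 z := by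
  obtain ⟨C, hC0, hC⟩ := exists_norm_difTest_le hε φ
  have hc : Continuous fun S => (difTest ε S φ).1 z := by
    have := φ.continuous
    simp only [difTest_apply]
    fun_prop
  refine (hV.integrable.mul_const C).mono' (hV.aestronglyMeasurable.mul hc.aestronglyMeasurable)
    (Eventually.of_forall fun S => ?_)
  rw [norm_mul, mul_assoc, mul_comm ‖S‖]
  exact mul_le_mul_of_nonneg_left (hC S z) (norm_nonneg _)

theorem IsPotential.aestronglyMeasurable_mul_difTest (hV : IsPotential V) (ε : ℝ) (φ : Test n) :
    AEStronglyMeasurable (fun x : Phase n × Config n => V x.2 * (difTest ε x.2 φ).1 x.1)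
      ((volume : Measure (Phase n)).prod volume) :=
  hV.aestronglyMeasurable.comp_snd.mul (continuous_difTest ε φ).aestronglyMeasurable

/-- The real part is the mean of `κ` and its conjugate. Under `S ↦ -S` the difference `δ` is odd and
`κ` becomes minus its conjugate, so both halves have the same integral and the real part may be
dropped. -/
theorem IsPotential.potTerm_eq_integral (hV : IsPotential V) {ε : ℝ} (hε : 0 ≤ ε) (φ : Test n)
    (z : Phase n) :
    potTerm ε V φ.1 z = (Complex.I / (ε : ℂ)) * ∫ S, V S * (difTest ε S φ).1 z := by
  set κ : Config n → ℂ := fun S => Complex.I *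
    Complex.exp ((2 * Real.pi * inner ℝ S z.1 : ℝ) * Complex.I) * V S with hκ
  set δ : Config n → ℂ := fun S => φ.1 (z.1, z.2 - (ε / 2) • S) - φ.1 (z.1, z.2 + (ε / 2) • S)
    with hδ
  have hI : Integrable fun S => κ S * δ S := by
    refine ((hV.integrable_mul_difTest hε φ z).const_mul Complex.I).congr
      (Eventually.of_forall fun S => ?_)
    simp only [difTest_apply, hκ, hδ]
    ring
  have hodd : ∀ᵐ S, κ (-S) * δ (-S) = (starRingEnd ℂ) (κ S) * δ S := by
    filter_upwards [hV.herm] with S hS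
    have h : Complex.exp (-(((2 * Real.pi * inner ℝ S z.1 : ℝ) : ℂ) * Complex.I)) =
        (starRingEnd ℂ) (Complex.exp (((2 * Real.pi * inner ℝ S z.1 : ℝ) : ℂ) * Complex.I)) := by
      rw [← Complex.exp_conj, map_mul, Complex.conj_ofReal, Complex.conj_I, mul_neg]
    simp only [hκ, hδ, hS, inner_neg_left, mul_neg, Complex.ofReal_neg, neg_mul, h, map_mul,
      Complex.conj_I, smul_neg, sub_neg_eq_add]
    rw [← sub_eq_add_neg]
    ring
  have hconj : Integrable fun S => (starRingEnd ℂ) (κ S) * δ S := hI.comp_neg.congr hodd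
  have h1 : ∫ S, (starRingEnd ℂ) (κ S) * δ S = ∫ S, κ S * δ S := by
    rw [← integral_congr_ae hodd, integral_neg_eq_self (fun S => κ S * δ S)]
  have h2 : ∀ S, (potKernel V z.1 S : ℂ) * δ S =
      2⁻¹ * (κ S * δ S + (starRingEnd ℂ) (κ S) * δ S) := fun S => by
    have : (potKernel V z.1 S : ℂ) = 2⁻¹ * (κ S + (starRingEnd ℂ) (κ S)) := by
      rw [Complex.add_conj]
      simp [potKernel, hκ]
    rw [this]
    ring
  have h3 : ∫ S, (potKernel V z.1 S : ℂ) * δ S = ∫ S, κ S * δ S := by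
    simp only [h2]
    rw [integral_const_mul, integral_add hI hconj, h1]
    ring
  have h4 : ∫ S, κ S * δ S = Complex.I * ∫ S, V S * (difTest ε S φ).1 z := by
    rw [← integral_const_mul]
    refine integral_congr_ae (Eventually.of_forall fun S => ?_)
    simp only [difTest_apply, hκ, hδ]
    ring
  rw [potTerm, h3, h4]
  push_cast
  ring

/-- The potential term in `L²` is given by the pointwise formula. -/
theorem IsPotential.coeFn_pot_toL2 (hV : IsPotential V) {ε : ℝ} (hε : 0 < ε) (φ : Test n) :
    pot ε V (toL2 φ) =ᵐ[volume] potTerm ε V φ.1 := by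
  obtain ⟨C, hC0, hC⟩ := exists_norm_difTest_le hε.le φ
  have hG : potTerm ε V φ.1 = fun z => (Complex.I / (ε : ℂ)) * ∫ S, V S * (difTest ε S φ).1 z :=
    funext fun z => hV.potTerm_eq_integral hε.le φ z
  have hmeas : AEStronglyMeasurable (potTerm ε V φ.1) := by
    rw [hG]
    exact (hV.aestronglyMeasurable_mul_difTest ε φ).integral_prod_right'.const_mul _
  have hloc : LocallyIntegrable (potTerm ε V φ.1) := by
    refine (locallyIntegrable_const (ε⁻¹ * ∫ S, ‖V S‖ * ‖S‖ * C)).mono hmeas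
      (Eventually.of_forall fun z => ?_)
    rw [hG, norm_mul, norm_I_div hε, Real.norm_eq_abs]
    refine le_trans ?_ (le_abs_self _)
    refine mul_le_mul_of_nonneg_left ?_ (inv_nonneg.2 hε.le)
    refine norm_integral_le_of_norm_le (hV.integrable.mul_const C)
      (Eventually.of_forall fun S => ?_)
    rw [norm_mul, mul_assoc, mul_comm ‖S‖]
    exact mul_le_mul_of_nonneg_left (hC S z) (norm_nonneg _)
  -- The Bochner integral in `L²` and the pointwise integral are compared after testing with smooth
  -- compactly supported `g`, where Fubini applies thanks to the bound `C * ‖S‖`.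
  refine ae_eq_of_integral_contDiff_smul_eq ((Lp.memLp _).locallyIntegrable one_le_two) hloc
    fun g hg hgs => ?_
  set ψ : Test n := ⟨fun z => (g z : ℂ), Complex.ofRealCLM.contDiff.comp hg,
    hgs.comp_left Complex.ofReal_zero⟩ with hψ
  have hmem : jet n 1 φ ∈ weakJets n 1 := testJets_le_weakJets (jet_mem_testJets φ)
  have hint := hV.integrable_smul_dif hε.le hmem
  rw [jet_zeroIdx] at hint
  have h1 : ∫ z, g z • pot ε V (toL2 φ) z = pair (pot ε V (toL2 φ)) (toL2 ψ) := by
    rw [pair_toL2]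
    refine integral_congr_ae (Eventually.of_forall fun z => ?_)
    simp only [hψ, Complex.real_smul]
    ring
  have h2 : ∀ S, V S * pair (dif ε S (toL2 φ)) (toL2 ψ) =
      ∫ z, V S * (difTest ε S φ).1 z * (g z : ℂ) := fun S => by
    rw [dif_toL2, pair_toL2, ← integral_const_mul]
    refine integral_congr_ae ?_
    filter_upwards [coeFn_toL2 (difTest ε S φ)] with z hz
    rw [hz, mul_assoc]
  have hgi : Integrable g := hg.continuous.integrable_of_hasCompactSupport hgs
  have h3 : Integrable (Function.uncurry fun (z : Phase n) (S : Config n) =>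
      V S * (difTest ε S φ).1 z * (g z : ℂ)) ((volume : Measure (Phase n)).prod volume) := by
    have hb := hgi.norm.mul_prod (hV.integrable.mul_const C)
    refine hb.mono' ((hV.aestronglyMeasurable_mul_difTest ε φ).mul
      (Complex.continuous_ofReal.comp (hg.continuous.comp continuous_fst)).aestronglyMeasurable)
      (Eventually.of_forall fun x => ?_)
    rw [Function.uncurry_def, norm_mul, norm_mul, Complex.norm_real, mul_comm]
    refine mul_le_mul_of_nonneg_left ?_ (norm_nonneg _)
    rw [mul_assoc, mul_comm ‖x.2‖]
    exact mul_le_mul_of_nonneg_left (hC x.2 x.1) (norm_nonneg _)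
  rw [h1, pair_pot_left hint]
  simp only [h2]
  rw [← integral_integral_swap h3, ← integral_const_mul]
  refine integral_congr_ae (Eventually.of_forall fun z => ?_)
  simp only [hG, Complex.real_smul]
  rw [integral_mul_const]
  ring

theorem IsPotential.pair_add_pot (hV : IsPotential V) {ε : ℝ} (hε : 0 < ε) (φ : Test n) (f : L2 n) :
    pair f (toL2 (transport φ) + pot ε V (toL2 φ)) =
      ∫ z : Phase n, f z * (2 * Real.pi * fderiv ℝ φ.1 z (z.2, 0) + potTerm ε V φ.1 z) := by
  rw [pair_apply]
  refine integral_congr_ae ?_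
  filter_upwards [Lp.coeFn_add (toL2 (transport φ)) (pot ε V (toL2 φ)),
    coeFn_toL2 (transport φ), hV.coeFn_pot_toL2 hε φ] with z h1 h2 h3
  rw [h1, Pi.add_apply, h2, h3, transport_apply]

/-- The weak form of the equation in terms of the pairing. -/
theorem IsPotential.isSolution_iff (hV : IsPotential V) {ε : ℝ} (hε : 0 < ε) {T : ℝ} {f : L2 n}
    {W : ℝ → L2 n} :
    IsSolution ε V T f W ↔ ContinuousOn W (Set.Icc 0 T) ∧ W 0 = f ∧
      ∀ φ : Test n, ∀ t ∈ Set.Icc 0 T, pair (W t) (toL2 φ) - pair f (toL2 φ) =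
        ∫ s in (0 : ℝ)..t, pair (W s) (toL2 (transport φ) + pot ε V (toL2 φ)) := by
  constructor
  · rintro ⟨h1, h2, h3⟩
    refine ⟨h1, h2, fun φ t ht => ?_⟩
    simp only [pair_toL2, hV.pair_add_pot hε]
    exact h3 φ.1 φ.2 t ht
  · rintro ⟨h1, h2, h3⟩
    refine ⟨h1, h2, fun φ hφ t ht => ?_⟩
    have h := h3 ⟨φ, hφ⟩ t ht
    simpa only [pair_toL2, hV.pair_add_pot hε] using h

end

section

/-! ### Uniqueness -/

/-- Chain rule on the diagonal when the derivative in the first variable is known only in integrated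
form: `H r r = H s r + ∫ σ in s..r, K σ r`, and joint continuity of `K` makes the integral
differentiable at `s` with derivative `K s s`. -/
theorem hasDerivWithinAt_diag {H K : ℝ → ℝ → ℂ} {a b : ℝ}
    (hK : ContinuousOn (Function.uncurry K) (Set.Icc a b ×ˢ Set.Icc a b))
    (hH : ∀ s ∈ Set.Icc a b, ∀ s' ∈ Set.Icc a b, ∀ r ∈ Set.Icc a b,
      H s' r - H s r = ∫ σ in s..s', K σ r) {s : ℝ} (hs : s ∈ Set.Icc a b) {L : ℂ}
    (hL : HasDerivWithinAt (H s) L (Set.Icc a b) s) :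
    HasDerivWithinAt (fun s => H s s) (K s s + L) (Set.Icc a b) s := by
  have hJ : HasDerivWithinAt (fun r => ∫ σ in s..r, K σ r) (K s s) (Set.Icc a b) s := by
    rw [hasDerivWithinAt_iff_isLittleO, Asymptotics.isLittleO_iff]
    intro c hc
    obtain ⟨δ, hδ, h⟩ := Metric.continuousWithinAt_iff.1 (hK (s, s) ⟨hs, hs⟩) c hc
    filter_upwards [self_mem_nhdsWithin, mem_nhdsWithin_of_mem_nhds (Metric.ball_mem_nhds s hδ)]
      with r hr hrδ
    have hsub : Set.uIcc s r ⊆ Set.Icc a b := (Set.uIcc_subset_Icc hs hr)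
    have hi : IntervalIntegrable (fun σ => K σ r) volume s r := by
      refine ContinuousOn.intervalIntegrable fun σ hσ => ?_
      exact (hK (σ, r) ⟨hsub hσ, hr⟩).comp (t := Set.Icc a b ×ˢ Set.Icc a b)
        (f := fun σ => (σ, r)) (Continuous.prodMk_left r).continuousWithinAt
        fun σ hσ => ⟨hsub hσ, hr⟩
    have h1 : (∫ σ in s..r, K σ r) - (∫ σ in s..s, K σ s) - (r - s) • K s s =
        ∫ σ in s..r, (K σ r - K s s) := by
      rw [intervalIntegral.integral_same, sub_zero, intervalIntegral.integral_sub hi (by simp),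
        intervalIntegral.integral_const]
    rw [h1, Real.norm_eq_abs]
    refine intervalIntegral.norm_integral_le_of_norm_le_const fun σ hσ => ?_
    have h2 : dist (σ, r) (s, s) < δ := by
      rw [Prod.dist_eq]
      refine max_lt ?_ hrδ
      refine lt_of_le_of_lt ?_ hrδ
      rw [Real.dist_eq, Real.dist_eq]
      exact Set.abs_sub_left_of_mem_uIcc (Set.uIoc_subset_uIcc hσ)
    have h3 := h ⟨hsub (Set.uIoc_subset_uIcc hσ), hr⟩ h2
    rw [dist_eq_norm] at h3
    exact h3.le
  have h := hJ.add hL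
  refine h.congr (fun r hr => ?_) ?_
  · rw [Pi.add_apply, ← hH s hs r hr r hr]
    ring
  · rw [Pi.add_apply, intervalIntegral.integral_same, zero_add]

theorem continuousOn_pair {X : Type*} [TopologicalSpace X] {p q : X → L2 n} {s : Set X}
    (hp : ContinuousOn p s) (hq : ContinuousOn q s) :
    ContinuousOn (fun x => pair (p x) (q x)) s := fun x hx => tendsto_pair (hp x hx) (hq x hx)

variable {V : Config n → ℂ} {ε : ℝ}

/-- By `norm_pot_le` the potential term is bounded from first order jets to `L²`, even though it may
be unbounded on `L²`. -/
theorem IsPotential.continuous_pot (hV : IsPotential V) (hε : 0 < ε) {X : Type*}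
    [TopologicalSpace X] {g : X → Jet n 1} (hg : Continuous g) (hgw : ∀ x, g x ∈ weakJets n 1) :
    Continuous fun x => pot ε V (g x zeroIdx) := by
  refine continuous_iff_continuousAt.2 fun x₀ => ?_
  rw [ContinuousAt, tendsto_iff_norm_sub_tendsto_zero]
  have h : Continuous fun x => (∫ S, ‖V S‖ * ‖S‖) * ∑ α, ‖(g x - g x₀) α‖ :=
    continuous_const.mul (continuous_finsetSum _ fun α _ =>
      ((continuous_apply α).comp (hg.sub continuous_const)).norm)
  have h0 := h.tendsto x₀
  simp only [sub_self, Pi.zero_apply, norm_zero, Finset.sum_const_zero, mul_zero] at h0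
  refine squeeze_zero (fun _ => norm_nonneg _) (fun x => ?_) h0
  rw [← hV.pot_sub hε.le (hgw x) (hgw x₀)]
  exact hV.norm_pot_le hε (Submodule.sub_mem _ (hgw x) (hgw x₀))

/-- Continuous curves in `L²` which solve the homogeneous weak equation with initial value zero. -/
structure IsNullSolution (ε : ℝ) (V : Config n → ℂ) (T : ℝ) (D : ℝ → L2 n) : Prop where
  continuousOn : ContinuousOn D (Set.Icc 0 T)
  weak : ∀ φ : Test n, ∀ t ∈ Set.Icc 0 T, pair (D t) (toL2 φ) =
    ∫ s in (0 : ℝ)..t, pair (D s) (toL2 (transport φ) + pot ε V (toL2 φ))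

namespace IsNullSolution

variable {T : ℝ} {D : ℝ → L2 n}

theorem pair_sub_eq_integral (h : IsNullSolution ε V T D) (φ : Test n) {s s' : ℝ}
    (hs : s ∈ Set.Icc 0 T) (hs' : s' ∈ Set.Icc 0 T) :
    pair (D s') (toL2 φ) - pair (D s) (toL2 φ) =
      ∫ σ in s..s', pair (D σ) (toL2 (transport φ) + pot ε V (toL2 φ)) := by
  have hi : ∀ s ∈ Set.Icc 0 T, IntervalIntegrable
      (fun σ => pair (D σ) (toL2 (transport φ) + pot ε V (toL2 φ))) volume 0 s := fun s hs =>
    ((continuousOn_pair h.continuousOn continuousOn_const).mono (by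
      rw [Set.uIcc_of_le hs.1]
      exact Set.Icc_subset_Icc_right hs.2)).intervalIntegrable
  rw [h.weak φ s hs, h.weak φ s' hs', intervalIntegral.integral_interval_sub_left (hi s' hs')
    (hi s hs)]

/-- Test functions moving with the free flow remove the transport term: the one from the weak
equation cancels the derivative of the flow. -/
theorem hasDerivWithinAt_pair_flow (h : IsNullSolution ε V T D) (hV : IsPotential V) (hε : 0 < ε)
    (φ : Test n) {s : ℝ} (hs : s ∈ Set.Icc 0 T) :
    HasDerivWithinAt (fun s => pair (D s) ((flow s).onL2 (toL2 φ)))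
      (pair (D s) (pot ε V ((flow s).onL2 (toL2 φ)))) (Set.Icc 0 T) s := by
  set K : ℝ → ℝ → ℂ := fun σ r => pair (D σ) (toL2 (transport ((flow r).onTest φ)) +
    pot ε V (toL2 ((flow r).onTest φ))) with hK
  have hp : ∀ r, pot ε V (toL2 ((flow r).onTest φ)) =
      pot ε V (jetFlow 1 r (jet n 1 φ) zeroIdx) := fun r => by
    rw [jetFlow, jetMap_zeroIdx, jet_zeroIdx, Twist.onL2_toL2]
  have hKc : ContinuousOn (Function.uncurry K) (Set.Icc 0 T ×ˢ Set.Icc 0 T) := by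
    refine continuousOn_pair (h.continuousOn.comp continuousOn_fst fun x hx => hx.1) ?_
    refine Continuous.continuousOn ?_
    simp only [transport_onTest_flow, ← Twist.onL2_toL2 _ (transport φ), hp]
    refine ((continuous_flow _).comp continuous_snd).add ?_
    exact hV.continuous_pot hε (continuous_jetFlow continuous_const continuous_snd) fun x =>
      (isInvariant_weakJets ε).jetFlow_mem _ _ (testJets_le_weakJets (jet_mem_testJets φ))
  have hL : HasDerivWithinAt (fun r => pair (D s) (toL2 ((flow r).onTest φ)))
      (pair (D s) (-toL2 ((flow s).onTest (transport φ)))) (Set.Icc 0 T) s :=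
    (((pair (D s)).restrictScalars ℝ).hasFDerivAt.comp_hasDerivAt s
      (hasDerivAt_flow φ s)).hasDerivWithinAt
  have key := hasDerivWithinAt_diag (H := fun s r => pair (D s) (toL2 ((flow r).onTest φ))) hKc
    (fun s hs s' hs' r _ => h.pair_sub_eq_integral _ hs hs') hs hL
  simp only [Twist.onL2_toL2]
  refine key.congr_deriv ?_
  rw [hK]
  simp only [transport_onTest_flow]
  rw [← map_add]
  congr 1
  abel

theorem exists_bound (h : IsNullSolution ε V T D) : ∃ B, 0 ≤ B ∧ ∀ s ∈ Set.Icc 0 T, ‖D s‖ ≤ B := by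
  obtain ⟨B, hB⟩ := isCompact_Icc.exists_bound_of_continuousOn h.continuousOn
  exact ⟨max B 0, le_max_right _ _, fun s hs => (hB s hs).trans (le_max_left _ _)⟩

/-- Once transport is gone, both sides are continuous in the first order jet without any weight in
`k`, so the identity passes from test functions to `testJets`. -/
theorem pair_flow_sub_eq_integral (h : IsNullSolution ε V T D) (hV : IsPotential V) (hε : 0 < ε)
    {u : Jet n 1} (hu : u ∈ testJets n 1) {s s' : ℝ} (hs : s ∈ Set.Icc 0 T)
    (hs' : s' ∈ Set.Icc 0 T) :
    pair (D s') ((flow s').onL2 (u zeroIdx)) - pair (D s) ((flow s).onL2 (u zeroIdx)) =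
      ∫ σ in s..s', pair (D σ) (pot ε V (jetFlow 1 σ u zeroIdx)) := by
  have hT : 0 ≤ T := hs.1.trans hs.2
  have hsub : Set.uIcc s s' ⊆ Set.Icc 0 T := Set.uIcc_subset_Icc hs hs'
  -- A continuous extension of `D` to all times, which gives joint continuity on all of `testJets n
  -- 1 × ℝ` for the parametric integral.
  obtain ⟨D', hD', hDD'⟩ : ∃ D' : ℝ → L2 n, Continuous D' ∧ ∀ s ∈ Set.Icc 0 T, D' s = D s :=
    ⟨Set.IccExtend hT ((Set.Icc 0 T).domRestrict D), h.continuousOn.domRestrict.Icc_extend',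
      fun s hs => by rw [Set.IccExtend_of_mem _ _ hs, Set.domRestrict_apply]⟩
  have hint : ∀ u : Jet n 1, ∫ σ in s..s', pair (D σ) (pot ε V (jetFlow 1 σ u zeroIdx)) =
      ∫ σ in s..s', pair (D' σ) (pot ε V (jetFlow 1 σ u zeroIdx)) := fun u =>
    intervalIntegral.integral_congr fun σ hσ => by simp only [hDD' σ (hsub hσ)]
  have hF : Continuous (Function.uncurry fun (u : testJets n 1) (σ : ℝ) =>
      pair (D' σ) (pot ε V (jetFlow 1 σ u.1 zeroIdx))) := by
    rw [← continuousOn_univ]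
    refine continuousOn_pair (hD'.comp continuous_snd).continuousOn (Continuous.continuousOn ?_)
    exact hV.continuous_pot hε (continuous_jetFlow (continuous_subtype_val.comp continuous_fst)
      continuous_snd) fun x => testJets_le_weakJets ((isInvariant_testJets ε).jetFlow_mem _ _ x.1.2)
  have hFi := intervalIntegral.continuous_parametric_intervalIntegral_of_continuous'
    (μ := volume) hF s s'
  have hL : Continuous fun u : testJets n 1 => pair (D s') ((flow s').onL2 (u.1 zeroIdx)) -
      pair (D s) ((flow s).onL2 (u.1 zeroIdx)) := by
    have h1 : ∀ σ, Continuous fun u : testJets n 1 => pair (D σ) ((flow σ).onL2 (u.1 zeroIdx)) :=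
      fun σ => (pair (D σ)).continuous.comp ((flow σ).onL2.continuous.comp
        ((continuous_apply zeroIdx).comp continuous_subtype_val))
    exact (h1 s').sub (h1 s)
  obtain ⟨x, hx, hxu⟩ := mem_closure_iff_seq_limit.1 (show u ∈ closure _ from hu)
  choose φ hφ using hx
  have hlim : Tendsto (fun k => (⟨jet n 1 (φ k), jet_mem_testJets _⟩ : testJets n 1)) atTop
      (𝓝 ⟨u, hu⟩) := by
    rw [tendsto_subtype_rng]
    simpa only [hφ] using hxu
  rw [hint]
  refine tendsto_nhds_unique ((hL.tendsto ⟨u, hu⟩).comp hlim)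
    (((hFi.tendsto ⟨u, hu⟩).comp hlim).congr fun k => ?_)
  simp only [Function.comp_apply]
  rw [← hint]
  have hjet : ∀ σ, jetFlow 1 σ (jet n 1 (φ k)) zeroIdx = (flow σ).onL2 (toL2 (φ k)) := fun σ => by
    rw [jetFlow, jetMap_zeroIdx, jet_zeroIdx]
  simp only [hjet, jet_zeroIdx]
  have hsub' : ∀ σ ∈ Set.Ioo (min s s') (max s s'), Set.Icc 0 T ∈ 𝓝 σ := fun σ hσ =>
    Filter.mem_of_superset (Icc_mem_nhds hσ.1 hσ.2) hsub
  refine intervalIntegral.integral_eq_sub_of_hasDeriv_right (fun σ hσ =>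
    ((h.hasDerivWithinAt_pair_flow hV hε (φ k) (hsub hσ)).continuousWithinAt.mono hsub))
    (fun σ hσ => ((h.hasDerivWithinAt_pair_flow hV hε (φ k)
      (hsub (Set.Ioo_subset_Icc_self hσ))).hasDerivAt (hsub' σ hσ)).hasDerivWithinAt) ?_
  refine ContinuousOn.intervalIntegrable (continuousOn_pair (h.continuousOn.mono hsub)
    (Continuous.continuousOn ?_))
  simp only [← hjet]
  exact hV.continuous_pot hε (continuous_jetFlow continuous_const continuous_id) fun x =>
    (isInvariant_weakJets ε).jetFlow_mem _ _ (testJets_le_weakJets (jet_mem_testJets _))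

/-- Duality: `D s` is paired with the truncated evolution that equals `φ` at time `t`. The truncated
part of the generator cancels, the remaining derivative is the error of the potential, and the
pairing vanishes at `s = 0` because `D 0 = 0`. -/
theorem norm_pair_toL2_le (h : IsNullSolution ε V T D) (hV : IsPotential V) (hε : 0 < ε)
    (A : Approx ε T V) (j : ℕ) (φ : Test n) {B : ℝ} (hB : ∀ s ∈ Set.Icc 0 T, ‖D s‖ ≤ B) {t : ℝ}
    (ht : t ∈ Set.Icc 0 T) :
    ‖pair (D t) (toL2 φ)‖ ≤ B * (A.err j * ∑ α, ‖jet n 1 φ α‖) * t := by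
  have htT : Set.Icc 0 t ⊆ Set.Icc 0 T := Set.Icc_subset_Icc_right ht.2
  have hB0 : 0 ≤ B := (norm_nonneg _).trans (hB t ht)
  have hφw : jet n 1 φ ∈ weakJets n 1 := testJets_le_weakJets (jet_mem_testJets φ)
  set r : ℝ → L2 n := fun s => (flow (-t)).onL2 (evol ε (A.isTruncated j) (toL2 φ) (s - t)) with hr
  have hrE : IsEvol ε (A.v j) r := (isEvol_evol ε (A.isTruncated j) (toL2 φ)).shift t
  have hUr : ∀ s, (flow s).onL2 (r s) = A.prop j (s - t) (toL2 φ) := fun s => by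
    rw [hr, Approx.prop, propagator]
    dsimp only
    rw [flow_add, ← sub_eq_add_neg]
  -- The backward evolution of `φ` to time `0`, as a limit of jets of test functions; it serves as
  -- the initial value for the jet of `r`, along which the weak equation may be used.
  obtain ⟨u, hu, hu0, -⟩ := A.exists_jet_prop hε (isInvariant_testJets ε) testJets_le_weakJets
    (jet_mem_testJets φ) (show |(-t)| ≤ T by rw [abs_neg, abs_of_nonneg ht.1]; exact ht.2) j
  have hur : u zeroIdx = r 0 := by
    rw [hu0, jet_zeroIdx, ← flow_zero (r 0), hUr, zero_sub]
  obtain ⟨y, -, hyK, hy, hyr⟩ := exists_jet_evol (A.isTruncated j) (isInvariant_testJets ε) hrE hu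
    hur t
  have hsub : Set.Icc 0 t ⊆ Set.Icc (-t) t := Set.Icc_subset_Icc_left (by linarith [ht.1])
  obtain ⟨Y, hYc, hYy, hYK⟩ : ∃ Y : ℝ → Jet n 1, Continuous Y ∧ (∀ s ∈ Set.Icc 0 t, Y s = y s) ∧
      ∀ s, Y s ∈ testJets n 1 := by
    have hc : ContinuousOn y (Set.Icc 0 t) := fun s hs =>
      (hy s (hsub hs)).continuousAt.continuousWithinAt
    exact ⟨Set.IccExtend ht.1 ((Set.Icc 0 t).domRestrict y), hc.domRestrict.Icc_extend',
      fun s hs => by rw [Set.IccExtend_of_mem _ _ hs, Set.domRestrict_apply], fun s => hyK _⟩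
  have hYr : ∀ s ∈ Set.Icc 0 t, Y s zeroIdx = r s := fun s hs => by rw [hYy s hs, hyr s (hsub hs)]
  set K : ℝ → ℝ → ℂ := fun σ s => pair (D σ) (pot ε V (jetFlow 1 σ (Y s) zeroIdx)) with hK
  have hKc : ContinuousOn (Function.uncurry K) (Set.Icc 0 t ×ˢ Set.Icc 0 t) := by
    refine continuousOn_pair (h.continuousOn.comp continuousOn_fst fun x hx => htT hx.1)
      (Continuous.continuousOn ?_)
    exact hV.continuous_pot hε (continuous_jetFlow (hYc.comp continuous_snd) continuous_fst)
      fun x => testJets_le_weakJets ((isInvariant_testJets ε).jetFlow_mem _ _ (hYK _))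
  have hd : ∀ s ∈ Set.Icc 0 t, HasDerivWithinAt (fun s => pair (D s) ((flow s).onL2 (r s)))
      (pair (D s) (pot ε V (A.prop j (s - t) (toL2 φ)) -
        pot ε (A.v j) (A.prop j (s - t) (toL2 φ)))) (Set.Icc 0 t) s := fun s hs => by
    have hL : HasDerivWithinAt (fun ρ => pair (D s) ((flow s).onL2 (r ρ)))
        (pair (D s) ((flow s).onL2 (gen ε (A.v j) s (r s)))) (Set.Icc 0 t) s :=
      (((pair (D s) ∘L (flow s).onL2).restrictScalars ℝ).hasFDerivAt.comp_hasDerivAt s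
        (hrE s)).hasDerivWithinAt
    have key := hasDerivWithinAt_diag (H := fun s ρ => pair (D s) ((flow s).onL2 (r ρ))) hKc
      (fun a ha b hb ρ hρ => by
        rw [← hYr ρ hρ]
        exact h.pair_flow_sub_eq_integral hV hε (hYK ρ) (htT ha) (htT hb)) hs hL
    refine key.congr_deriv ?_
    rw [hK]
    dsimp only
    rw [jetFlow, jetMap_zeroIdx, hYr s hs, gen, map_neg, flow_flow_neg, hUr, map_neg, map_sub]
    exact (sub_eq_add_neg _ _).symm
  have hb : ∀ s ∈ Set.Icc 0 t, ‖pair (D s) (pot ε V (A.prop j (s - t) (toL2 φ)) -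
      pot ε (A.v j) (A.prop j (s - t) (toL2 φ)))‖ ≤ B * (A.err j * ∑ α, ‖jet n 1 φ α‖) :=
    fun s hs => by
    have habs : |s - t| ≤ T := by
      rw [abs_le]
      constructor <;> linarith [hs.1, hs.2, ht.1, ht.2]
    have h1 := A.norm_pot_sub_pot_prop_le hε hφw habs j
    rw [jet_zeroIdx] at h1
    exact (norm_pair_le _ _).trans (mul_le_mul (hB s (htT hs)) h1 (norm_nonneg _) hB0)
  have hmv := (convex_Icc 0 t).norm_image_sub_le_of_norm_hasDerivWithin_le (𝕜 := ℝ) hd hb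
    (Set.left_mem_Icc.2 ht.1) (Set.right_mem_Icc.2 ht.1)
  have hD0 : D 0 = 0 := eq_of_pair_toL2_eq fun ψ => by
    rw [h.weak ψ 0 (Set.left_mem_Icc.2 (ht.1.trans ht.2)), intervalIntegral.integral_same, map_zero,
      zero_apply]
  rw [hUr t, sub_self, Approx.prop, propagator_zero, hD0, map_zero, zero_apply, sub_zero, sub_zero,
    Real.norm_eq_abs, abs_of_nonneg ht.1] at hmv
  exact hmv

theorem eq_zero (h : IsNullSolution ε V T D) (hV : IsPotential V) (hε : 0 < ε) {t : ℝ}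
    (ht : t ∈ Set.Icc 0 T) : D t = 0 := by
  obtain ⟨A⟩ := hV.nonempty_approx hε (ht.1.trans ht.2)
  obtain ⟨B, -, hB⟩ := h.exists_bound
  refine eq_of_pair_toL2_eq fun φ => ?_
  rw [map_zero, zero_apply, ← norm_le_zero_iff]
  have hlim : Tendsto (fun j => B * (A.err j * ∑ α, ‖jet n 1 φ α‖) * t) atTop (𝓝 0) := by
    simpa using ((A.tendsto_err.mul_const (∑ α, ‖jet n 1 φ α‖)).const_mul B).mul_const t
  exact ge_of_tendsto' hlim fun j => h.norm_pair_toL2_le hV hε A j φ hB ht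

end IsNullSolution

end

section

open MvPolynomial

/-! ### Sobolev norms and jets -/

/-- `g` is the weak derivative of `f` with the multi-index `α`. -/
def IsWeakDeriv (α : Idx n →₀ ℕ) (f g : L2 n) : Prop :=
  ∀ φ : Test n, pair f (toL2 (diffOpNeg (monomial α 1) φ)) = pair g (toL2 φ)

theorem hasWeakDeriv_iff (α : Idx n →₀ ℕ) (f g : L2 n) :
    HasWeakDeriv (fun i => α (Sum.inl i)) (fun i => α (Sum.inr i)) f g ↔ IsWeakDeriv α f g := by
  have hsign : ((-1 : ℂ) ^ α.degree) * (-1) ^ α.degree = 1 := by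
    rw [← mul_pow, neg_one_mul, neg_neg, one_pow]
  have h : ∀ φ : Test n, pair f (toL2 (diffOpNeg (monomial α 1) φ)) = (-1) ^ α.degree *
      ∫ z, f z * mixedDeriv (fun i => α (Sum.inl i)) (fun i => α (Sum.inr i)) φ.1 z := fun φ => by
    rw [diffOpNeg_monomial, LinearMap.smul_apply, map_smul, map_smul, smul_eq_mul, pair_toL2,
      ← coe_monoDeriv]
  have hd : ∑ i, α (Sum.inl i) + ∑ i, α (Sum.inr i) = α.degree := (degree_eq_add α).symm
  constructor
  · intro hfg φ
    rw [h, hfg φ.1 φ.2, hd, ← mul_assoc, hsign, one_mul, pair_toL2]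
  · intro hfg φ hφ
    have h1 := hfg ⟨φ, hφ⟩
    rw [h, pair_toL2] at h1
    rw [hd, ← h1, ← mul_assoc, hsign, one_mul]

theorem IsWeakDeriv.unique {α : Idx n →₀ ℕ} {f g g' : L2 n} (h : IsWeakDeriv α f g)
    (h' : IsWeakDeriv α f g') : g = g' :=
  eq_of_pair_toL2_eq fun φ => by rw [← h φ, h' φ]

theorem isWeakDeriv_zero (f : L2 n) : IsWeakDeriv 0 f f := fun φ => by
  have : (monomial 0 1 : MvPolynomial (Idx n) ℂ) = C 1 := rfl
  rw [this, diffOpNeg_C, one_smul, Module.End.one_apply]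

/-- The norm of the weak derivative with the multi-index `α`. -/
def weakNorm (α : Idx n →₀ ℕ) (f : L2 n) : ℝ≥0∞ :=
  derivNorm (fun i => α (Sum.inl i)) (fun i => α (Sum.inr i)) f

theorem IsWeakDeriv.weakNorm_eq {α : Idx n →₀ ℕ} {f g : L2 n} (h : IsWeakDeriv α f g) :
    weakNorm α f = ‖g‖ₑ := by
  refine le_antisymm (iInf₂_le g ((hasWeakDeriv_iff α f g).2 h)) (le_iInf₂ fun g' hg' => ?_)
  rw [h.unique ((hasWeakDeriv_iff α f g').1 hg')]

theorem exists_isWeakDeriv {α : Idx n →₀ ℕ} {f : L2 n} (h : weakNorm α f ≠ ⊤) :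
    ∃ g, IsWeakDeriv α f g := by
  by_contra hc
  push Not at hc
  refine h (iInf₂_eq_top.2 fun g hg => absurd ((hasWeakDeriv_iff α f g).1 hg) (hc g))

/-- If the functional `φ ↦ ∫ f ∂^α φ` is bounded in `L²`, the Riesz theorem represents it by an `L²`
function, which is then the weak derivative. The right-hand side is a closed condition on `f`,
whence lower semicontinuity. -/
theorem weakNorm_le_iff (α : Idx n →₀ ℕ) (f : L2 n) (c : NNReal) :
    weakNorm α f ≤ c ↔
      ∀ φ : Test n, ‖pair f (toL2 (diffOpNeg (monomial α 1) φ))‖ ≤ c * ‖toL2 φ‖ := by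
  constructor
  · intro h φ
    obtain ⟨g, hg⟩ := exists_isWeakDeriv (ne_top_of_le_ne_top ENNReal.coe_ne_top h)
    rw [hg.weakNorm_eq, enorm_le_coe] at h
    rw [hg φ]
    exact (norm_pair_le _ _).trans (mul_le_mul_of_nonneg_right h (norm_nonneg _))
  · intro h
    set l : Test n →ₗ[ℂ] ℂ := (pair f).toLinearMap ∘ₗ toL2 ∘ₗ diffOpNeg (monomial α 1)
    have hl : ∀ φ, ‖l φ‖ ≤ c * ‖toL2 φ‖ := h
    obtain ⟨g, hg, hgl⟩ := exists_pair_eq (l.extendOfNorm toL2) c.2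
      (LinearMap.norm_extendOfNorm_apply_le denseRange_toL2 c hl)
    have hw : IsWeakDeriv α f g := fun φ => by
      rw [hgl, LinearMap.extendOfNorm_eq denseRange_toL2 ⟨c, hl⟩]
      rfl
    rw [hw.weakNorm_eq, enorm_le_coe]
    exact hg

theorem lowerSemicontinuous_weakNorm (α : Idx n →₀ ℕ) :
    LowerSemicontinuous (weakNorm α : L2 n → ℝ≥0∞) := by
  rw [lowerSemicontinuous_iff_isClosed_preimage]
  intro c
  rcases eq_or_ne c ⊤ with rfl | hc
  · simp
  lift c to NNReal using hc
  have h : weakNorm α ⁻¹' Set.Iic (c : ℝ≥0∞) = ⋂ φ : Test n,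
      {f | ‖pair f (toL2 (diffOpNeg (monomial α 1) φ))‖ ≤ c * ‖toL2 φ‖} := by
    ext f
    simp [weakNorm_le_iff]
  rw [h]
  exact isClosed_iInter fun φ => isClosed_le (by fun_prop) (by fun_prop)

theorem sobolevNorm_eq_sum (m : ℕ) (f : L2 n) :
    sobolevNorm m f = ∑ α ∈ multiIdx n m, weakNorm α f := by
  rw [sobolevNorm, ← Finset.sum_fiberwise_of_maps_to (s := multiIdx n m)
    (t := Finset.range (m + 1)) (g := fun α => α.degree)
    fun α hα => Finset.mem_range.2 (Nat.lt_succ_of_le (mem_multiIdx.1 hα))]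
  refine Finset.sum_congr rfl fun j hj => ?_
  refine Finset.sum_bij' (fun α _ => Finsupp.equivFunOnFinite.symm α) (fun α _ => ⇑α) ?_ ?_ ?_ ?_ ?_
  · intro α hα
    have h1 : (Finsupp.equivFunOnFinite.symm α).degree = j := by
      rw [Finsupp.degree_eq_sum]
      exact (Finset.mem_piAntidiag.1 hα).1
    rw [Finset.mem_filter, mem_multiIdx, h1]
    exact ⟨Nat.le_of_lt_succ (Finset.mem_range.1 hj), rfl⟩
  · intro α hα
    rw [Finset.mem_piAntidiag, ← Finsupp.degree_eq_sum]
    exact ⟨(Finset.mem_filter.1 hα).2, fun _ _ => Finset.mem_univ _⟩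
  · intro α _
    rfl
  · intro α _
    simp
  · intro α _
    rfl

theorem lowerSemicontinuous_sobolevNorm (m : ℕ) :
    LowerSemicontinuous (sobolevNorm m : L2 n → ℝ≥0∞) := by
  have h : (sobolevNorm m : L2 n → ℝ≥0∞) = fun f => ∑ α ∈ multiIdx n m, weakNorm α f :=
    funext (sobolevNorm_eq_sum m)
  rw [h]
  exact lowerSemicontinuous_sum fun α _ => lowerSemicontinuous_weakNorm α

theorem sobolevNorm_of_mem_weakJets {u : Jet n m} (hu : u ∈ weakJets n m) :
    sobolevNorm m (u zeroIdx) = ENNReal.ofReal (∑ α, ‖u α‖) := by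
  rw [sobolevNorm_eq_sum, ← Finset.sum_coe_sort (multiIdx n m),
    ENNReal.ofReal_sum_of_nonneg fun _ _ => norm_nonneg _]
  refine Finset.sum_congr rfl fun α _ => ?_
  rw [IsWeakDeriv.weakNorm_eq (g := u α) fun φ => hu α φ, ofReal_norm]

theorem exists_mem_weakJets {f : L2 n} (h : sobolevNorm m f ≠ ⊤) :
    ∃ u ∈ weakJets n m, u zeroIdx = f := by
  rw [sobolevNorm_eq_sum] at h
  have h1 : ∀ α : multiIdx n m, ∃ g, IsWeakDeriv α.1 f g := fun α =>
    exists_isWeakDeriv (ne_top_of_le_ne_top h (Finset.single_le_sum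
      (f := fun α => weakNorm α f) (fun _ _ => zero_le) α.2))
  choose u hu using h1
  have h0 : u zeroIdx = f := (hu zeroIdx).unique (isWeakDeriv_zero f)
  refine ⟨u, fun α φ => ?_, h0⟩
  rw [h0]
  exact hu α φ

/-! ### The bounds for the limit -/

theorem sobolevNorm_propagator_le {ε : ℝ} (hε : 0 < ε) {v : Config n → ℂ} (hv : IsTruncated v)
    {M : ℝ} (hM : moment m v ≤ M) (f : L2 n) (t : ℝ) :
    sobolevNorm m (propagator ε hv t f) ≤
      ENNReal.ofReal (Real.exp (growthRate m n M * |t|)) * sobolevNorm m f := by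
  by_cases h : sobolevNorm m f = ⊤
  · rw [h, ENNReal.mul_top (by simpa using Real.exp_pos _)]
    exact le_top
  obtain ⟨u, hu, rfl⟩ := exists_mem_weakJets h
  obtain ⟨z, hz, hz0, hzu⟩ := exists_jet_propagator hε hv hM (isInvariant_weakJets ε) le_rfl hu t
  rw [← hz0, sobolevNorm_of_mem_weakJets hz, sobolevNorm_of_mem_weakJets hu,
    ← ENNReal.ofReal_mul (Real.exp_nonneg _)]
  exact ENNReal.ofReal_le_ofReal hzu

/-- Scaling of `g` into the unit ball, carried out on its jet, where the Sobolev norm is a plain sum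
of norms. -/
theorem enorm_pair_le_dualSobolevNorm {f g : L2 n} {c : ℝ} (hc : 0 < c)
    (hg : sobolevNorm m g ≤ ENNReal.ofReal c) :
    ‖pair f g‖ₑ ≤ ENNReal.ofReal c * dualSobolevNorm m f := by
  obtain ⟨u, hu, rfl⟩ := exists_mem_weakJets (ne_top_of_le_ne_top ENNReal.ofReal_ne_top hg)
  set w : Jet n m := ((c⁻¹ : ℝ) : ℂ) • u with hw
  have hwm : w ∈ weakJets n m := Submodule.smul_mem _ _ hu
  have hw1 : sobolevNorm m (w zeroIdx) ≤ 1 := by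
    rw [sobolevNorm_of_mem_weakJets hu, ENNReal.ofReal_le_ofReal_iff hc.le] at hg
    rw [sobolevNorm_of_mem_weakJets hwm, ENNReal.ofReal_le_one]
    simp only [hw, Pi.smul_apply, norm_smul, Complex.norm_real, Real.norm_eq_abs,
      abs_of_pos (inv_pos.2 hc)]
    rw [← Finset.mul_sum]
    calc c⁻¹ * ∑ α, ‖u α‖ ≤ c⁻¹ * c := by gcongr
      _ = 1 := inv_mul_cancel₀ hc.ne'
  have hle : ‖pair f (w zeroIdx)‖ₑ ≤ dualSobolevNorm m f :=
    le_iSup₂ (f := fun (g : L2 n) (_ : sobolevNorm m g ≤ 1) => ‖∫ z, f z * g z‖ₑ)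
      (w zeroIdx) hw1
  have hpair : pair f (u zeroIdx) = (c : ℂ) * pair f (w zeroIdx) := by
    rw [hw, Pi.smul_apply, map_smul, smul_eq_mul, ← mul_assoc, ← Complex.ofReal_mul,
      mul_inv_cancel₀ hc.ne', Complex.ofReal_one, one_mul]
  have hcn : ‖(c : ℂ)‖ₑ = ENNReal.ofReal c := by
    rw [← ofReal_norm, Complex.norm_real, Real.norm_eq_abs, abs_of_pos hc]
  rw [hpair, enorm_mul, hcn]
  exact mul_le_mul_right hle _

/-- The propagator is transposed onto `g`, and the Sobolev bound is used for time `-t`. -/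
theorem enorm_pair_propagator_le {ε : ℝ} (hε : 0 < ε) {v : Config n → ℂ} (hv : IsTruncated v)
    {M : ℝ} (hM : moment m v ≤ M) (f : L2 n) {g : L2 n} (hg : sobolevNorm m g ≤ 1) (t : ℝ) :
    ‖pair (propagator ε hv t f) g‖ₑ ≤
      ENNReal.ofReal (Real.exp (growthRate m n M * |t|)) * dualSobolevNorm m f := by
  rw [pair_propagator]
  refine enorm_pair_le_dualSobolevNorm (Real.exp_pos _)
    ((sobolevNorm_propagator_le hε hv hM g (-t)).trans ?_)
  rw [abs_neg]
  exact mul_le_of_le_one_right zero_le hg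

end

/-! ### Uniqueness, existence and the two bounds for the original potential -/

section

variable {ε T : ℝ} {V : Config n → ℂ}

theorem IsPotential.of_integrable (hmeas : AEStronglyMeasurable V)
    (hherm : ∀ᵐ S, V (-S) = (starRingEnd ℂ) (V S))
    (hint : Integrable fun S => ‖V S‖ * (‖S‖ + ‖S‖ ^ (m + 1))) : IsPotential V where
  aestronglyMeasurable := hmeas
  herm := hherm
  integrable := by
    refine hint.mono' (hmeas.norm.mul continuous_norm.aestronglyMeasurable)
      (Eventually.of_forall fun S => ?_)
    rw [norm_mul, norm_norm, norm_norm]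
    exact mul_le_mul_of_nonneg_left (le_add_of_nonneg_right (by positivity)) (norm_nonneg _)

/-- The truncations are dominated by `V`, so the growth rate of order `m` is uniform in `j`, unlike
the first order rate used for convergence. -/
theorem Approx.moment_le (A : Approx ε T V)
    (hint : Integrable fun S => ‖V S‖ * (‖S‖ + ‖S‖ ^ (m + 1))) (j : ℕ) :
    moment m (A.v j) ≤ moment m V :=
  integral_mono_of_nonneg (Eventually.of_forall fun S => by positivity) hint
    (Eventually.of_forall fun S => mul_le_mul_of_nonneg_right (A.norm_le j S) (by positivity))

theorem IsPotential.isSolution_unique (hV : IsPotential V) (hε : 0 < ε) {f : L2 n}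
    {W W' : ℝ → L2 n} (hW : IsSolution ε V T f W) (hW' : IsSolution ε V T f W') {t : ℝ}
    (ht : t ∈ Set.Icc 0 T) : W' t = W t := by
  obtain ⟨h1, -, h3⟩ := (hV.isSolution_iff hε).1 hW
  obtain ⟨h1', -, h3'⟩ := (hV.isSolution_iff hε).1 hW'
  have hD : IsNullSolution ε V T fun s => W' s - W s := by
    refine ⟨h1'.sub h1, fun φ t ht => ?_⟩
    have hi : ∀ {w : ℝ → L2 n}, ContinuousOn w (Set.Icc 0 T) → IntervalIntegrable
        (fun s => pair (w s) (toL2 (transport φ) + pot ε V (toL2 φ))) volume 0 t := fun hw =>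
      ((continuousOn_pair hw continuousOn_const).mono (by
        rw [Set.uIcc_of_le ht.1]
        exact Set.Icc_subset_Icc_right ht.2)).intervalIntegrable
    have h4 := h3 φ t ht
    have h5 := h3' φ t ht
    simp only [map_sub, sub_apply]
    rw [intervalIntegral.integral_sub (hi h1') (hi h1), ← h4, ← h5]
    ring
  exact sub_eq_zero.1 (hD.eq_zero hV hε ht)

theorem Approx.isSolution_limit (A : Approx ε T V) (hV : IsPotential V) (hε : 0 < ε) (hT : 0 ≤ T)
    {f : L2 n} {W : ℝ → L2 n}
    (hW : TendstoUniformlyOn (fun j t => A.prop j t f) W atTop (Set.Icc 0 T)) :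
    IsSolution ε V T f W := by
  refine (hV.isSolution_iff hε).2 ⟨?_, ?_, fun φ t ht => A.pair_limit_sub_eq_integral hW φ ht⟩
  · exact hW.continuousOn (Eventually.of_forall fun j =>
      (continuous_propagator ε (A.isTruncated j) f).continuousOn).frequently
  · refine tendsto_nhds_unique (hW.tendsto_at (Set.left_mem_Icc.2 hT)) ?_
    simp only [prop, propagator_zero]
    exact tendsto_const_nhds

/-- Convergence holds only in `L²`; lower semicontinuity makes the sublevel sets of the Sobolev norm
closed there. If the right-hand side is infinite, nothing is lost. -/
theorem Approx.sobolevNorm_limit_le (A : Approx ε T V) (hε : 0 < ε)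
    (hint : Integrable fun S => ‖V S‖ * (‖S‖ + ‖S‖ ^ (m + 1))) {f w : L2 n} {t : ℝ} (ht : 0 ≤ t)
    (hw : Tendsto (fun j => A.prop j t f) atTop (𝓝 w)) :
    sobolevNorm m w ≤ ENNReal.ofReal (Real.exp (t * rate m n V)) * sobolevNorm m f := by
  refine ((lowerSemicontinuous_iff_isClosed_preimage.1 (lowerSemicontinuous_sobolevNorm m)
    _).mem_of_tendsto hw (Eventually.of_forall fun j => ?_) :)
  have h := sobolevNorm_propagator_le hε (A.isTruncated j) (A.moment_le hint j) f t
  rw [abs_of_nonneg ht, mul_comm (growthRate m n (moment m V))] at h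
  exact h

theorem Approx.dualSobolevNorm_limit_le (A : Approx ε T V) (hε : 0 < ε)
    (hint : Integrable fun S => ‖V S‖ * (‖S‖ + ‖S‖ ^ (m + 1))) {f w : L2 n} {t : ℝ} (ht : 0 ≤ t)
    (hw : Tendsto (fun j => A.prop j t f) atTop (𝓝 w)) :
    dualSobolevNorm m w ≤ ENNReal.ofReal (Real.exp (t * rate m n V)) * dualSobolevNorm m f := by
  refine iSup₂_le fun g hg => ?_
  refine le_of_tendsto (tendsto_pair hw tendsto_const_nhds).enorm
    (Eventually.of_forall fun j => ?_)
  have h := enorm_pair_propagator_le hε (A.isTruncated j) (A.moment_le hint j) f hg t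
  rwa [abs_of_nonneg ht, mul_comm (growthRate m n (moment m V))] at h

end

end Wigner

end

theorem theorem2p2 (m n : ℕ) (ε : ℝ) (hε : 0 < ε)
    (Vhat : Wigner.Config n → ℂ) (hmeas : AEStronglyMeasurable Vhat volume)
    (hherm : ∀ᵐ S, Vhat (-S) = (starRingEnd ℂ) (Vhat S))
    (hint : Integrable fun S => ‖Vhat S‖ * (‖S‖ + ‖S‖ ^ (m + 1)))
    (T : ℝ) (hT : 0 ≤ T) (W₀ : Wigner.L2 n) :
    ∃ W : ℝ → Wigner.L2 n, Wigner.IsSolution ε Vhat T W₀ W ∧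
      (∀ W' : ℝ → Wigner.L2 n, Wigner.IsSolution ε Vhat T W₀ W' →
        ∀ t ∈ Set.Icc 0 T, W' t = W t) ∧
      ∀ t ∈ Set.Icc 0 T,
        Wigner.sobolevNorm m (W t) ≤
            ENNReal.ofReal (Real.exp (t * Wigner.rate m n Vhat)) * Wigner.sobolevNorm m W₀ ∧
        Wigner.dualSobolevNorm m (W t) ≤
            ENNReal.ofReal (Real.exp (t * Wigner.rate m n Vhat)) *
              Wigner.dualSobolevNorm m W₀ := by
  have hV := Wigner.IsPotential.of_integrable hmeas hherm hint
  obtain ⟨A⟩ := hV.nonempty_approx hε hT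
  obtain ⟨W, hW⟩ := A.exists_limit hε W₀
  have hsol := A.isSolution_limit hV hε hT hW
  exact ⟨W, hsol, fun W' hW' t ht => hV.isSolution_unique hε hsol hW' ht, fun t ht =>
    ⟨A.sobolevNorm_limit_le hε hint ht.1 (hW.tendsto_at ht),
      A.dualSobolevNorm_limit_le hε hint ht.1 (hW.tendsto_at ht)⟩⟩
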